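/- An orthogonal polyhedron is a connected $3$-manifold with boundary in $\mathbb{R}^3$ that is the union of finitely many boxes (cuboids with edges parallel to the coordinate axes). It is $2$-reflex if its reflex edges have at most two different directions. Its genus is the genus of its boundary surface. Two points of a polyhedron $P$ see each other if the segment joining them lies in $P$. A set of closed (respectively, open) edge guards, i.e. of edges of $P$ taken with (respectively, without) their endpoints, guards $P$ if every point of $P$ is seen by at least one point of some guard in the set. Theorem. Let $P$ be a non-convex $2$-reflex orthogonal polyhedron with $m$ edges in total (convex and reflex) and genus $g$. Then $P$ can be guarded by a set of at most $$\left\lfloor \frac{m-4}{8} \right\rfloor + g$$ closed edge guards, all of them lying on reflex edges of $P$; the same holds with open edge guards. -/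

import Mathlib

open Set Filter Topology

/-- Three-dimensional space. Only its topology and its affine structure are used. -/
abbrev Space : Type := Fin 3 → ℝ

/-- A box: a nondegenerate closed cuboid whose edges are parallel to the coordinate axes. -/
def IsBox (B : Set Space) : Prop :=
  ∃ a b : Space, (∀ i, a i < b i) ∧ B = Icc a b

/-- `P` is a 3-manifold with boundary in space: around each of its points there is a local chart
of the ambient space that carries `P` to the closed half-space `{v | 0 ≤ v 0}`. (The chart is only
defined on an open set and its image need not meet the plane `v 0 = 0`, so that interior points are
covered as well.) -/
def IsManifoldInSpace (P : Set Space) : Prop :=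
  ∀ x ∈ P, ∃ φ : OpenPartialHomeomorph Space Space,
    x ∈ φ.source ∧ ∀ y ∈ φ.source, (y ∈ P ↔ 0 ≤ φ y 0)

/-- An orthogonal polyhedron: a connected 3-manifold with boundary in space that is the union of
finitely many boxes. -/
structure IsOrthogonalPolyhedron (P : Set Space) : Prop where
  connected : IsConnected P
  manifold : IsManifoldInSpace P
  union_boxes : ∃ S : Set (Set Space), S.Finite ∧ (∀ B ∈ S, IsBox B) ∧ P = ⋃₀ S

/-- The points in the relative interior of the convex edges of `P` parallel to the `i`-th axis:
near such a point, `P` is a wedge of 90 degrees, the intersection of two orthogonal half-spaces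
whose bounding planes pass through the point and are parallel to the `i`-th axis. The signs
`σ j`, `j ≠ i`, tell on which side the half-spaces lie. -/
def convexEdgePoints (P : Set Space) (i : Fin 3) : Set Space :=
  {p | ∃ σ : Fin 3 → ℝ, (∀ j, σ j = 1 ∨ σ j = -1) ∧
    ∀ᶠ q in 𝓝 p, (q ∈ P ↔ ∀ j, j ≠ i → 0 ≤ σ j * (q j - p j))}

/-- The points in the relative interior of the reflex edges of `P` parallel to the `i`-th axis:
near such a point, `P` is a wedge of 270 degrees, the union of two orthogonal half-spaces. -/
def reflexEdgePoints (P : Set Space) (i : Fin 3) : Set Space :=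
  {p | ∃ σ : Fin 3 → ℝ, (∀ j, σ j = 1 ∨ σ j = -1) ∧
    ∀ᶠ q in 𝓝 p, (q ∈ P ↔ ∃ j, j ≠ i ∧ 0 ≤ σ j * (q j - p j))}

/-- The convex edges of `P` parallel to the `i`-th axis, each represented as an open segment
(without its endpoints). -/
def convexEdgesAlong (P : Set Space) (i : Fin 3) : Set (Set Space) :=
  {e | ∃ p ∈ convexEdgePoints P i, e = connectedComponentIn (convexEdgePoints P i) p}

/-- The reflex edges of `P` parallel to the `i`-th axis, each represented as an open segment
(without its endpoints). -/
def reflexEdgesAlong (P : Set Space) (i : Fin 3) : Set (Set Space) :=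
  {e | ∃ p ∈ reflexEdgePoints P i, e = connectedComponentIn (reflexEdgePoints P i) p}

/-- The reflex edges of `P`. -/
def reflexEdges (P : Set Space) : Set (Set Space) :=
  ⋃ i, reflexEdgesAlong P i

/-- All edges of `P`, convex or reflex. -/
def polyhedronEdges (P : Set Space) : Set (Set Space) :=
  (⋃ i, convexEdgesAlong P i) ∪ reflexEdges P

/-- The reflex edges of `P` have at most two different directions. -/
def IsTwoReflex (P : Set Space) : Prop :=
  ∃ i, reflexEdgesAlong P i = ∅

/-- The surface `S` contains `n` pairwise disjoint simple closed curves which together do not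
separate it: two points of `S` off the curves that lie in the same component of `S` can still be
connected in `S` when the curves are removed. -/
def HasNonseparatingCurves (S : Set Space) (n : ℕ) : Prop :=
  ∃ γ : Fin n → Circle → Space,
    (∀ k, Continuous (γ k)) ∧ (∀ k, Function.Injective (γ k)) ∧ (∀ k, range (γ k) ⊆ S) ∧
    Pairwise (fun k l => Disjoint (range (γ k)) (range (γ l))) ∧
    ∀ x ∈ S \ ⋃ k, range (γ k), ∀ y ∈ S \ ⋃ k, range (γ k),
      y ∈ connectedComponentIn S x → y ∈ connectedComponentIn (S \ ⋃ k, range (γ k)) x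

/-- The genus of a polyhedron, i.e. of its boundary surface: the largest number of pairwise disjoint
simple closed curves on the surface which together do not separate it. -/
noncomputable def polyhedronGenus (P : Set Space) : ℕ∞ :=
  ⨆ n ∈ {n : ℕ | HasNonseparatingCurves (frontier P) n}, (n : ℕ∞)

/-- Two points see each other in `P` if the segment joining them lies in `P`. -/
def Sees (P : Set Space) (p q : Space) : Prop :=
  segment ℝ p q ⊆ P

/-- Every point of `P` is seen by some point of one of the edges in `G`, endpoints excluded. -/
def GuardedByOpen (P : Set Space) (G : Set (Set Space)) : Prop :=
  ∀ p ∈ P, ∃ e ∈ G, ∃ q ∈ e, Sees P q p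

/-- Every point of `P` is seen by some point of one of the edges in `G`, endpoints included. -/
def GuardedByClosed (P : Set Space) (G : Set (Set Space)) : Prop :=
  ∀ p ∈ P, ∃ e ∈ G, ∃ q ∈ closure e, Sees P q p

/-!
Call the direction without reflex edges vertical. All vertical edges being convex, the horizontal
cross sections of `P` consist of disjoint rectangles, so that `P` is a stack of boxes, its *bricks*
(`IsBrickwork`, `exists_isBrickwork`): two bricks meet, if at all, in a nondegenerate horizontal
rectangle, their *contact*. Merging bricks as long as possible, one may assume that bricks that
touch each other have different horizontal rectangles (`exists_reduced_isBrickwork`). Then there is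
a reflex edge at each contact, and as bricks are convex, any point of it sees both bricks entirely
(`IsBrickwork.exists_guard`). Hence it suffices to choose contacts that cover all the bricks.

Let `n` be the number of bricks, and choose a spanning tree of the graph formed by the bricks and
their contacts. In the rooted tree, let a brick belong to `I` if none of its children does. Then `I`
is independent, and the contacts of its members with their parents cover all bricks
(`SimpleGraph.Connected.exists_parent`), so `|I|` guards are enough.

The number `m` of edges is bounded from below by counting endpoints. A point that is a corner of
exactly one brick has an odd number of octants in `P`, and therefore it is, for each axis, the
endpoint of exactly one edge in that direction, an edge being the same as a line around which one or
three out of four quadrants are filled (`IsBrickwork.three_mul_card_le`). If `s` is the number of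
points that are shared corners of two bricks, this gives `2 * m ≥ 3 * (8 * n - 2 * s)`. The bricks of
a contact share at most two corners, so the contacts of the tree contribute at most `2 * (n - 1)` to
`s`; they also contribute at most `8 * (n - |I|)`, since each of them involves one of the `n - |I|`
bricks outside of `I`. If there are `k` contacts outside of the tree, then
`3 * s ≤ 8 * (n - |I|) + 2 * (2 * (n - 1)) + 6 * k`, hence `8 * |I| + 4 ≤ m + 6 * k`.

Finally `k ≤ g`: the perimeters of the contacts outside of the tree are disjoint simple closed curves
on the boundary surface that together do not separate it (`IsBrickwork.hasNonseparatingCurves`). The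
side wall of each brick remains connected, each point of its horizontal faces can be joined to the
wall by walking around the contact rectangles (`exists_joinedIn_perimeter`), and the tree contacts
lead from wall to wall.
-/

/-! ### Local connectedness of the interior -/

/-- At every point of a 3-manifold in space, the interior is locally connected: this is the only
consequence of the manifold condition that is used. -/
theorem IsManifoldInSpace.exists_isPreconnected_inter_interior {P : Set Space}
    (hP : IsManifoldInSpace P) {x : Space} (hx : x ∈ P) {U : Set Space} (hU : U ∈ 𝓝 x) :
    ∃ V ∈ 𝓝 x, V ⊆ U ∧ IsPreconnected (V ∩ interior P) := by
  obtain ⟨φ, hxs, hφ⟩ := hP x hx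
  have hmem : φ.target ∩ φ.symm ⁻¹' U ∈ 𝓝 (φ x) := by
    refine inter_mem (φ.open_target.mem_nhds (φ.map_source hxs)) ?_
    refine (φ.symm.continuousAt (φ.map_source hxs)).preimage_mem_nhds ?_
    rwa [φ.left_inv hxs]
  obtain ⟨r, hr, hball⟩ := Metric.mem_nhds_iff.1 hmem
  refine ⟨φ.symm '' Metric.ball (φ x) r, ?_, ?_, ?_⟩
  · have h := φ.symm.image_mem_nhds (φ.map_source hxs) (Metric.ball_mem_nhds (φ x) hr)
    rwa [φ.left_inv hxs] at h
  · rintro _ ⟨y, hy, rfl⟩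
    exact (hball hy).2
  · have key : φ.symm '' Metric.ball (φ x) r ∩ interior P
        = φ.symm '' (Metric.ball (φ x) r ∩ {y | 0 < y 0}) := by
      ext q
      constructor
      · rintro ⟨⟨y, hy, rfl⟩, hq⟩
        refine ⟨y, ⟨hy, ?_⟩, rfl⟩
        have hyt : y ∈ φ.target := (hball hy).1
        have hopen : IsOpen (φ.target ∩ φ.symm ⁻¹' interior P) :=
          φ.symm.isOpen_inter_preimage isOpen_interior
        have hev : ∀ᶠ t : ℝ in 𝓝[>] 0,
            y + t • Pi.single (0 : Fin 3) (-1 : ℝ) ∈ φ.target ∩ φ.symm ⁻¹' interior P := by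
          have hc : Tendsto (fun t : ℝ => y + t • Pi.single (0 : Fin 3) (-1 : ℝ)) (𝓝[>] 0) (𝓝 y) := by
            have : Continuous (fun t : ℝ => y + t • Pi.single (0 : Fin 3) (-1 : ℝ)) := by fun_prop
            simpa using (this.tendsto 0).mono_left nhdsWithin_le_nhds
          exact hc.eventually_mem (hopen.mem_nhds ⟨hyt, hq⟩)
        obtain ⟨t, ⟨ht1, ht2⟩, ht0⟩ := (hev.and self_mem_nhdsWithin).exists
        have h1 := (hφ _ (φ.map_target ht1)).1 (interior_subset ht2)
        rw [φ.right_inv ht1] at h1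
        replace ht0 : 0 < t := ht0
        simp at h1
        show 0 < y 0
        linarith
      · rintro ⟨y, ⟨hy, hy0⟩, rfl⟩
        refine ⟨⟨y, hy, rfl⟩, ?_⟩
        have hyt : y ∈ φ.target := (hball hy).1
        have hopen : IsOpen (φ.source ∩ φ ⁻¹' {y | 0 < y 0}) :=
          φ.isOpen_inter_preimage (isOpen_lt continuous_const (continuous_apply 0))
        refine mem_interior.2 ⟨_, ?_, hopen, φ.map_target hyt, ?_⟩
        · rintro q ⟨hqs, hq⟩
          exact (hφ q hqs).2 (le_of_lt hq)
        · simpa [φ.right_inv hyt] using hy0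
    rw [key]
    refine IsPreconnected.image ?_ _ (φ.continuousOn_symm.mono fun y hy => (hball hy.1).1)
    refine Convex.isPreconnected ((convex_ball _ _).inter ?_)
    exact convex_halfSpace_gt (f := fun y : Space => y 0) ⟨fun _ _ => rfl, fun _ _ => rfl⟩ 0

/-- A manifold cannot look like two boxes that meet along an edge or at a corner only: seen from
`v`, all of `P` lies in two opposite dihedral wedges, and it fills a box in each of them. -/
theorem IsManifoldInSpace.false_of_opposite_wedges {P : Set Space} (hP : IsManifoldInSpace P)
    {v : Space} {j j' : Fin 3} (hj : j ≠ j') {τ : ℝ} (hτ : τ ≠ 0)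
    (hgerm : ∀ᶠ q in 𝓝 v, q ∈ P → (q j ≤ v j ∧ τ * (q j' - v j') ≤ 0) ∨
      (v j ≤ q j ∧ 0 ≤ τ * (q j' - v j')))
    {a b a' b' : Space} (hab : ∀ k, a k < b k) (hab' : ∀ k, a' k < b' k)
    (hA : Icc a b ⊆ P) (hB : Icc a' b' ⊆ P) (hvA : v ∈ Icc a b) (hvB : v ∈ Icc a' b')
    (hb : b j ≤ v j) (ha' : v j ≤ a' j) : False := by
  obtain ⟨V, hV, hVU, hconn⟩ :=
    hP.exists_isPreconnected_inter_interior (hA hvA) (eventually_mem_nhds_iff.2 hgerm)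
  have hint : ∀ c d : Space, interior (Icc c d) = {q | ∀ k, c k < q k ∧ q k < d k} := by
    intro c d
    rw [← pi_univ_Icc, interior_pi_set finite_univ]
    ext q; simp
  have hcl : ∀ c d : Space, (∀ k, c k < d k) → closure (interior (Icc c d)) = Icc c d := by
    intro c d hcd
    have : interior (Icc c d) = pi univ fun k => Ioo (c k) (d k) := by
      rw [hint]; ext q; simp [forall_and]
    rw [this, closure_pi_set, ← pi_univ_Icc]
    exact pi_congr rfl fun k _ => closure_Ioo (hcd k).ne
  -- an interior point of `P` near `v` cannot lie on the plane through `v` between the two wedges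
  have hsplit : V ∩ interior P ⊆ {q | q j < v j} ∪ {q | v j < q j} := by
    rintro q ⟨hqV, hqP⟩
    by_contra hq
    simp only [mem_union, mem_ofPred_eq, not_or, not_lt] at hq
    have hqj : q j = v j := le_antisymm hq.2 hq.1
    have hgq : ∀ᶠ q in 𝓝 q, q ∈ P → (q j ≤ v j ∧ τ * (q j' - v j') ≤ 0) ∨
      (v j ≤ q j ∧ 0 ≤ τ * (q j' - v j')) := hVU hqV
    have hev : ∀ w : Space, ∀ᶠ t : ℝ in 𝓝[>] 0, ((q + t • w) j ≤ v j ∧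
        τ * ((q + t • w) j' - v j') ≤ 0) ∨ (v j ≤ (q + t • w) j ∧ 0 ≤ τ * ((q + t • w) j' - v j')) := by
      intro w
      have hc : Tendsto (fun t : ℝ => q + t • w) (𝓝[>] 0) (𝓝 q) := by
        have : Continuous (fun t : ℝ => q + t • w) := by fun_prop
        simpa using (this.tendsto 0).mono_left nhdsWithin_le_nhds
      filter_upwards [hc.eventually hgq, hc.eventually (mem_interior_iff_mem_nhds.1 hqP)]
        with t h1 h2 using h1 h2
    obtain ⟨t, ⟨h1, h2⟩, ht⟩ := (((hev (Pi.single j (-1) + Pi.single j' τ)).and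
      (hev (Pi.single j 1 + Pi.single j' (-τ)))).and self_mem_nhdsWithin).exists
    replace ht : 0 < t := ht
    simp [hj, hj.symm, hqj] at h1 h2
    have hs : 0 < t * (τ * τ) := mul_pos ht (mul_self_pos.2 hτ)
    rcases h1 with h1 | h1 <;> rcases h2 with h2 | h2 <;> nlinarith
  obtain ⟨q, ⟨hqV, hq1⟩, hq2⟩ : ((V ∩ interior P) ∩ {q | q j < v j}).Nonempty := by
    have : v ∈ closure (interior (Icc a b)) := by rw [hcl _ _ hab]; exact hvA
    obtain ⟨q, hq, hq'⟩ := mem_closure_iff_nhds.1 this V hV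
    refine ⟨q, ⟨hq, interior_mono hA hq'⟩, ?_⟩
    rw [hint] at hq'
    exact (hq' j).2.trans_le hb
  obtain ⟨q', ⟨hqV', hq1'⟩, hq2'⟩ : ((V ∩ interior P) ∩ {q | v j < q j}).Nonempty := by
    have : v ∈ closure (interior (Icc a' b')) := by rw [hcl _ _ hab']; exact hvB
    obtain ⟨q, hq, hq'⟩ := mem_closure_iff_nhds.1 this V hV
    refine ⟨q, ⟨hq, interior_mono hB hq'⟩, ?_⟩
    rw [hint] at hq'
    exact ha'.trans_lt (hq' j).1
  obtain ⟨z, -, hz1, hz2⟩ := hconn {q | q j < v j} {q | v j < q j}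
    (isOpen_lt (continuous_apply j) continuous_const)
    (isOpen_lt continuous_const (continuous_apply j)) hsplit
    ⟨q, ⟨hqV, hq1⟩, hq2⟩ ⟨q', ⟨hqV', hq1'⟩, hq2'⟩
  exact lt_asymm (show z j < v j from hz1) hz2

/-- The germ of a box at a point of it: only the faces through the point matter. -/
theorem eventually_mem_Icc_iff {a b p : Space} (hp : p ∈ Icc a b) :
    ∀ᶠ q in 𝓝 p, (q ∈ Icc a b ↔ ∀ j, (p j = a j → p j ≤ q j) ∧ (p j = b j → q j ≤ p j)) := by
  have h : ∀ j, ∀ᶠ q in 𝓝 p, (a j < p j → a j < q j) ∧ (p j < b j → q j < b j) := by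
    intro j
    have hc := (continuous_apply (A := fun _ : Fin 3 => ℝ) j).tendsto p
    refine (eventually_imp_distrib_left.2 fun h => hc.eventually_const_lt h).and
      (eventually_imp_distrib_left.2 fun h => hc.eventually_lt_const h)
  filter_upwards [eventually_all.2 h] with q hq
  constructor
  · exact fun hqm j => ⟨fun e => e ▸ hqm.1 j, fun e => e ▸ hqm.2 j⟩
  · intro hqm
    refine ⟨fun j => ?_, fun j => ?_⟩
    · rcases (hp.1 j).eq_or_lt with e | e
      · exact e ▸ (hqm j).1 e.symm
      · exact ((hq j).1 e).le
    · rcases (hp.2 j).eq_or_lt with e | e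
      · exact e ▸ (hqm j).2 e
      · exact ((hq j).2 e).le

/-- Near a point outside a box there are only points outside the box. -/
theorem eventually_notMem_Icc {a b p : Space} (hp : p ∉ Icc a b) : ∀ᶠ q in 𝓝 p, q ∉ Icc a b :=
  isClosed_Icc.isOpen_compl.mem_nhds hp

/-! ### Grids -/

/-- A finite set of reals is contained in the range of a strictly increasing sequence, indexed by
the integers and unbounded on both sides. -/
theorem exists_strictMono_grid (K : Finset ℝ) :
    ∃ X : ℤ → ℝ, StrictMono X ∧ (∀ x, ∃ n, X n ≤ x ∧ x < X (n + 1)) ∧ ∀ x ∈ K, ∃ n, X n = x := by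
  classical
  induction K using Finset.induction_on with
  | empty =>
    refine ⟨fun n => n, Int.cast_strictMono, fun x => ⟨⌊x⌋, Int.floor_le x, ?_⟩, by simp⟩
    exact_mod_cast Int.lt_floor_add_one x
  | insert c K _ ih =>
    obtain ⟨X, hX, hloc, hK⟩ := ih
    by_cases hc : ∃ n, X n = c
    · refine ⟨X, hX, hloc, fun x hx => ?_⟩
      rcases Finset.mem_insert.1 hx with rfl | hx
      exacts [hc, hK x hx]
    obtain ⟨n, hn1, hn2⟩ := hloc c
    have hn1' : X n < c := lt_of_le_of_ne hn1 fun h => hc ⟨n, h⟩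
    -- insert `c` between `X n` and `X (n + 1)`
    let Y : ℤ → ℝ := fun k => if k ≤ n then X k else if k = n + 1 then c else X (k - 1)
    have hY1 : ∀ k ≤ n, Y k = X k := fun k hk => if_pos hk
    have hY2 : Y (n + 1) = c := by simp [Y]
    have hY3 : ∀ k, n + 1 < k → Y k = X (k - 1) := fun k hk => by
      simp only [Y]
      rw [if_neg (by omega), if_neg (by omega)]
    refine ⟨Y, strictMono_int_of_lt_succ fun k => ?_, fun x => ?_, fun x hx => ?_⟩
    · rcases lt_trichotomy k n with h | h | h
      · rw [hY1 k h.le, hY1 (k + 1) (by omega)]; exact hX (by omega)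
      · rw [hY1 k h.le, h, hY2]; exact hn1'
      · rcases eq_or_lt_of_le (show n + 1 ≤ k by omega) with h' | h'
        · rw [← h', hY2, hY3 _ (by omega)]
          exact hn2.trans_le (hX.monotone (by omega))
        · rw [hY3 k h', hY3 _ (by omega)]; exact hX (by omega)
    · obtain ⟨k, hk1, hk2⟩ := hloc x
      rcases lt_trichotomy k n with h | h | h
      · exact ⟨k, by rwa [hY1 k h.le], by rwa [hY1 (k + 1) (by omega)]⟩
      · subst h
        rcases lt_or_ge x c with h' | h'
        · exact ⟨k, by rwa [hY1 k le_rfl], by rwa [hY2]⟩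
        · exact ⟨k + 1, by rwa [hY2], by rw [hY3 _ (by omega)]; simpa using hk2⟩
      · refine ⟨k + 1, ?_, ?_⟩
        · rw [hY3 _ (by omega)]; simpa using hk1
        · rw [hY3 _ (by omega)]; simpa using hk2
    · rcases Finset.mem_insert.1 hx with rfl | hx
      · exact ⟨_, hY2⟩
      · obtain ⟨k, rfl⟩ := hK x hx
        rcases le_or_gt k n with h | h
        · exact ⟨k, hY1 k h⟩
        · exact ⟨k + 1, by rw [hY3 _ (by omega)]; simp⟩

/-- A half-open range of grid indices: a point between `X m` and `X n` lies in one of the grid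
intervals from `m` to `n`. -/
theorem StrictMono.exists_grid_interval {X : ℤ → ℝ} (hX : StrictMono X)
    (hloc : ∀ x, ∃ n, X n ≤ x ∧ x < X (n + 1)) {m n : ℤ} (hmn : m < n) {x : ℝ}
    (h1 : X m ≤ x) (h2 : x ≤ X n) : ∃ k, m ≤ k ∧ k < n ∧ X k ≤ x ∧ x ≤ X (k + 1) := by
  obtain ⟨k, hk1, hk2⟩ := hloc x
  have hmk : m < k + 1 := hX.lt_iff_lt.1 (h1.trans_lt hk2)
  have hkn : k ≤ n := hX.le_iff_le.1 (hk1.trans h2)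
  rcases hkn.lt_or_eq with h | rfl
  · exact ⟨k, by omega, h, hk1, hk2.le⟩
  · exact ⟨k - 1, by omega, by omega, (hX (by omega)).le.trans hk1, by simpa using h2⟩

/-- The box of the grid `X` with lower corner `m` and upper corner `n`. -/
def gridBox (X : Fin 3 → ℤ → ℝ) (m n : Fin 3 → ℤ) : Set Space :=
  Icc (fun j => X j (m j)) fun j => X j (n j)

/-- The cell of the grid `X` with lower corner `c`. -/
def gridCell (X : Fin 3 → ℤ → ℝ) (c : Fin 3 → ℤ) : Set Space :=
  gridBox X c fun j => c j + 1

theorem mem_gridBox {X : Fin 3 → ℤ → ℝ} {m n : Fin 3 → ℤ} {p : Space} :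
    p ∈ gridBox X m n ↔ ∀ j, X j (m j) ≤ p j ∧ p j ≤ X j (n j) := by
  simp [gridBox, Pi.le_def, forall_and]

theorem mem_gridCell {X : Fin 3 → ℤ → ℝ} {c : Fin 3 → ℤ} {p : Space} :
    p ∈ gridCell X c ↔ ∀ j, X j (c j) ≤ p j ∧ p j ≤ X j (c j + 1) := mem_gridBox

theorem exists_gridCell_of_mem_gridBox {X : Fin 3 → ℤ → ℝ} (hX : ∀ j, StrictMono (X j))
    (hloc : ∀ j x, ∃ n, X j n ≤ x ∧ x < X j (n + 1)) {m n : Fin 3 → ℤ} (hmn : ∀ j, m j < n j)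
    {p : Space} (hp : p ∈ gridBox X m n) :
    ∃ c, (∀ j, m j ≤ c j ∧ c j < n j) ∧ p ∈ gridCell X c := by
  rw [mem_gridBox] at hp
  choose c h1 h2 h3 h4 using fun j =>
    (hX j).exists_grid_interval (hloc j) (hmn j) (hp j).1 (hp j).2
  exact ⟨c, fun j => ⟨h1 j, h2 j⟩, mem_gridCell.2 fun j => ⟨h3 j, h4 j⟩⟩

/-- A finite union of boxes is a finite union of cells of a suitable grid. -/
theorem exists_grid {S : Set (Set Space)} (hS : S.Finite) (hbox : ∀ B ∈ S, IsBox B) :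
    ∃ X : Fin 3 → ℤ → ℝ, (∀ j, StrictMono (X j)) ∧ (∀ j x, ∃ n, X j n ≤ x ∧ x < X j (n + 1)) ∧
      ∃ Q : Set (Fin 3 → ℤ), Q.Finite ∧ ∀ p, p ∈ ⋃₀ S ↔ ∃ c ∈ Q, p ∈ gridCell X c := by
  classical
  choose! a b hab hB using hbox
  lift S to Finset (Set Space) using hS
  choose X hX hloc hK using fun j : Fin 3 =>
    exists_strictMono_grid (S.image (fun B => a B j) ∪ S.image (fun B => b B j))
  have hm : ∀ B ∈ S, ∃ m : Fin 3 → ℤ, ∀ j, X j (m j) = a B j := fun B hBS => by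
    choose m hm using fun j => hK j (a B j)
      (Finset.mem_union_left _ (Finset.mem_image_of_mem (fun B => a B j) hBS))
    exact ⟨m, hm⟩
  have hn : ∀ B ∈ S, ∃ n : Fin 3 → ℤ, ∀ j, X j (n j) = b B j := fun B hBS => by
    choose m hm using fun j => hK j (b B j)
      (Finset.mem_union_right _ (Finset.mem_image_of_mem (fun B => b B j) hBS))
    exact ⟨m, hm⟩
  choose! m hm using hm
  choose! n hn using hn
  have hBg : ∀ B ∈ S, B = gridBox X (m B) (n B) := fun B hBS => by
    have h1 : (fun j => X j (m B j)) = a B := funext (hm B hBS)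
    have h2 : (fun j => X j (n B j)) = b B := funext (hn B hBS)
    rw [gridBox, h1, h2]; exact hB B hBS
  have hmn : ∀ B ∈ S, ∀ j, m B j < n B j := fun B hBS j => by
    rw [← (hX j).lt_iff_lt, hm B hBS, hn B hBS]; exact hab B hBS j
  refine ⟨X, hX, hloc, ⋃ B ∈ S, {c | ∀ j, m B j ≤ c j ∧ c j < n B j}, ?_, fun p => ?_⟩
  · refine S.finite_toSet.biUnion fun B _ => ?_
    refine (Set.finite_Icc (m B) (n B)).subset fun c hc => ⟨fun j => (hc j).1, fun j => (hc j).2.le⟩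
  · constructor
    · rintro ⟨B, hBS, hp⟩
      rw [hBg B hBS] at hp
      obtain ⟨c, hc, hpc⟩ := exists_gridCell_of_mem_gridBox hX hloc (hmn B hBS) hp
      exact ⟨c, mem_biUnion (show B ∈ (S : Set (Set Space)) from hBS) hc, hpc⟩
    · rintro ⟨c, hc, hpc⟩
      obtain ⟨B, hBS, hc⟩ := mem_iUnion₂.1 hc
      refine ⟨B, hBS, ?_⟩
      rw [hBg B hBS, mem_gridBox]
      rw [mem_gridCell] at hpc
      exact fun j => ⟨((hX j).monotone (hc j).1).trans (hpc j).1,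
        (hpc j).2.trans ((hX j).monotone (by have := (hc j).2; omega))⟩

/-! ### Planar cell complexes without reflex corners -/

/-- The local step of the next theorem: a maximal row of cells is repeated in the adjacent row as
soon as one of its cells is. -/
theorem row_propagates {D : ℤ → ℤ → Prop}
    (hD : ∀ x y s t, (s = 1 ∨ s = -1) → (t = 1 ∨ t = -1) → D x y → D x (y + t) → D (x + s) y →
      D (x + s) (y + t))
    {t y x α β : ℤ} (ht : t = 1 ∨ t = -1) (hx : α ≤ x ∧ x ≤ β)
    (hrow : ∀ u, α ≤ u → u ≤ β → D u y) (h : D x (y + t)) :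
    ∀ u, α ≤ u → u ≤ β → D u (y + t) := by
  have hr : ∀ k : ℕ, x + k ≤ β → D (x + k) (y + t) := by
    intro k
    induction k with
    | zero => intro _; simpa using h
    | succ k ih =>
      intro hk
      push_cast at hk ⊢
      rw [← add_assoc]
      exact hD _ _ _ _ (Or.inl rfl) ht (hrow _ (by omega) (by omega)) (ih (by omega))
        (hrow _ (by omega) (by omega))
  have hl : ∀ k : ℕ, α ≤ x - k → D (x - k) (y + t) := by
    intro k
    induction k with
    | zero => intro _; simpa using h
    | succ k ih =>
      intro hk
      push_cast at hk ⊢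
      rw [show x - ((k : ℤ) + 1) = x - k + -1 by ring]
      exact hD _ _ _ _ (Or.inr rfl) ht (hrow _ (by omega) (by omega)) (ih (by omega))
        (hrow _ (by omega) (by omega))
  intro u h1 h2
  rcases le_total x u with h | h
  · have := hr (u - x).toNat
    rw [Int.toNat_of_nonneg (by omega)] at this
    simpa using this (by omega)
  · have := hl (x - u).toNat
    rw [Int.toNat_of_nonneg (by omega)] at this
    simpa using this (by omega)

/-- A bounded predicate on the integers holds on a maximal interval around each of its points. -/
theorem exists_maximal_int_interval {p : ℤ → Prop} (hp : {x | p x}.Finite) {x : ℤ} (hx : p x) :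
    ∃ α β, α ≤ x ∧ x ≤ β ∧ (∀ u, α ≤ u → u ≤ β → p u) ∧ ¬ p (α - 1) ∧ ¬ p (β + 1) := by
  obtain ⟨M, hM⟩ := hp.bddAbove
  obtain ⟨N, hN⟩ := hp.bddBelow
  obtain ⟨β, ⟨h1, h2⟩, h3⟩ := Int.exists_greatest_of_bdd
    (P := fun β => x ≤ β ∧ ∀ u, x ≤ u → u ≤ β → p u)
    ⟨M, fun z hz => hM (hz.2 z hz.1 le_rfl)⟩
    ⟨x, le_rfl, fun u h1 h2 => (le_antisymm h1 h2) ▸ hx⟩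
  obtain ⟨α, ⟨h1', h2'⟩, h3'⟩ := Int.exists_least_of_bdd
    (P := fun α => α ≤ x ∧ ∀ u, α ≤ u → u ≤ x → p u)
    ⟨N, fun z hz => hN (hz.2 z le_rfl hz.1)⟩
    ⟨x, le_rfl, fun u h1 h2 => (le_antisymm h1 h2) ▸ hx⟩
  refine ⟨α, β, h1', h1, fun u hu1 hu2 => ?_, fun h => ?_, fun h => ?_⟩
  · rcases le_total x u with h | h
    exacts [h2 u h hu2, h2' u hu1 h]
  · have := h3' (α - 1) ⟨by omega, fun u hu1 hu2 => ?_⟩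
    · omega
    · rcases hu1.eq_or_lt with e | e
      exacts [e ▸ h, h2' u (by omega) hu2]
  · have := h3 (β + 1) ⟨by omega, fun u hu1 hu2 => ?_⟩
    · omega
    · rcases hu2.eq_or_lt with e | e
      exacts [e ▸ h, h2 u hu1 (by omega)]

/-- A finite set of cells of the plane in which no vertex has exactly three cells around it, nor
exactly two opposite ones, is a union of isolated rectangles. -/
theorem exists_isolated_rectangle {D : ℤ → ℤ → Prop} (hfin : {c : ℤ × ℤ | D c.1 c.2}.Finite)
    (hthree : ∀ x y s t, (s = 1 ∨ s = -1) → (t = 1 ∨ t = -1) → D x y → D x (y + t) → D (x + s) y →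
      D (x + s) (y + t))
    (hdiag : ∀ x y s t, (s = 1 ∨ s = -1) → (t = 1 ∨ t = -1) → D x y → D (x + s) (y + t) →
      D (x + s) y ∧ D x (y + t))
    {x y : ℤ} (h : D x y) :
    ∃ α β γ δ, (α ≤ x ∧ x ≤ β) ∧ (γ ≤ y ∧ y ≤ δ) ∧
      (∀ u v, α ≤ u → u ≤ β → γ ≤ v → v ≤ δ → D u v) ∧
      (∀ u v, α - 1 ≤ u → u ≤ β + 1 → γ - 1 ≤ v → v ≤ δ + 1 → D u v →
        (α ≤ u ∧ u ≤ β) ∧ γ ≤ v ∧ v ≤ δ) := by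
  have hfinx : {u | D u y}.Finite := by
    refine (hfin.image Prod.fst).subset fun u hu => ⟨(u, y), hu, rfl⟩
  have hfiny : {v | D x v}.Finite := by
    refine (hfin.image Prod.snd).subset fun v hv => ⟨(x, v), hv, rfl⟩
  obtain ⟨α, β, hα, hβ, hx, hα1, hβ1⟩ := exists_maximal_int_interval hfinx h
  obtain ⟨γ, δ, hγ, hδ, hy, hγ1, hδ1⟩ := exists_maximal_int_interval hfiny h
  have hrow : ∀ v t, (t = 1 ∨ t = -1) → D x (v + t) →
      ((∀ u, α ≤ u → u ≤ β → D u v) ∧ ¬ D (α - 1) v ∧ ¬ D (β + 1) v) →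
      ((∀ u, α ≤ u → u ≤ β → D u (v + t)) ∧ ¬ D (α - 1) (v + t) ∧ ¬ D (β + 1) (v + t)) := by
    rintro v t ht hxv ⟨h1, h2, h3⟩
    refine ⟨row_propagates hthree ht ⟨hα, hβ⟩ h1 hxv, fun h => h2 ?_, fun h => h3 ?_⟩
    · exact (hdiag α v (-1) t (Or.inr rfl) ht (h1 _ le_rfl (hα.trans hβ)) h).1
    · exact (hdiag β v 1 t (Or.inl rfl) ht (h1 _ (hα.trans hβ) le_rfl) h).1
  have hall : ∀ v, γ ≤ v → v ≤ δ →
      ((∀ u, α ≤ u → u ≤ β → D u v) ∧ ¬ D (α - 1) v ∧ ¬ D (β + 1) v) := by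
    have hu : ∀ k : ℕ, y + k ≤ δ →
        ((∀ u, α ≤ u → u ≤ β → D u (y + k)) ∧ ¬ D (α - 1) (y + k) ∧ ¬ D (β + 1) (y + k)) := by
      intro k
      induction k with
      | zero => intro _; simpa using ⟨hx, hα1, hβ1⟩
      | succ k ih =>
        intro hk
        push_cast at hk ⊢
        rw [← add_assoc]
        exact hrow _ 1 (Or.inl rfl) (hy _ (by omega) (by omega)) (ih (by omega))
    have hd : ∀ k : ℕ, γ ≤ y - k →
        ((∀ u, α ≤ u → u ≤ β → D u (y - k)) ∧ ¬ D (α - 1) (y - k) ∧ ¬ D (β + 1) (y - k)) := by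
      intro k
      induction k with
      | zero => intro _; simpa using ⟨hx, hα1, hβ1⟩
      | succ k ih =>
        intro hk
        push_cast at hk ⊢
        rw [show y - ((k : ℤ) + 1) = y - k + -1 by ring]
        exact hrow _ (-1) (Or.inr rfl) (hy _ (by omega) (by omega)) (ih (by omega))
    intro v h1 h2
    rcases le_total y v with h | h
    · have := hu (v - y).toNat
      rw [Int.toNat_of_nonneg (by omega)] at this
      simpa using this (by omega)
    · have := hd (y - v).toNat
      rw [Int.toNat_of_nonneg (by omega)] at this
      simpa using this (by omega)
  have hcap : ∀ v t, (t = 1 ∨ t = -1) → γ ≤ v → v ≤ δ → ¬ D x (v + t) →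
      ∀ u, α - 1 ≤ u → u ≤ β + 1 → ¬ D u (v + t) := by
    intro v t ht h1 h2 hn u hu1 hu2 hD
    obtain ⟨hv1, hv2, hv3⟩ := hall v h1 h2
    have hmid : α ≤ u ∧ u ≤ β := by
      constructor
      · by_contra hlt
        obtain rfl : u = α - 1 := by omega
        exact hv2 (hdiag α v (-1) t (Or.inr rfl) ht (hv1 _ le_rfl (hα.trans hβ)) hD).1
      · by_contra hlt
        obtain rfl : u = β + 1 := by omega
        exact hv3 (hdiag β v 1 t (Or.inl rfl) ht (hv1 _ (hα.trans hβ) le_rfl) hD).1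
    exact hn (row_propagates hthree ht hmid hv1 hD x hα hβ)
  refine ⟨α, β, γ, δ, ⟨hα, hβ⟩, ⟨hγ, hδ⟩, fun u v h1 h2 h3 h4 => (hall v h3 h4).1 u h1 h2, ?_⟩
  intro u v h1 h2 h3 h4 hD
  have hv : γ ≤ v ∧ v ≤ δ := by
    constructor
    · by_contra hlt
      have e : v = γ + -1 := by omega
      exact hcap γ (-1) (Or.inr rfl) le_rfl (hγ.trans hδ) hγ1 u h1 h2 (e ▸ hD)
    · by_contra hlt
      have e : v = δ + 1 := by omega
      exact hcap δ 1 (Or.inl rfl) (hγ.trans hδ) le_rfl hδ1 u h1 h2 (e ▸ hD)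
  obtain ⟨-, hv2, hv3⟩ := hall v hv.1 hv.2
  refine ⟨⟨?_, ?_⟩, hv⟩
  · by_contra hlt
    obtain rfl : u = α - 1 := by omega
    exact hv2 hD
  · by_contra hlt
    obtain rfl : u = β + 1 := by omega
    exact hv3 hD

/-! ### Vertical grid lines -/

theorem grid_line_iff {X : ℤ → ℝ} (hX : StrictMono X) {x s : ℤ} (hs : s = 1 ∨ s = -1) {c : ℤ}
    {r : ℝ} :
    ((X c ≤ X (max x (x + s)) ∧ X (max x (x + s)) ≤ X (c + 1)) ∧
      (X (max x (x + s)) = X c → X (max x (x + s)) ≤ r) ∧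
      (X (max x (x + s)) = X (c + 1) → r ≤ X (max x (x + s)))) ↔
    (c = x ∧ 0 ≤ -(s : ℝ) * (r - X (max x (x + s)))) ∨
      (c = x + s ∧ 0 ≤ (s : ℝ) * (r - X (max x (x + s)))) := by
  simp only [hX.le_iff_le, hX.injective.eq_iff]
  rcases hs with rfl | rfl
  · rw [max_eq_right (by omega)]
    constructor
    · rintro ⟨⟨h1, h2⟩, h3, h4⟩
      rcases eq_or_lt_of_le h1 with e | e
      · right
        refine ⟨e, ?_⟩
        have := h3 e.symm
        push_cast; linarith
      · left
        have e' : c = x := by omega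
        refine ⟨e', ?_⟩
        have := h4 (by omega)
        push_cast; linarith
    · rintro (⟨rfl, h⟩ | ⟨rfl, h⟩)
      · push_cast at h
        exact ⟨⟨by omega, le_rfl⟩, fun h => by omega, fun _ => by linarith⟩
      · push_cast at h
        exact ⟨⟨le_rfl, by omega⟩, fun _ => by linarith, fun h => by omega⟩
  · rw [max_eq_left (by omega)]
    constructor
    · rintro ⟨⟨h1, h2⟩, h3, h4⟩
      rcases eq_or_lt_of_le h1 with e | e
      · left
        refine ⟨e, ?_⟩
        have := h3 e.symm
        push_cast; linarith
      · right
        have e' : c = x + -1 := by omega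
        refine ⟨e', ?_⟩
        have := h4 (by omega)
        push_cast; linarith
    · rintro (⟨rfl, h⟩ | ⟨rfl, h⟩)
      · push_cast at h
        exact ⟨⟨le_rfl, by omega⟩, fun _ => by linarith, fun h => by omega⟩
      · push_cast at h
        exact ⟨⟨by omega, by omega⟩, fun h => by omega, fun _ => by linarith⟩

theorem grid_midpoint_iff {X : ℤ → ℝ} (hX : StrictMono X) {k c : ℤ} {r : ℝ} :
    ((X c ≤ (X k + X (k + 1)) / 2 ∧ (X k + X (k + 1)) / 2 ≤ X (c + 1)) ∧
      ((X k + X (k + 1)) / 2 = X c → (X k + X (k + 1)) / 2 ≤ r) ∧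
      ((X k + X (k + 1)) / 2 = X (c + 1) → r ≤ (X k + X (k + 1)) / 2)) ↔ c = k := by
  have h := hX (show k < k + 1 by omega)
  constructor
  · rintro ⟨⟨h1, h2⟩, -⟩
    have h1' : c < k + 1 := hX.lt_iff_lt.1 (by linarith)
    have h2' : k < c + 1 := hX.lt_iff_lt.1 (by linarith)
    omega
  · rintro rfl
    exact ⟨⟨by linarith, by linarith⟩, fun e => by linarith, fun e => by linarith⟩

/-- The point in the layer `k` on the vertical grid line at which the four columns of cells over
`x`, `x + s` and `y`, `y + t` meet. -/
noncomputable def gridLinePoint (X : Fin 3 → ℤ → ℝ) (i a b : Fin 3) (x s y t k : ℤ) :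
    Space :=
  fun j => if j = i then (X i k + X i (k + 1)) / 2 else if j = a then X a (max x (x + s))
    else X b (max y (y + t))

theorem eventually_mem_iff_gridLinePoint {X : Fin 3 → ℤ → ℝ} (hX : ∀ j, StrictMono (X j))
    {P : Set Space} {Q : Set (Fin 3 → ℤ)} (hQ : Q.Finite)
    (hP : ∀ p, p ∈ P ↔ ∃ c ∈ Q, p ∈ gridCell X c) {i a b : Fin 3} (hai : a ≠ i) (hbi : b ≠ i)
    (hab : b ≠ a) (hcov : ∀ j, j = i ∨ j = a ∨ j = b) {x s y t : ℤ} (k : ℤ)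
    (hs : s = 1 ∨ s = -1) (ht : t = 1 ∨ t = -1) {v : Space}
    (hv : v = gridLinePoint X i a b x s y t k) :
    ∀ᶠ q in 𝓝 v, (q ∈ P ↔ ∃ c ∈ Q, c i = k ∧
      ((c a = x ∧ 0 ≤ -(s : ℝ) * (q a - v a)) ∨ (c a = x + s ∧ 0 ≤ (s : ℝ) * (q a - v a))) ∧
      ((c b = y ∧ 0 ≤ -(t : ℝ) * (q b - v b)) ∨ (c b = y + t ∧ 0 ≤ (t : ℝ) * (q b - v b)))) := by
  have hvi : v i = (X i k + X i (k + 1)) / 2 := by simp [hv, gridLinePoint]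
  have hva : v a = X a (max x (x + s)) := by simp [hv, gridLinePoint, hai]
  have hvb : v b = X b (max y (y + t)) := by simp [hv, gridLinePoint, hbi, hab]
  have h : ∀ c ∈ Q, ∀ᶠ q in 𝓝 v, (q ∈ gridCell X c ↔
      ∀ j, (X j (c j) ≤ v j ∧ v j ≤ X j (c j + 1)) ∧ (v j = X j (c j) → v j ≤ q j) ∧
        (v j = X j (c j + 1) → q j ≤ v j)) := by
    intro c _
    by_cases hvc : v ∈ gridCell X c
    · filter_upwards [eventually_mem_Icc_iff hvc] with q hq
      rw [gridCell, gridBox, hq]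
      exact ⟨fun h j => ⟨mem_gridCell.1 hvc j, h j⟩, fun h j => (h j).2⟩
    · filter_upwards [eventually_notMem_Icc hvc] with q hq
      exact iff_of_false hq fun h => hvc (mem_gridCell.2 fun j => (h j).1)
  filter_upwards [(hQ.eventually_all (l := 𝓝 v)).2 h] with q hq
  rw [hP]
  refine exists_congr fun c => and_congr_right fun hc => ?_
  rw [hq c hc]
  have hall : ∀ R : Fin 3 → Prop, (∀ j, R j) ↔ R i ∧ R a ∧ R b := fun R =>
    ⟨fun h => ⟨h i, h a, h b⟩, fun h j => by
      rcases hcov j with rfl | rfl | rfl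
      exacts [h.1, h.2.1, h.2.2]⟩
  rw [hall, hvi, hva, hvb, grid_midpoint_iff (hX i), grid_line_iff (hX a) hs,
    grid_line_iff (hX b) ht]

section Columns

variable {X : Fin 3 → ℤ → ℝ} (hX : ∀ j, StrictMono (X j))
  {P : Set Space} {Q : Set (Fin 3 → ℤ)} (hQ : Q.Finite)
  (hP : ∀ p, p ∈ P ↔ ∃ c ∈ Q, p ∈ gridCell X c) {i a b : Fin 3} (hai : a ≠ i) (hbi : b ≠ i)
  (hab : b ≠ a) (hcov : ∀ j, j = i ∨ j = a ∨ j = b)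

/-- The cell with coordinates `x`, `y`, `k` in the directions `a`, `b`, `i`. -/
def cellIndex (i a : Fin 3) (x y k : ℤ) : Fin 3 → ℤ :=
  fun j => if j = i then k else if j = a then x else y

include hai hbi hab hcov in
theorem eq_cellIndex_iff {c : Fin 3 → ℤ} {x y k : ℤ} :
    c = cellIndex i a x y k ↔ c i = k ∧ c a = x ∧ c b = y := by
  constructor
  · rintro rfl
    simp [cellIndex, hai, hbi, hab]
  · rintro ⟨rfl, rfl, rfl⟩
    funext j
    rcases hcov j with rfl | rfl | rfl <;> simp [cellIndex, hai, hbi, hab]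

include hX hQ hP hai hbi hab hcov

theorem eventually_mem_iff_four_columns {x s y t : ℤ} (k : ℤ)
    (hs : s = 1 ∨ s = -1) (ht : t = 1 ∨ t = -1) {v : Space}
    (hv : v = gridLinePoint X i a b x s y t k) :
    ∀ᶠ q in 𝓝 v, (q ∈ P ↔
      (cellIndex i a x y k ∈ Q ∧ 0 ≤ -(s : ℝ) * (q a - v a) ∧ 0 ≤ -(t : ℝ) * (q b - v b)) ∨
      (cellIndex i a x (y + t) k ∈ Q ∧ 0 ≤ -(s : ℝ) * (q a - v a) ∧
        0 ≤ (t : ℝ) * (q b - v b)) ∨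
      (cellIndex i a (x + s) y k ∈ Q ∧ 0 ≤ (s : ℝ) * (q a - v a) ∧
        0 ≤ -(t : ℝ) * (q b - v b)) ∨
      (cellIndex i a (x + s) (y + t) k ∈ Q ∧ 0 ≤ (s : ℝ) * (q a - v a) ∧
        0 ≤ (t : ℝ) * (q b - v b))) := by
  filter_upwards [eventually_mem_iff_gridLinePoint hX hQ hP hai hbi hab hcov k hs ht hv] with q hq
  rw [hq]
  have hci := fun (c : Fin 3 → ℤ) (x y : ℤ) =>
    eq_cellIndex_iff (c := c) (x := x) (y := y) (k := k) hai hbi hab hcov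
  constructor
  · rintro ⟨c, hc, hck, ⟨hca, h1⟩ | ⟨hca, h1⟩, ⟨hcb, h2⟩ | ⟨hcb, h2⟩⟩
    · exact Or.inl ⟨(hci _ _ _).2 ⟨hck, hca, hcb⟩ ▸ hc, h1, h2⟩
    · exact Or.inr (Or.inl ⟨(hci _ _ _).2 ⟨hck, hca, hcb⟩ ▸ hc, h1, h2⟩)
    · exact Or.inr (Or.inr (Or.inl ⟨(hci _ _ _).2 ⟨hck, hca, hcb⟩ ▸ hc, h1, h2⟩))
    · exact Or.inr (Or.inr (Or.inr ⟨(hci _ _ _).2 ⟨hck, hca, hcb⟩ ▸ hc, h1, h2⟩))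
  · rintro (⟨hc, h1, h2⟩ | ⟨hc, h1, h2⟩ | ⟨hc, h1, h2⟩ | ⟨hc, h1, h2⟩) <;>
      obtain ⟨e1, e2, e3⟩ := (hci _ _ _).1 rfl
    · exact ⟨_, hc, e1, Or.inl ⟨e2, h1⟩, Or.inl ⟨e3, h2⟩⟩
    · exact ⟨_, hc, e1, Or.inl ⟨e2, h1⟩, Or.inr ⟨e3, h2⟩⟩
    · exact ⟨_, hc, e1, Or.inr ⟨e2, h1⟩, Or.inl ⟨e3, h2⟩⟩
    · exact ⟨_, hc, e1, Or.inr ⟨e2, h1⟩, Or.inr ⟨e3, h2⟩⟩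

/-- Without vertical reflex edges, no vertical grid line has exactly three columns around it. -/
theorem cellIndex_mem_of_three (hr : reflexEdgePoints P i = ∅) {x s y t : ℤ} (k : ℤ)
    (hs : s = 1 ∨ s = -1) (ht : t = 1 ∨ t = -1) (h1 : cellIndex i a x y k ∈ Q)
    (h2 : cellIndex i a x (y + t) k ∈ Q) (h3 : cellIndex i a (x + s) y k ∈ Q) :
    cellIndex i a (x + s) (y + t) k ∈ Q := by
  by_contra h4
  obtain ⟨v, hv⟩ : ∃ v, v = gridLinePoint X i a b x s y t k := ⟨_, rfl⟩
  have hsr : (s : ℝ) = 1 ∨ (s : ℝ) = -1 := by rcases hs with rfl | rfl <;> simp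
  have htr : (t : ℝ) = 1 ∨ (t : ℝ) = -1 := by rcases ht with rfl | rfl <;> simp
  have hmem : v ∈ reflexEdgePoints P i := by
    refine ⟨fun j => if j = a then -(s : ℝ) else -(t : ℝ), fun j => ?_, ?_⟩
    · by_cases hj : j = a
      · rcases hsr with e | e <;> simp [hj, e]
      · rcases htr with e | e <;> simp [hj, e]
    · filter_upwards [eventually_mem_iff_four_columns hX hQ hP hai hbi hab hcov k hs ht hv] with q hq
      rw [hq]
      simp only [h1, h2, h3, h4, true_and, false_and, or_false]
      have e : (∃ j, j ≠ i ∧ 0 ≤ (if j = a then -(s : ℝ) else -(t : ℝ)) * (q j - v j)) ↔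
          0 ≤ -(s : ℝ) * (q a - v a) ∨ 0 ≤ -(t : ℝ) * (q b - v b) := by
        constructor
        · rintro ⟨j, hj, h⟩
          rcases hcov j with rfl | rfl | rfl
          · exact absurd rfl hj
          · left; simpa using h
          · right; simpa [hab] using h
        · rintro (h | h)
          · exact ⟨a, hai, by simpa using h⟩
          · exact ⟨b, hbi, by simpa [hab] using h⟩
      rw [e]
      have ta := le_total 0 ((s : ℝ) * (q a - v a))
      have tb := le_total 0 ((t : ℝ) * (q b - v b))
      constructor
      · rintro (⟨h, -⟩ | ⟨h, -⟩ | ⟨-, h⟩)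
        exacts [Or.inl h, Or.inl h, Or.inr h]
      · rintro (h | h)
        · rcases tb with h' | h'
          · exact Or.inr (Or.inl ⟨h, h'⟩)
          · exact Or.inl ⟨h, by linarith⟩
        · rcases ta with h' | h'
          · exact Or.inr (Or.inr ⟨h', h⟩)
          · exact Or.inl ⟨by linarith, h⟩
  rw [hr] at hmem
  exact hmem

/-- If two opposite columns around a vertical grid line belong to a manifold without vertical
reflex edges, then so do the other two. -/
theorem cellIndex_mem_of_diagonal (hM : IsManifoldInSpace P) (hr : reflexEdgePoints P i = ∅)
    {x s y t : ℤ} (k : ℤ) (hs : s = 1 ∨ s = -1) (ht : t = 1 ∨ t = -1)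
    (h1 : cellIndex i a x y k ∈ Q) (h2 : cellIndex i a (x + s) (y + t) k ∈ Q) :
    cellIndex i a (x + s) y k ∈ Q ∧ cellIndex i a x (y + t) k ∈ Q := by
  have hmt : -t = 1 ∨ -t = -1 := by omega
  by_cases h3 : cellIndex i a (x + s) y k ∈ Q
  · refine ⟨h3, ?_⟩
    have := cellIndex_mem_of_three hX hQ hP hai hbi hab hcov hr (x := x + s) (s := -s) (y := y)
      (t := t) k (by omega) ht h3 h2 (by simpa using h1)
    simpa using this
  by_cases h4 : cellIndex i a x (y + t) k ∈ Q
  · refine ⟨?_, h4⟩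
    have := cellIndex_mem_of_three hX hQ hP hai hbi hab hcov hr (x := x) (s := s) (y := y + t)
      (t := -t) k hs hmt h4 (by simpa using h1) h2
    simpa using this
  exfalso
  obtain ⟨v, hv⟩ : ∃ v, v = gridLinePoint X i a b x s y t k := ⟨_, rfl⟩
  have hvi : v i = (X i k + X i (k + 1)) / 2 := by simp [hv, gridLinePoint]
  have hva : v a = X a (max x (x + s)) := by simp [hv, gridLinePoint, hai]
  have hvb : v b = X b (max y (y + t)) := by simp [hv, gridLinePoint, hbi, hab]
  have hg := eventually_mem_iff_four_columns hX hQ hP hai hbi hab hcov k hs ht hv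
  simp only [h1, h2, h3, h4, true_and, false_and, false_or] at hg
  have hcell : ∀ c, c ∈ Q → gridCell X c ⊆ P := fun c hc p hp => (hP p).2 ⟨c, hc, hp⟩
  have hnd : ∀ c : Fin 3 → ℤ, ∀ j, X j (c j) < X j (c j + 1) := fun c j => hX j (by omega)
  have hvmem : ∀ x' y', (x' = x ∨ x' = x + s) → (y' = y ∨ y' = y + t) →
      v ∈ gridCell X (cellIndex i a x' y' k) := by
    intro x' y' hx' hy'
    obtain ⟨e1, e2, e3⟩ := (eq_cellIndex_iff (k := k) (x := x') (y := y') hai hbi hab hcov).1 rfl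
    rw [mem_gridCell]
    intro j
    rcases hcov j with rfl | rfl | rfl
    · have := hX j (show k < k + 1 by omega)
      rw [e1, hvi]; constructor <;> linarith
    · rw [e2, hva, (hX j).le_iff_le, (hX j).le_iff_le]; omega
    · rw [e3, hvb, (hX j).le_iff_le, (hX j).le_iff_le]; omega
  have hA := hvmem x y (Or.inl rfl) (Or.inl rfl)
  have hB := hvmem (x + s) (y + t) (Or.inr rfl) (Or.inr rfl)
  obtain ⟨-, e2, -⟩ := (eq_cellIndex_iff (k := k) (x := x) (y := y) hai hbi hab hcov).1 rfl
  obtain ⟨-, e2', -⟩ :=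
    (eq_cellIndex_iff (k := k) (x := x + s) (y := y + t) hai hbi hab hcov).1 rfl
  have htr : (t : ℝ) ≠ 0 := by rcases ht with rfl | rfl <;> simp
  rcases hs with rfl | rfl
  · refine hM.false_of_opposite_wedges hab.symm htr ?_ (hnd _) (hnd _) (hcell _ h1) (hcell _ h2) hA hB
      ?_ ?_
    · filter_upwards [hg] with q hq hqP
      rcases hq.1 hqP with ⟨h, h'⟩ | ⟨h, h'⟩
      · left; push_cast at h; constructor <;> linarith
      · right; push_cast at h; constructor <;> linarith
    · rw [e2, hva]; exact (hX a).monotone (by omega)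
    · rw [e2', hva]; exact (hX a).monotone (by omega)
  · refine hM.false_of_opposite_wedges hab.symm (neg_ne_zero.2 htr) ?_ (hnd _) (hnd _) (hcell _ h2)
      (hcell _ h1) hB hA ?_ ?_
    · filter_upwards [hg] with q hq hqP
      rcases hq.1 hqP with ⟨h, h'⟩ | ⟨h, h'⟩
      · right; push_cast at h; constructor <;> linarith
      · left; push_cast at h; constructor <;> linarith
    · rw [e2', hva]; exact (hX a).monotone (by omega)
    · rw [e2, hva]; exact (hX a).monotone (by omega)

end Columns

/-! ### Decomposition into bricks -/

theorem exists_other_directions (i : Fin 3) :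
    ∃ a b : Fin 3, a ≠ i ∧ b ≠ i ∧ b ≠ a ∧ ∀ j, j = i ∨ j = a ∨ j = b := by
  revert i; decide

/-- A decomposition of `P` into finitely many boxes, its bricks, each of them represented by its
lower and its upper corner, such that two different bricks can only meet along horizontal faces
(the direction `i` being the vertical one), one above the other, and then in a nondegenerate
rectangle. -/
structure IsBrickwork (i : Fin 3) (P : Set Space) (F : Finset (Space × Space)) : Prop where
  lt : ∀ B ∈ F, ∀ j, B.1 j < B.2 j
  mem_iff : ∀ p, p ∈ P ↔ ∃ B ∈ F, p ∈ Icc B.1 B.2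
  contact : ∀ A ∈ F, ∀ B ∈ F, A ≠ B → ∀ p, p ∈ Icc A.1 A.2 → p ∈ Icc B.1 B.2 →
    (A.2 i = B.1 i ∨ B.2 i = A.1 i) ∧ ∀ j, j ≠ i → A.1 j < B.2 j ∧ B.1 j < A.2 j

/-- An isolated rectangle of cells in one layer of `Q`: all cells of `Q` next to it in its layer
belong to it. -/
structure IsIsolated (i : Fin 3) (Q : Set (Fin 3 → ℤ)) (m n : Fin 3 → ℤ) : Prop where
  lt : ∀ j, m j < n j
  layer : n i = m i + 1
  mem : ∀ c, (∀ j, m j ≤ c j ∧ c j < n j) → c ∈ Q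
  isolated : ∀ c ∈ Q, c i = m i → (∀ j, m j - 1 ≤ c j ∧ c j ≤ n j) →
    ∀ j, j ≠ i → m j ≤ c j ∧ c j < n j

/-- Isolated rectangles of the same layer that touch each other coincide. -/
theorem IsIsolated.le_of_touch {i : Fin 3} {Q : Set (Fin 3 → ℤ)} {m n m' n' : Fin 3 → ℤ}
    (h : IsIsolated i Q m n) (h' : IsIsolated i Q m' n') (hi : m i = m' i)
    (h1 : ∀ j, m j ≤ n' j) (h2 : ∀ j, m' j ≤ n j) {j : Fin 3} (hj : j ≠ i) :
    m j ≤ m' j ∧ n' j ≤ n j := by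
  have key : ∀ d : Fin 3 → ℤ, (∀ j, m' j ≤ d j ∧ d j < n' j) → (∀ j, m j - 1 ≤ d j ∧ d j ≤ n j) →
      m j ≤ d j ∧ d j < n j := by
    intro d hd1 hd2
    refine h.isolated d (h'.mem d hd1) ?_ hd2 j hj
    have := hd1 i
    have := h'.layer
    omega
  have e1 := key (fun j => max (m' j) (m j - 1))
    (fun j => by have := h1 j; have := h'.lt j; omega)
    (fun j => by have := h2 j; have := h.lt j; omega)
  have e2 := key (fun j => min (n' j - 1) (n j))
    (fun j => by have := h2 j; have := h'.lt j; omega)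
    (fun j => by have := h1 j; have := h.lt j; omega)
  omega

theorem IsIsolated.eq_of_touch {i : Fin 3} {Q : Set (Fin 3 → ℤ)} {m n m' n' : Fin 3 → ℤ}
    (h : IsIsolated i Q m n) (h' : IsIsolated i Q m' n') (hi : m i = m' i)
    (h1 : ∀ j, m j ≤ n' j) (h2 : ∀ j, m' j ≤ n j) : m = m' ∧ n = n' := by
  have key : ∀ j, m j = m' j ∧ n j = n' j := by
    intro j
    by_cases hj : j = i
    · subst hj
      have := h.layer
      have := h'.layer
      omega
    · have e1 := h.le_of_touch h' hi h1 h2 hj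
      have e2 := h'.le_of_touch h hi.symm h2 h1 hj
      omega
  exact ⟨funext fun j => (key j).1, funext fun j => (key j).2⟩

/-- A manifold without vertical reflex edges that is a finite union of boxes has a brickwork. -/
theorem exists_isBrickwork {P : Set Space} (hM : IsManifoldInSpace P) {i : Fin 3}
    (hr : reflexEdgePoints P i = ∅) {S : Set (Set Space)} (hS : S.Finite)
    (hbox : ∀ B ∈ S, IsBox B) (hPS : P = ⋃₀ S) : ∃ F, IsBrickwork i P F := by
  classical
  obtain ⟨X, hX, hloc, Q, hQ, hPQ⟩ := exists_grid hS hbox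
  rw [← hPS] at hPQ
  obtain ⟨a, b, hai, hbi, hab, hcov⟩ := exists_other_directions i
  have hmono : ∀ j, Monotone (X j) := fun j => (hX j).monotone
  -- every cell lies in an isolated rectangle
  have hcover : ∀ c ∈ Q, ∃ m n, IsIsolated i Q m n ∧ ∀ j, m j ≤ c j ∧ c j < n j := by
    intro c hc
    have heq : ∀ c : Fin 3 → ℤ, c = cellIndex i a (c a) (c b) (c i) := fun c =>
      (eq_cellIndex_iff hai hbi hab hcov).2 ⟨rfl, rfl, rfl⟩
    have hcoord := fun x y k =>
      (eq_cellIndex_iff (x := x) (y := y) (k := k) hai hbi hab hcov).1 rfl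
    obtain ⟨α, β, γ, δ, hx, hy, hin, hout⟩ := exists_isolated_rectangle
      (D := fun x y => cellIndex i a x y (c i) ∈ Q) (x := c a) (y := c b)
      (by
        refine (hQ.image fun c : Fin 3 → ℤ => (c a, c b)).subset fun d hd => ⟨_, hd, ?_⟩
        obtain ⟨-, e2, e3⟩ := hcoord d.1 d.2 (c i)
        exact Prod.ext e2 e3)
      (fun x y s t hs ht h1 h2 h3 =>
        cellIndex_mem_of_three hX hQ hPQ hai hbi hab hcov hr _ hs ht h1 h2 h3)
      (fun x y s t hs ht h1 h2 =>
        cellIndex_mem_of_diagonal hX hQ hPQ hai hbi hab hcov hM hr _ hs ht h1 h2)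
      (by rw [← heq]; exact hc)
    obtain ⟨m1, m2, m3⟩ := hcoord α γ (c i)
    obtain ⟨n1, n2, n3⟩ := hcoord (β + 1) (δ + 1) (c i + 1)
    have hall : ∀ R : Fin 3 → Prop, (∀ j, R j) ↔ R i ∧ R a ∧ R b := fun R =>
      ⟨fun h => ⟨h i, h a, h b⟩, fun h j => by
        rcases hcov j with rfl | rfl | rfl
        exacts [h.1, h.2.1, h.2.2]⟩
    refine ⟨cellIndex i a α γ (c i), cellIndex i a (β + 1) (δ + 1) (c i + 1), ⟨?_, ?_, ?_, ?_⟩, ?_⟩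
    · rw [hall, m1, m2, m3, n1, n2, n3]; omega
    · rw [m1, n1]
    · intro d hd
      rw [hall, m1, m2, m3, n1, n2, n3] at hd
      have := hin (d a) (d b) (by omega) (by omega) (by omega) (by omega)
      rw [show c i = d i by omega, ← heq] at this
      exact this
    · intro d hd hdi hdj
      rw [hall, m1, m2, m3, n1, n2, n3] at hdj
      rw [m1] at hdi
      have := hout (d a) (d b) (by omega) (by omega) (by omega) (by omega)
        (by rw [← hdi, ← heq]; exact hd)
      intro j hj
      rcases hcov j with rfl | rfl | rfl
      · exact absurd rfl hj
      · rw [m2, n2]; omega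
      · rw [m3, n3]; omega
    · rw [hall, m1, m2, m3, n1, n2, n3]; omega
  have hboxP : ∀ m n, IsIsolated i Q m n → gridBox X m n ⊆ P := by
    intro m n h p hp
    obtain ⟨c, hc, hpc⟩ := exists_gridCell_of_mem_gridBox hX hloc h.lt hp
    exact (hPQ p).2 ⟨c, h.mem c hc, hpc⟩
  have htouch : ∀ m n m' n' p, p ∈ gridBox X m n → p ∈ gridBox X m' n' → ∀ j, m j ≤ n' j := by
    intro m n m' n' p hp hp' j
    exact (hX j).le_iff_le.1 (((mem_gridBox.1 hp) j).1.trans ((mem_gridBox.1 hp') j).2)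
  have hfin : {B : (Fin 3 → ℤ) × (Fin 3 → ℤ) | IsIsolated i Q B.1 B.2}.Finite := by
    refine ((hQ.prod hQ).image fun B => (B.1, fun j => B.2 j + 1)).subset ?_
    rintro ⟨m, n⟩ h
    replace h : IsIsolated i Q m n := h
    refine ⟨(m, fun j => n j - 1), ⟨h.mem _ fun j => ⟨le_rfl, h.lt j⟩, h.mem _ fun j => ?_⟩, ?_⟩
    · have := h.lt j; simp only; omega
    · simp
  let e : (Fin 3 → ℤ) × (Fin 3 → ℤ) → Space × Space :=
    fun B => (fun j => X j (B.1 j), fun j => X j (B.2 j))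
  have hF : ∀ B, B ∈ hfin.toFinset.image e ↔ ∃ m n, IsIsolated i Q m n ∧
      B = (fun j => X j (m j), fun j => X j (n j)) := by
    intro B
    simp only [Finset.mem_image, Finite.mem_toFinset, mem_ofPred_eq, Prod.exists, e]
    exact ⟨fun ⟨m, n, h, h'⟩ => ⟨m, n, h, h'.symm⟩, fun ⟨m, n, h, h'⟩ => ⟨m, n, h, h'.symm⟩⟩
  refine ⟨hfin.toFinset.image e, ?_, ?_, ?_⟩
  · intro B hB j
    obtain ⟨m, n, h, rfl⟩ := (hF B).1 hB
    exact hX j (h.lt j)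
  · intro p
    constructor
    · intro hp
      obtain ⟨c, hc, hpc⟩ := (hPQ p).1 hp
      obtain ⟨m, n, h, hmn⟩ := hcover c hc
      refine ⟨_, (hF _).2 ⟨m, n, h, rfl⟩, ?_⟩
      rw [mem_gridCell] at hpc
      exact mem_gridBox.2 fun j => ⟨(hmono j (hmn j).1).trans (hpc j).1,
        (hpc j).2.trans (hmono j (by have := (hmn j).2; omega))⟩
    · rintro ⟨B, hB, hp⟩
      obtain ⟨m, n, h, rfl⟩ := (hF B).1 hB
      exact hboxP m n h hp
  · intro A hA B hB hAB p hpA hpB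
    obtain ⟨m, n, h, rfl⟩ := (hF A).1 hA
    obtain ⟨m', n', h', rfl⟩ := (hF B).1 hB
    replace hpA : p ∈ gridBox X m n := hpA
    replace hpB : p ∈ gridBox X m' n' := hpB
    have t1 := htouch _ _ _ _ p hpA hpB
    have t2 := htouch _ _ _ _ p hpB hpA
    have hne : m i ≠ m' i := fun e => hAB (by
      obtain ⟨rfl, rfl⟩ := h.eq_of_touch h' e t1 t2; rfl)
    have hl := h.layer
    have hl' := h'.layer
    have t1i := t1 i
    have t2i := t2 i
    have hadj : n i = m' i ∨ n' i = m i := by omega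
    -- near `p`, there are no other bricks
    have hgerm : ∀ᶠ q in 𝓝 p, q ∈ P → q ∈ gridBox X m n ∨ q ∈ gridBox X m' n' := by
      have hev : ∀ B ∈ hfin.toFinset, ∀ᶠ q in 𝓝 p, q ∈ gridBox X B.1 B.2 →
          q ∈ gridBox X m n ∨ q ∈ gridBox X m' n' := by
        rintro ⟨k, l⟩ hkl
        replace hkl : IsIsolated i Q k l := by simpa using hkl
        by_cases hp : p ∈ gridBox X k l
        · refine Eventually.of_forall fun q hq => ?_
          have s1 := htouch _ _ _ _ p hpA hp
          have s2 := htouch _ _ _ _ p hp hpA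
          have s3 := htouch _ _ _ _ p hpB hp
          have s4 := htouch _ _ _ _ p hp hpB
          have hkl' := hkl.layer
          have s1i := s1 i
          have s2i := s2 i
          have s3i := s3 i
          have s4i := s4 i
          have : k i = m i ∨ k i = m' i := by omega
          rcases this with e | e
          · obtain ⟨rfl, rfl⟩ := hkl.eq_of_touch h e s2 s1
            exact Or.inl hq
          · obtain ⟨rfl, rfl⟩ := hkl.eq_of_touch h' e s4 s3
            exact Or.inr hq
        · filter_upwards [eventually_notMem_Icc hp] with q hq hq'
          exact absurd hq' hq
      filter_upwards [(Filter.eventually_all_finset hfin.toFinset).2 hev] with q hq hqP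
      obtain ⟨c, hc, hqc⟩ := (hPQ q).1 hqP
      obtain ⟨k, l, hkl, hckl⟩ := hcover c hc
      refine hq (k, l) (by simpa using hkl) ?_
      rw [mem_gridCell] at hqc
      exact mem_gridBox.2 fun j => ⟨(hmono j (hckl j).1).trans (hqc j).1,
        (hqc j).2.trans (hmono j (by have := (hckl j).2; simp only; omega))⟩
    refine ⟨?_, fun j hj => ?_⟩
    · rcases hadj with e | e
      · left; simp [e]
      · right; simp [e]
    -- two bricks with a degenerate contact lie in opposite wedges
    have hdeg : ∀ m n m' n' : Fin 3 → ℤ, IsIsolated i Q m n → IsIsolated i Q m' n' →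
        p ∈ gridBox X m n → p ∈ gridBox X m' n' → n i = m' i → (n' j = m j ∨ n j = m' j) →
        (∀ᶠ q in 𝓝 p, q ∈ P → q ∈ gridBox X m n ∨ q ∈ gridBox X m' n') → False := by
      intro m n m' n' h h' hp hp' hi hj' hg
      have hpi := (mem_gridBox.1 hp i).2
      have hpi' := (mem_gridBox.1 hp' i).1
      have hpj := mem_gridBox.1 hp j
      have hpj' := mem_gridBox.1 hp' j
      have main : ∀ τ : ℝ, τ ≠ 0 → (∀ q ∈ gridBox X m n, τ * (q j - p j) ≤ 0) →
          (∀ q ∈ gridBox X m' n', 0 ≤ τ * (q j - p j)) → False := by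
        intro τ hτ h1 h2
        refine hM.false_of_opposite_wedges hj.symm hτ ?_ (fun k => hX k (h.lt k))
          (fun k => hX k (h'.lt k)) (hboxP m n h) (hboxP m' n' h') hp hp' ?_ (hi ▸ hpi)
        · filter_upwards [hg] with q hq hqP
          rcases hq hqP with hq' | hq'
          · refine Or.inl ⟨((mem_gridBox.1 hq' i).2).trans ?_, h1 q hq'⟩
            rw [hi]; exact hpi'
          · refine Or.inr ⟨le_trans ?_ (mem_gridBox.1 hq' i).1, h2 q hq'⟩
            rw [← hi]; exact hpi
        · rw [hi]; exact hpi'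
      rcases hj' with e | e
      · refine main (-1) (by norm_num) (fun q hq => ?_) fun q hq => ?_
        · have := (mem_gridBox.1 hq j).1
          rw [e] at hpj'
          linarith
        · have := (mem_gridBox.1 hq j).2
          rw [e] at this
          linarith
      · refine main 1 (by norm_num) (fun q hq => ?_) fun q hq => ?_
        · have := (mem_gridBox.1 hq j).2
          rw [e] at this
          linarith
        · have := (mem_gridBox.1 hq j).1
          rw [e] at hpj
          linarith
    have hlt : m j < n' j ∧ m' j < n j := by
      by_contra hcon
      have t1j := t1 j
      have t2j := t2 j
      rcases hadj with ei | ei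
      · exact hdeg m n m' n' h h' hpA hpB ei (by omega) hgerm
      · exact hdeg m' n' m n h' h hpB hpA ei (by omega) (hgerm.mono fun q hq hqP => (hq hqP).symm)
    exact ⟨hX j hlt.1, hX j hlt.2⟩

/-- Two bricks stacked on each other with the same horizontal rectangle can be merged. -/
theorem IsBrickwork.exists_card_lt {i : Fin 3} {P : Set Space} {F : Finset (Space × Space)}
    (hF : IsBrickwork i P F) {A B : Space × Space} (hA : A ∈ F) (hB : B ∈ F)
    (hi : A.2 i = B.1 i) (h : ∀ j, j ≠ i → A.1 j = B.1 j ∧ A.2 j = B.2 j) :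
    ∃ F', IsBrickwork i P F' ∧ F'.card < F.card := by
  classical
  have hAlt := hF.lt A hA
  have hBlt := hF.lt B hB
  have hAB : A ≠ B := by
    rintro rfl
    exact (hAlt i).ne hi.symm
  have hM : ∀ p, p ∈ Icc A.1 B.2 ↔ p ∈ Icc A.1 A.2 ∨ p ∈ Icc B.1 B.2 := by
    intro p
    constructor
    · rintro ⟨h1, h2⟩
      rcases le_total (p i) (A.2 i) with hp | hp
      · refine Or.inl ⟨h1, fun j => ?_⟩
        by_cases hj : j = i
        · rw [hj]; exact hp
        · rw [(h j hj).2]; exact h2 j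
      · refine Or.inr ⟨fun j => ?_, h2⟩
        by_cases hj : j = i
        · rw [hj, ← hi]; exact hp
        · rw [← (h j hj).1]; exact h1 j
    · rintro (⟨h1, h2⟩ | ⟨h1, h2⟩)
      · refine ⟨h1, fun j => ?_⟩
        by_cases hj : j = i
        · have := h2 i; have := hBlt i; rw [hj]; linarith
        · rw [← (h j hj).2]; exact h2 j
      · refine ⟨fun j => ?_, h2⟩
        by_cases hj : j = i
        · have := h1 i; have := hAlt i; rw [hj]; linarith
        · rw [(h j hj).1]; exact h1 j
  have hcon : ∀ C ∈ F, C ≠ A → C ≠ B → ∀ p, p ∈ Icc A.1 B.2 → p ∈ Icc C.1 C.2 →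
      (B.2 i = C.1 i ∨ C.2 i = A.1 i) ∧ ∀ j, j ≠ i → A.1 j < C.2 j ∧ C.1 j < B.2 j := by
    intro C hC hCA hCB p hpM hpC
    have hClt := hF.lt C hC
    rcases (hM p).1 hpM with hp | hp
    · obtain ⟨h1, h2⟩ := hF.contact A hA C hC hCA.symm p hp hpC
      refine ⟨Or.inr ?_, fun j hj => ⟨(h2 j hj).1, (h j hj).2 ▸ (h2 j hj).2⟩⟩
      rcases h1 with h1 | h1
      · -- `C` would lie in the same layer as `B` and touch it
        exfalso
        have hpB : p ∈ Icc B.1 B.2 := by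
          refine ⟨fun j => ?_, hpM.2⟩
          by_cases hj : j = i
          · rw [hj, ← hi, h1]; exact hpC.1 i
          · rw [← (h j hj).1]; exact hp.1 j
        have hb := hBlt i
        have hc := hClt i
        rcases (hF.contact B hB C hC hCB.symm p hpB hpC).1 with e | e <;> linarith
      · exact h1
    · obtain ⟨h1, h2⟩ := hF.contact B hB C hC hCB.symm p hp hpC
      refine ⟨Or.inl ?_, fun j hj => ⟨(h j hj).1 ▸ (h2 j hj).1, (h2 j hj).2⟩⟩
      rcases h1 with h1 | h1
      · exact h1
      · exfalso
        have hpA : p ∈ Icc A.1 A.2 := by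
          refine ⟨hpM.1, fun j => ?_⟩
          by_cases hj : j = i
          · rw [hj, hi, ← h1]; exact hpC.2 i
          · rw [(h j hj).2]; exact hp.2 j
        have ha := hAlt i
        have hc := hClt i
        rcases (hF.contact A hA C hC hCA.symm p hpA hpC).1 with e | e <;> linarith
  refine ⟨insert (A.1, B.2) ((F.erase A).erase B), ⟨?_, ?_, ?_⟩, ?_⟩
  · intro C hC j
    rcases Finset.mem_insert.1 hC with rfl | hC
    · by_cases hj : j = i
      · have := hAlt i; have := hBlt i; simp only [hj]; linarith
      · simp only [← (h j hj).2]; exact hAlt j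
    · exact hF.lt C (Finset.mem_of_mem_erase (Finset.mem_of_mem_erase hC)) j
  · intro p
    rw [hF.mem_iff]
    constructor
    · rintro ⟨C, hC, hp⟩
      by_cases hCA : C = A
      · exact ⟨_, Finset.mem_insert_self _ _, (hM p).2 (Or.inl (hCA ▸ hp))⟩
      by_cases hCB : C = B
      · exact ⟨_, Finset.mem_insert_self _ _, (hM p).2 (Or.inr (hCB ▸ hp))⟩
      · exact ⟨C, Finset.mem_insert_of_mem
          (Finset.mem_erase.2 ⟨hCB, Finset.mem_erase.2 ⟨hCA, hC⟩⟩), hp⟩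
    · rintro ⟨C, hC, hp⟩
      rcases Finset.mem_insert.1 hC with rfl | hC
      · rcases (hM p).1 hp with hp | hp
        exacts [⟨A, hA, hp⟩, ⟨B, hB, hp⟩]
      · exact ⟨C, Finset.mem_of_mem_erase (Finset.mem_of_mem_erase hC), hp⟩
  · intro C hC D hD hCD p hpC hpD
    rcases Finset.mem_insert.1 hC with rfl | hC <;> rcases Finset.mem_insert.1 hD with rfl | hD
    · exact absurd rfl hCD
    · simp only [Finset.mem_erase] at hD
      exact hcon D hD.2.2 hD.2.1 hD.1 p hpC hpD
    · simp only [Finset.mem_erase] at hC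
      obtain ⟨h1, h2⟩ := hcon C hC.2.2 hC.2.1 hC.1 p hpD hpC
      exact ⟨h1.symm, fun j hj => (h2 j hj).symm⟩
    · simp only [Finset.mem_erase] at hC hD
      exact hF.contact C hC.2.2 D hD.2.2 hCD p hpC hpD
  · have h1 := Finset.card_insert_le (A.1, B.2) ((F.erase A).erase B)
    have h2 : ((F.erase A).erase B).card = (F.erase A).card - 1 :=
      Finset.card_erase_of_mem (Finset.mem_erase.2 ⟨hAB.symm, hB⟩)
    have h3 : (F.erase A).card = F.card - 1 := Finset.card_erase_of_mem hA
    have h4 : 1 < F.card := Finset.one_lt_card.2 ⟨A, hA, B, hB, hAB⟩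
    omega

/-- A brickwork with the least number of bricks is reduced: the horizontal rectangles of two bricks
that touch each other differ. -/
theorem exists_reduced_isBrickwork {i : Fin 3} {P : Set Space} (h : ∃ F, IsBrickwork i P F) :
    ∃ F, IsBrickwork i P F ∧ ∀ A ∈ F, ∀ B ∈ F, A.2 i = B.1 i →
      ∃ j, j ≠ i ∧ (A.1 j ≠ B.1 j ∨ A.2 j ≠ B.2 j) := by
  obtain ⟨F, hF, hmin⟩ := exists_minimalFor_of_wellFoundedLT (IsBrickwork i P) Finset.card h
  refine ⟨F, hF, fun A hA B hB hi => ?_⟩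
  by_contra hcon
  push Not at hcon
  obtain ⟨F', hF', hlt⟩ := hF.exists_card_lt hA hB hi hcon
  exact absurd (hmin hF' hlt.le) (not_le.2 hlt)

/-! ### Octants -/

/-- The sign `1` or `-1` encoded by a Boolean. -/
def boolSign (b : Bool) : ℝ := if b then 1 else -1

@[simp] theorem boolSign_true : boolSign true = 1 := rfl
@[simp] theorem boolSign_false : boolSign false = -1 := rfl

/-- The interval from `lo` to `hi` contains a one-sided neighbourhood of `x`, on the side given by
`b`. -/
def HasSide (lo hi x : ℝ) (b : Bool) : Prop :=
  if b then lo ≤ x ∧ x < hi else lo < x ∧ x ≤ hi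

/-- The box `B` contains the octant at `p` with signs `σ`, up to a neighbourhood of `p`. -/
def BoxOctant (B : Space × Space) (p : Space) (σ : Fin 3 → Bool) : Prop :=
  ∀ j, HasSide (B.1 j) (B.2 j) (p j) (σ j)

/-- The octant at `p` with signs `σ` is filled by a box of `F`, up to a neighbourhood of `p`. -/
def Octant (F : Finset (Space × Space)) (p : Space) (σ : Fin 3 → Bool) : Prop :=
  ∃ B ∈ F, BoxOctant B p σ

theorem HasSide.mem {lo hi x : ℝ} {b : Bool} (h : HasSide lo hi x b) : lo ≤ x ∧ x ≤ hi := by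
  cases b <;> simp only [HasSide, if_true, Bool.false_eq_true, if_false] at h
  exacts [⟨h.1.le, h.2⟩, ⟨h.1, h.2.le⟩]

theorem BoxOctant.mem {B : Space × Space} {p : Space} {σ : Fin 3 → Bool} (h : BoxOctant B p σ) :
    p ∈ Icc B.1 B.2 := ⟨fun j => (h j).mem.1, fun j => (h j).mem.2⟩

theorem exists_hasSide {lo hi x y : ℝ} (h : lo < hi) (hx : lo ≤ x ∧ x ≤ hi)
    (h1 : x = lo → x ≤ y) (h2 : x = hi → y ≤ x) :
    ∃ b, HasSide lo hi x b ∧ 0 ≤ boolSign b * (y - x) := by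
  rcases le_total x y with hxy | hxy
  · by_cases e : x = hi
    · exact ⟨false, by simp only [HasSide, Bool.false_eq_true, if_false]; exact ⟨e ▸ h, hx.2⟩, by
        have := h2 e; simp; linarith⟩
    · exact ⟨true, by simp only [HasSide, if_true]; exact ⟨hx.1, lt_of_le_of_ne hx.2 e⟩, by
        simp; linarith⟩
  · by_cases e : x = lo
    · exact ⟨true, by simp only [HasSide, if_true]; exact ⟨hx.1, e ▸ h⟩, by
        have := h1 e; simp; linarith⟩
    · exact ⟨false, by
        simp only [HasSide, Bool.false_eq_true, if_false]
        exact ⟨lt_of_le_of_ne hx.1 (Ne.symm e), hx.2⟩, by simp; linarith⟩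

theorem HasSide.imp {lo hi x y : ℝ} {b : Bool} (h : HasSide lo hi x b)
    (hy : 0 ≤ boolSign b * (y - x)) : (x = lo → x ≤ y) ∧ (x = hi → y ≤ x) := by
  cases b <;> simp only [HasSide, if_true, Bool.false_eq_true, if_false] at h <;> simp at hy
  · exact ⟨fun e => absurd e h.1.ne', fun _ => by linarith⟩
  · exact ⟨fun _ => by linarith, fun e => absurd e h.2.ne⟩

theorem eventually_mem_Icc_iff_boxOctant {B : Space × Space} (hB : ∀ j, B.1 j < B.2 j) (p : Space) :
    ∀ᶠ q in 𝓝 p, (q ∈ Icc B.1 B.2 ↔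
      ∃ σ, BoxOctant B p σ ∧ ∀ j, 0 ≤ boolSign (σ j) * (q j - p j)) := by
  by_cases hp : p ∈ Icc B.1 B.2
  · filter_upwards [eventually_mem_Icc_iff hp] with q hq
    rw [hq]
    constructor
    · intro h
      choose σ h1 h2 using fun j => exists_hasSide (hB j) ⟨hp.1 j, hp.2 j⟩ (h j).1 (h j).2
      exact ⟨σ, h1, h2⟩
    · rintro ⟨σ, h1, h2⟩ j
      exact (h1 j).imp (h2 j)
  · filter_upwards [eventually_notMem_Icc hp] with q hq
    exact iff_of_false hq fun ⟨σ, h, _⟩ => hp h.mem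

namespace IsBrickwork

variable {i : Fin 3} {P : Set Space} {F : Finset (Space × Space)} (hF : IsBrickwork i P F)

include hF

/-- The germ of `P` at a point is determined by the octants that are filled. -/
theorem eventually_mem_iff (p : Space) :
    ∀ᶠ q in 𝓝 p, (q ∈ P ↔ ∃ σ, Octant F p σ ∧ ∀ j, 0 ≤ boolSign (σ j) * (q j - p j)) := by
  filter_upwards [(Filter.eventually_all_finset F).2 fun B hB =>
    eventually_mem_Icc_iff_boxOctant (hF.lt B hB) p] with q hq
  rw [hF.mem_iff]
  constructor
  · rintro ⟨B, hB, h⟩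
    obtain ⟨σ, h1, h2⟩ := (hq B hB).1 h
    exact ⟨σ, ⟨B, hB, h1⟩, h2⟩
  · rintro ⟨σ, ⟨B, hB, h1⟩, h2⟩
    exact ⟨B, hB, (hq B hB).2 ⟨σ, h1, h2⟩⟩

theorem eventually_ray_mem_iff (p : Space) (σ : Fin 3 → Bool) :
    ∀ᶠ t : ℝ in 𝓝[>] 0, (p + t • (fun j => boolSign (σ j)) ∈ P ↔ Octant F p σ) := by
  have hc : Tendsto (fun t : ℝ => p + t • (fun j => boolSign (σ j))) (𝓝[>] 0) (𝓝 p) := by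
    have : Continuous (fun t : ℝ => p + t • (fun j => boolSign (σ j))) := by fun_prop
    simpa using (this.tendsto 0).mono_left nhdsWithin_le_nhds
  filter_upwards [hc.eventually (hF.eventually_mem_iff p), self_mem_nhdsWithin] with t ht ht0
  replace ht0 : 0 < t := ht0
  rw [ht]
  constructor
  · rintro ⟨σ', h1, h2⟩
    have : σ' = σ := funext fun j => by
      have := h2 j
      cases hs : σ j <;> cases hs' : σ' j <;> simp [hs, hs'] at this ⊢ <;> linarith
    exact this ▸ h1
  · intro h
    refine ⟨σ, h, fun j => ?_⟩
    cases hs : σ j <;> simp [hs, ht0.le]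

/-- Different bricks do not overlap. -/
theorem eq_of_boxOctant {A B : Space × Space} (hA : A ∈ F) (hB : B ∈ F) {p : Space}
    {σ : Fin 3 → Bool} (h : BoxOctant A p σ) (h' : BoxOctant B p σ) : A = B := by
  by_contra hAB
  have h1 := h i
  have h2 := h' i
  have h1m := h1.mem
  have h2m := h2.mem
  rcases (hF.contact A hA B hB hAB p h.mem h'.mem).1 with e | e <;> cases hs : σ i <;>
    simp only [hs, HasSide, if_true, Bool.false_eq_true, if_false] at h1 h2 <;> linarith

/-- A point belongs to at most two bricks. -/
theorem eq_or_eq_of_mem {A B C : Space × Space} (hA : A ∈ F) (hB : B ∈ F) (hC : C ∈ F)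
    (hAB : A ≠ B) {p : Space} (hpA : p ∈ Icc A.1 A.2) (hpB : p ∈ Icc B.1 B.2)
    (hpC : p ∈ Icc C.1 C.2) : C = A ∨ C = B := by
  by_contra h
  push Not at h
  have a := hF.lt A hA i
  have b := hF.lt B hB i
  have c := hF.lt C hC i
  have a1 := hpA.1 i
  have a2 := hpA.2 i
  have b1 := hpB.1 i
  have b2 := hpB.2 i
  have c1 := hpC.1 i
  have c2 := hpC.2 i
  rcases (hF.contact A hA B hB hAB p hpA hpB).1 with e | e <;>
  rcases (hF.contact C hC A hA h.1 p hpC hpA).1 with e' | e' <;>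
  rcases (hF.contact C hC B hB h.2 p hpC hpB).1 with e'' | e'' <;> linarith

end IsBrickwork

/-! ### Corners and parity -/

open Classical in
/-- The eight corners of a box. -/
noncomputable def boxCorners (B : Space × Space) : Finset Space :=
  Finset.univ.image fun (σ : Fin 3 → Bool) j => if σ j then B.2 j else B.1 j

theorem mem_boxCorners {B : Space × Space} {p : Space} :
    p ∈ boxCorners B ↔ ∀ j, p j = B.1 j ∨ p j = B.2 j := by
  classical
  simp only [boxCorners, Finset.mem_image, Finset.mem_univ, true_and]
  constructor
  · rintro ⟨σ, rfl⟩ j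
    cases hs : σ j <;> simp [hs]
  · intro h
    have h' : ∀ j, ∃ b : Bool, (if b then B.2 j else B.1 j) = p j := fun j => by
      rcases h j with e | e
      exacts [⟨false, by simp [e]⟩, ⟨true, by simp [e]⟩]
    choose σ hσ using h'
    exact ⟨σ, funext hσ⟩

theorem card_boxCorners {B : Space × Space} (hB : ∀ j, B.1 j < B.2 j) :
    (boxCorners B).card = 8 := by
  classical
  rw [boxCorners, Finset.card_image_of_injective]
  · simp
  · intro σ σ' h
    funext j
    have := congrFun h j
    have hlt := hB j
    cases hs : σ j <;> cases hs' : σ' j <;> simp [hs, hs'] at this ⊢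
    · exact hlt.ne this
    · exact hlt.ne' this

theorem mem_Icc_of_mem_boxCorners {B : Space × Space} (hB : ∀ j, B.1 j < B.2 j) {p : Space}
    (hp : p ∈ boxCorners B) : p ∈ Icc B.1 B.2 := by
  rw [mem_boxCorners] at hp
  refine ⟨fun j => ?_, fun j => ?_⟩ <;> have := hB j <;> rcases hp j with e | e <;> linarith

open Classical in
/-- A box fills 1, 2, 4 or 8 octants at each of its points: an odd number precisely at its
corners. -/
theorem odd_card_boxOctant_iff {B : Space × Space} (hB : ∀ j, B.1 j < B.2 j) (p : Space) :
    Odd (Finset.univ.filter fun σ => BoxOctant B p σ).card ↔ p ∈ boxCorners B := by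
  have h1 : (Finset.univ.filter fun σ => BoxOctant B p σ) = Fintype.piFinset fun j =>
      Finset.univ.filter fun b => HasSide (B.1 j) (B.2 j) (p j) b := by
    ext σ
    rw [Finset.mem_filter, Fintype.mem_piFinset]
    simp only [Finset.mem_filter, Finset.mem_univ, true_and, BoxOctant]
  have h2 : ∀ j, Odd (Finset.univ.filter fun b => HasSide (B.1 j) (B.2 j) (p j) b).card ↔
      (p j = B.1 j ∨ p j = B.2 j) := by
    intro j
    have hlt := hB j
    rw [Finset.card_filter, Fintype.sum_bool]
    simp only [HasSide, if_true, Bool.false_eq_true, if_false]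
    rcases lt_trichotomy (p j) (B.1 j) with h | h | h
    · simp [h.not_ge, h.not_gt, h.ne, (h.trans hlt).ne]
    · simp [h, hlt]
    · rcases lt_trichotomy (p j) (B.2 j) with h' | h' | h'
      · simp only [h.le, h', h, h'.le, and_self, if_true, h.ne', h'.ne, or_self, iff_false]
        decide
      · simp [h', hlt]
      · simp [h'.not_ge, h'.not_gt, h.ne', h'.ne']
  rw [h1, Fintype.card_piFinset, Fin.prod_univ_three, Nat.odd_mul, Nat.odd_mul, h2, h2, h2,
    mem_boxCorners]
  simp [Fin.forall_fin_succ, and_assoc]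

open Classical in
/-- The number of octants filled at a point has the same parity as the number of bricks that have a
corner there. -/
theorem IsBrickwork.odd_card_octant_iff {i : Fin 3} {P : Set Space} {F : Finset (Space × Space)}
    (hF : IsBrickwork i P F) (p : Space) :
    Odd (Finset.univ.filter fun σ => Octant F p σ).card ↔
      Odd (F.filter fun B => p ∈ boxCorners B).card := by
  have h1 : (Finset.univ.filter fun σ => Octant F p σ) =
      F.biUnion fun B => Finset.univ.filter fun σ => BoxOctant B p σ := by
    ext σ; simp [Octant]
  rw [h1, Finset.card_biUnion, Finset.odd_sum_iff_odd_card_odd]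
  · have : (F.filter fun B => Odd (Finset.univ.filter fun σ => BoxOctant B p σ).card) =
        F.filter fun B => p ∈ boxCorners B :=
      Finset.filter_congr fun B hB => odd_card_boxOctant_iff (hF.lt B hB) p
    rw [this]
  · intro A hA B hB hAB
    refine Finset.disjoint_left.2 fun σ h h' => hAB ?_
    exact hF.eq_of_boxOctant hA hB (Finset.mem_filter.1 h).2 (Finset.mem_filter.1 h').2

/-! ### Edge points in terms of octants -/

theorem boolSign_eq_or (b : Bool) : boolSign b = 1 ∨ boolSign b = -1 := by
  cases b <;> simp

theorem exists_bool_of_sign {σ : Fin 3 → ℝ} (hσ : ∀ j, σ j = 1 ∨ σ j = -1) :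
    ∃ τ : Fin 3 → Bool, ∀ j, σ j = boolSign (τ j) := by
  have h : ∀ j, ∃ b, σ j = boolSign b := fun j => by
    rcases hσ j with e | e
    exacts [⟨true, e⟩, ⟨false, e⟩]
  choose τ hτ using h
  exact ⟨τ, hτ⟩

theorem boolSign_mul_nonneg_iff {t : ℝ} (ht : 0 < t) (b b' : Bool) :
    0 ≤ boolSign b * (t * boolSign b') ↔ b' = b := by
  cases b <;> cases b' <;> simp [ht.le, ht]

theorem exists_boolSign_mul_nonneg (x : ℝ) : ∃ b, 0 ≤ boolSign b * x := by
  rcases le_total 0 x with h | h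
  exacts [⟨true, by simpa using h⟩, ⟨false, by simpa using h⟩]

namespace IsBrickwork

variable {i : Fin 3} {P : Set Space} {F : Finset (Space × Space)} (hF : IsBrickwork i P F)

include hF

theorem mem_convexEdgePoints_iff {p : Space} {d : Fin 3} :
    p ∈ convexEdgePoints P d ↔
      ∃ τ : Fin 3 → Bool, ∀ σ, Octant F p σ ↔ ∀ j, j ≠ d → σ j = τ j := by
  constructor
  · rintro ⟨s, hs, h⟩
    obtain ⟨τ, hτ⟩ := exists_bool_of_sign hs
    refine ⟨τ, fun σ => ?_⟩
    have hc : Tendsto (fun t : ℝ => p + t • (fun j => boolSign (σ j))) (𝓝[>] 0) (𝓝 p) := by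
      have : Continuous (fun t : ℝ => p + t • (fun j => boolSign (σ j))) := by fun_prop
      simpa using (this.tendsto 0).mono_left nhdsWithin_le_nhds
    obtain ⟨t, ⟨h1, h2⟩, ht⟩ :=
      (((hF.eventually_ray_mem_iff p σ).and (hc.eventually h)).and self_mem_nhdsWithin).exists
    replace ht : 0 < t := ht
    rw [← h1, h2]
    refine forall₂_congr fun j hj => ?_
    rw [hτ]
    simpa using boolSign_mul_nonneg_iff ht (τ j) (σ j)
  · rintro ⟨τ, hτ⟩
    refine ⟨fun j => boolSign (τ j), fun j => boolSign_eq_or (τ j), ?_⟩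
    filter_upwards [hF.eventually_mem_iff p] with q hq
    rw [hq]
    constructor
    · rintro ⟨σ, h1, h2⟩ j hj
      rw [← (hτ σ).1 h1 j hj]; exact h2 j
    · intro h
      obtain ⟨b, hb⟩ := exists_boolSign_mul_nonneg (q d - p d)
      refine ⟨Function.update τ d b, (hτ _).2 fun j hj => Function.update_of_ne hj _ _, fun j => ?_⟩
      by_cases hj : j = d
      · subst hj; simpa using hb
      · rw [Function.update_of_ne hj]; exact h j hj

theorem mem_reflexEdgePoints_iff {p : Space} {d : Fin 3} :
    p ∈ reflexEdgePoints P d ↔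
      ∃ τ : Fin 3 → Bool, ∀ σ, Octant F p σ ↔ ∃ j, j ≠ d ∧ σ j = τ j := by
  constructor
  · rintro ⟨s, hs, h⟩
    obtain ⟨τ, hτ⟩ := exists_bool_of_sign hs
    refine ⟨τ, fun σ => ?_⟩
    have hc : Tendsto (fun t : ℝ => p + t • (fun j => boolSign (σ j))) (𝓝[>] 0) (𝓝 p) := by
      have : Continuous (fun t : ℝ => p + t • (fun j => boolSign (σ j))) := by fun_prop
      simpa using (this.tendsto 0).mono_left nhdsWithin_le_nhds
    obtain ⟨t, ⟨h1, h2⟩, ht⟩ :=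
      (((hF.eventually_ray_mem_iff p σ).and (hc.eventually h)).and self_mem_nhdsWithin).exists
    replace ht : 0 < t := ht
    rw [← h1, h2]
    refine exists_congr fun j => and_congr_right fun hj => ?_
    rw [hτ]
    simpa using boolSign_mul_nonneg_iff ht (τ j) (σ j)
  · rintro ⟨τ, hτ⟩
    refine ⟨fun j => boolSign (τ j), fun j => boolSign_eq_or (τ j), ?_⟩
    filter_upwards [hF.eventually_mem_iff p] with q hq
    rw [hq]
    constructor
    · rintro ⟨σ, h1, h2⟩
      obtain ⟨j, hj, e⟩ := (hτ σ).1 h1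
      exact ⟨j, hj, e ▸ h2 j⟩
    · rintro ⟨j, hj, h⟩
      choose b hb using fun j => exists_boolSign_mul_nonneg (q j - p j)
      refine ⟨Function.update b j (τ j), (hτ _).2 ⟨j, hj, by simp⟩, fun k => ?_⟩
      by_cases hk : k = j
      · subst hk; simpa using h
      · rw [Function.update_of_ne hk]; exact hb k

/-- Along an edge, the filled octants do not depend on the sign in the direction of the edge. -/
theorem octant_update_iff {p : Space} {d : Fin 3}
    (hp : p ∈ convexEdgePoints P d ∪ reflexEdgePoints P d) (σ : Fin 3 → Bool) (b : Bool) :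
    Octant F p (Function.update σ d b) ↔ Octant F p σ := by
  rcases hp with hp | hp
  · obtain ⟨τ, hτ⟩ := hF.mem_convexEdgePoints_iff.1 hp
    rw [hτ, hτ]
    exact forall₂_congr fun j hj => by rw [Function.update_of_ne hj]
  · obtain ⟨τ, hτ⟩ := hF.mem_reflexEdgePoints_iff.1 hp
    rw [hτ, hτ]
    exact exists_congr fun j => and_congr_right fun hj => by rw [Function.update_of_ne hj]

theorem exists_octant_update_ne {p : Space} {d : Fin 3}
    (hp : p ∈ convexEdgePoints P d ∪ reflexEdgePoints P d) {j : Fin 3} (hj : j ≠ d) :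
    ∃ σ b, Octant F p σ ∧ ¬ Octant F p (Function.update σ j b) := by
  rcases hp with hp | hp
  · obtain ⟨τ, hτ⟩ := hF.mem_convexEdgePoints_iff.1 hp
    refine ⟨τ, !(τ j), (hτ τ).2 fun _ _ => rfl, fun h => ?_⟩
    have := (hτ _).1 h j hj
    simp at this
  · obtain ⟨τ, hτ⟩ := hF.mem_reflexEdgePoints_iff.1 hp
    refine ⟨Function.update (fun k => !(τ k)) j (τ j), !(τ j), (hτ _).2 ⟨j, hj, by simp⟩,
      fun h => ?_⟩
    obtain ⟨k, -, hk⟩ := (hτ _).1 h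
    by_cases hkj : k = j
    · subst hkj; simp at hk
    · simp [hkj] at hk

/-- The edges lie on the planes of the faces of the bricks. -/
theorem exists_eq_of_mem_edgePoints {p : Space} {d : Fin 3}
    (hp : p ∈ convexEdgePoints P d ∪ reflexEdgePoints P d) {j : Fin 3} (hj : j ≠ d) :
    ∃ B ∈ F, p j = B.1 j ∨ p j = B.2 j := by
  obtain ⟨σ, b, ⟨B, hB, h1⟩, h2⟩ := hF.exists_octant_update_ne hp hj
  refine ⟨B, hB, ?_⟩
  by_contra hcon
  push Not at hcon
  refine h2 ⟨B, hB, fun k => ?_⟩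
  by_cases hk : k = j
  · subst hk
    have h := (h1 k).mem
    have e1 := lt_of_le_of_ne h.1 (Ne.symm hcon.1)
    have e2 := lt_of_le_of_ne h.2 hcon.2
    rw [Function.update_self, HasSide]
    split_ifs
    exacts [⟨e1.le, e2⟩, ⟨e1, e2.le⟩]
  · rw [Function.update_of_ne hk]; exact h1 k

omit hF in
/-- Moving a little in a coordinate direction, one only sees the octants on that side. -/
theorem eventually_octant_iff (v : Space) (d : Fin 3) (s : Bool) :
    ∀ᶠ t : ℝ in 𝓝[>] 0, ∀ σ, Octant F (v + Pi.single d (t * boolSign s)) σ ↔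
      Octant F v (Function.update σ d s) := by
  have h1 : ∀ B ∈ F, ∀ᶠ t : ℝ in 𝓝[>] 0, ∀ b, HasSide (B.1 d) (B.2 d) (v d + t * boolSign s) b ↔
      HasSide (B.1 d) (B.2 d) (v d) s := by
    intro B hB
    have hc : Tendsto (fun t : ℝ => v d + t * boolSign s) (𝓝[>] 0) (𝓝 (v d)) := by
      have : Continuous (fun t : ℝ => v d + t * boolSign s) := by fun_prop
      simpa using (this.tendsto 0).mono_left nhdsWithin_le_nhds
    have hl : ∀ c : ℝ, ∀ᶠ t : ℝ in 𝓝[>] 0, (c < v d → c < v d + t * boolSign s) ∧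
        (v d < c → v d + t * boolSign s < c) := fun c =>
      (eventually_imp_distrib_left.2 fun h => hc.eventually_const_lt h).and
        (eventually_imp_distrib_left.2 fun h => hc.eventually_lt_const h)
    filter_upwards [hl (B.1 d), hl (B.2 d), self_mem_nhdsWithin] with t h1 h2 ht b
    replace ht : 0 < t := ht
    cases s <;> cases b <;>
      simp only [HasSide, if_true, Bool.false_eq_true, if_false, boolSign_true, boolSign_false]
        at h1 h2 ⊢
    · exact ⟨fun h => ⟨by linarith, by by_contra hh; linarith [h2.2, h2.1 (not_le.1 hh)]⟩,
        fun h => ⟨h1.1 h.1, by linarith⟩⟩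
    · exact ⟨fun h => ⟨by linarith, by by_contra hh; linarith [h2.2, h2.1 (not_le.1 hh)]⟩,
        fun h => ⟨(h1.1 h.1).le, by linarith⟩⟩
    · exact ⟨fun h => ⟨by by_contra hh; linarith [h1.1, h1.2 (not_le.1 hh)], by linarith⟩,
        fun h => ⟨by linarith, (h2.2 h.2).le⟩⟩
    · exact ⟨fun h => ⟨by by_contra hh; linarith [h1.1, h1.2 (not_le.1 hh)], by linarith⟩,
        fun h => ⟨by linarith, h2.2 h.2⟩⟩
  filter_upwards [(Filter.eventually_all_finset F).2 h1] with t ht σ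
  refine exists_congr fun B => and_congr_right fun hB => forall_congr' fun j => ?_
  by_cases hj : j = d
  · subst hj
    simpa using ht B hB (σ j)
  · simp [hj]

end IsBrickwork

/-! ### Counting edges by their endpoints -/

open Classical in
/-- At a point where an odd number of octants is filled, there is for each axis a side on which an
odd number of octants is filled: one of four, or three of four. -/
theorem exists_side_of_odd_card {f : (Fin 3 → Bool) → Prop}
    (hf : Odd (Finset.univ.filter f).card) (d : Fin 3) :
    ∃ s, (∃ τ : Fin 3 → Bool, ∀ σ, f (Function.update σ d s) ↔ ∀ j, j ≠ d → σ j = τ j) ∨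
      ∃ τ : Fin 3 → Bool, ∀ σ, f (Function.update σ d s) ↔ ∃ j, j ≠ d ∧ σ j = τ j := by
  have hT : ∃ s, Odd ((Finset.univ.filter f).filter fun σ => σ d = s).card := by
    by_contra hcon
    push Not at hcon
    have h1 := Finset.card_filter_add_card_filter_not (s := Finset.univ.filter f)
      (fun σ : Fin 3 → Bool => σ d = true)
    simp only [Bool.not_eq_true] at h1
    rw [← h1] at hf
    exact (Nat.not_odd_iff_even.2 ((Nat.not_odd_iff_even.1 (hcon true)).add
      (Nat.not_odd_iff_even.1 (hcon false)))) hf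
  obtain ⟨s, hs⟩ := hT
  set T := (Finset.univ.filter f).filter fun σ => σ d = s with hTdef
  have hmem : ∀ σ, Function.update σ d s ∈ T ↔ f (Function.update σ d s) := fun σ => by
    simp [hTdef]
  have hH : (Finset.univ.filter fun σ : Fin 3 → Bool => σ d = s).card = 4 := by
    have : ∀ d s, (Finset.univ.filter fun σ : Fin 3 → Bool => σ d = s).card = 4 := by decide
    convert this d s
  have hTH : T ⊆ Finset.univ.filter fun σ : Fin 3 → Bool => σ d = s := fun σ hσ => by
    simpa using (Finset.mem_filter.1 hσ).2
  have heq : ∀ σ τ : Fin 3 → Bool, τ d = s →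
      (Function.update σ d s = τ ↔ ∀ j, j ≠ d → σ j = τ j) := by
    rintro σ τ rfl
    constructor
    · intro h j hj
      rw [← h, Function.update_of_ne hj]
    · intro h
      funext j
      by_cases hj : j = d
      · subst hj; simp
      · rw [Function.update_of_ne hj, h j hj]
  have hle := Finset.card_le_card hTH
  rw [hH] at hle
  have hcard : T.card = 1 ∨ T.card = 3 := by
    obtain ⟨k, hk⟩ := hs
    omega
  refine ⟨s, ?_⟩
  rcases hcard with h | h
  · obtain ⟨τ, hτ⟩ := Finset.card_eq_one.1 h
    have hτd : τ d = s := by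
      have : τ ∈ T := by rw [hτ]; exact Finset.mem_singleton_self τ
      simpa using (Finset.mem_filter.1 this).2
    refine Or.inl ⟨τ, fun σ => ?_⟩
    rw [← hmem, hτ, Finset.mem_singleton, heq σ τ hτd]
  · have h1 : ((Finset.univ.filter fun σ : Fin 3 → Bool => σ d = s) \ T).card = 1 := by
      rw [Finset.card_sdiff_of_subset hTH, hH, h]
    obtain ⟨τ, hτ⟩ := Finset.card_eq_one.1 h1
    have hτm : τ ∈ (Finset.univ.filter fun σ : Fin 3 → Bool => σ d = s) \ T := by
      rw [hτ]; exact Finset.mem_singleton_self τ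
    have hτd : τ d = s := by simpa using (Finset.mem_sdiff.1 hτm).1
    refine Or.inr ⟨fun j => !(τ j), fun σ => ?_⟩
    have h2 : Function.update σ d s ∉ T ↔ Function.update σ d s = τ := by
      rw [← Finset.mem_singleton, ← hτ, Finset.mem_sdiff]
      simp
    rw [← hmem, ← not_iff_not, h2, heq σ τ hτd]
    push Not
    exact forall₂_congr fun j hj => by simp

open Classical in
theorem even_card_of_update_iff {f : (Fin 3 → Bool) → Prop} {d : Fin 3}
    (h : ∀ σ b, f (Function.update σ d b) ↔ f σ) : Even (Finset.univ.filter f).card := by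
  rw [← Finset.card_filter_add_card_filter_not (s := Finset.univ.filter f)
      (fun σ : Fin 3 → Bool => σ d = true)]
  have : ((Finset.univ.filter f).filter fun σ => σ d = true).card =
      ((Finset.univ.filter f).filter fun σ => ¬ σ d = true).card := by
    refine Finset.card_nbij' (fun σ => Function.update σ d false)
      (fun σ => Function.update σ d true) ?_ ?_ ?_ ?_
    · intro σ hσ
      simp only [Finset.coe_filter, Finset.mem_filter, Finset.mem_univ, true_and,
        mem_ofPred_eq] at hσ ⊢
      exact ⟨(h _ _).2 hσ.1, by simp⟩
    · intro σ hσ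
      simp only [Finset.coe_filter, Finset.mem_filter, Finset.mem_univ, true_and,
        mem_ofPred_eq] at hσ ⊢
      exact ⟨(h _ _).2 hσ.1, by simp⟩
    · intro σ hσ
      simp only [Finset.coe_filter, Finset.mem_filter, Finset.mem_univ, true_and,
        mem_ofPred_eq] at hσ
      simp [← hσ.2]
    · intro σ hσ
      simp only [Finset.coe_filter, Finset.mem_filter, Finset.mem_univ, true_and,
        mem_ofPred_eq, Bool.not_eq_true] at hσ
      simp [← hσ.2]
  rw [this]
  exact ⟨_, rfl⟩

/-- The point `v` is an endpoint of the open segment `e`, which has the direction of the `d`-th axis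
and leaves `v` towards the side `s`. -/
structure IsEdgeEnd (e : Set Space) (v : Space) (d : Fin 3) (s : Bool) : Prop where
  isPreconnected : IsPreconnected e
  notMem : v ∉ e
  line : ∀ q ∈ e, ∀ j, j ≠ d → q j = v j
  ray : ∃ ε > 0, ∀ t, 0 < t → t < ε → v + Pi.single d (t * boolSign s) ∈ e

theorem IsEdgeEnd.eq_of_le {e : Set Space} {v v' : Space} {d : Fin 3} {s : Bool}
    (h : IsEdgeEnd e v d s) (h' : IsEdgeEnd e v' d s)
    (hle : boolSign s * v d ≤ boolSign s * v' d) : v = v' := by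
  have hline : ∀ j, j ≠ d → v j = v' j := by
    obtain ⟨ε, hε, hr⟩ := h.ray
    intro j hj
    have := h'.line _ (hr (ε / 2) (by linarith) (by linarith)) j hj
    simpa [hj] using this
  have hsq : boolSign s * boolSign s = 1 := by cases s <;> simp
  rcases hle.eq_or_lt with he | hlt
  · funext j
    by_cases hj : j = d
    · subst hj
      have := congrArg (boolSign s * ·) he
      simpa [← mul_assoc, hsq] using this
    · exact hline j hj
  -- otherwise `v'` would lie between two points of the connected set `e`
  exfalso
  obtain ⟨ε, hε, hr⟩ := h.ray
  obtain ⟨ε', hε', hr'⟩ := h'.ray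
  set t := min (ε / 2) ((boolSign s * v' d - boolSign s * v d) / 2) with ht
  have ht0 : 0 < t := lt_min (by linarith) (by linarith)
  have ht1 : t ≤ ε / 2 := min_le_left _ _
  have ht2 : t ≤ (boolSign s * v' d - boolSign s * v d) / 2 := min_le_right _ _
  have p1 := hr t ht0 (by linarith)
  have p2 := hr' (ε' / 2) (by linarith) (by linarith)
  have hconn : IsPreconnected ((fun q : Space => boolSign s * q d) '' e) :=
    h.isPreconnected.image _ (by fun_prop)
  obtain ⟨q, hq, hqe⟩ := hconn.Icc_subset (mem_image_of_mem _ p1) (mem_image_of_mem _ p2)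
    (show boolSign s * v' d ∈ _ by
      have e1 : boolSign s * (v d + t * boolSign s) = boolSign s * v d + t * (boolSign s * boolSign s) := by
        ring
      have e2 : boolSign s * (v' d + ε' / 2 * boolSign s) =
        boolSign s * v' d + ε' / 2 * (boolSign s * boolSign s) := by ring
      simp only [Pi.add_apply, Pi.single_eq_same, mem_Icc]
      rw [e1, e2, hsq]
      constructor <;> linarith)
  refine h'.notMem ?_
  have : v' = q := by
    funext j
    by_cases hj : j = d
    · subst hj
      have := congrArg (boolSign s * ·) hqe
      simpa [← mul_assoc, hsq] using this.symm
    · exact (h'.line q hq j hj).symm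
  rw [this]; exact hq

/-- An edge has only one endpoint on each side. -/
theorem IsEdgeEnd.unique {e : Set Space} {v v' : Space} {d d' : Fin 3} {s : Bool}
    (h : IsEdgeEnd e v d s) (h' : IsEdgeEnd e v' d' s) : v = v' ∧ d = d' := by
  have hd : d = d' := by
    by_contra hd
    obtain ⟨ε, hε, hr⟩ := h.ray
    have e1 := h'.line _ (hr (ε / 2) (by linarith) (by linarith)) d hd
    have e2 := h'.line _ (hr (ε / 3) (by linarith) (by linarith)) d hd
    simp only [Pi.add_apply, Pi.single_eq_same] at e1 e2
    cases s <;> simp at e1 e2 <;> linarith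
  subst hd
  refine ⟨?_, rfl⟩
  rcases le_total (boolSign s * v d) (boolSign s * v' d) with hle | hle
  exacts [h.eq_of_le h' hle, (h'.eq_of_le h hle).symm]

theorem IsPreconnected.subsingleton_of_subset_finite {s : Set ℝ} (hs : IsPreconnected s)
    {K : Set ℝ} (hK : K.Finite) (hsK : s ⊆ K) {x y : ℝ} (hx : x ∈ s) (hy : y ∈ s) : x = y := by
  rcases lt_trichotomy x y with h | h | h
  · exact absurd (hK.subset ((hs.Icc_subset hx hy).trans hsK)) (Icc_infinite h)
  · exact h
  · exact absurd (hK.subset ((hs.Icc_subset hy hx).trans hsK)) (Icc_infinite h)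

namespace IsBrickwork

variable {i : Fin 3} {P : Set Space} {F : Finset (Space × Space)} (hF : IsBrickwork i P F)

include hF

open Classical in
theorem exists_isEdgeEnd {v : Space} (hv : Odd (Finset.univ.filter fun σ => Octant F v σ).card)
    (d : Fin 3) : ∃ e ∈ polyhedronEdges P, ∃ s, IsEdgeEnd e v d s := by
  obtain ⟨s, hs⟩ := exists_side_of_odd_card hv d
  obtain ⟨X, hX, hXe, hXv⟩ : ∃ X : Set Space, X ⊆ convexEdgePoints P d ∪ reflexEdgePoints P d ∧
      (∀ p ∈ X, connectedComponentIn X p ∈ polyhedronEdges P) ∧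
      ∀ᶠ t : ℝ in 𝓝[>] 0, v + Pi.single d (t * boolSign s) ∈ X := by
    rcases hs with ⟨τ, hτ⟩ | ⟨τ, hτ⟩
    · refine ⟨convexEdgePoints P d, subset_union_left,
        fun p hp => Or.inl (mem_iUnion.2 ⟨d, p, hp, rfl⟩), ?_⟩
      filter_upwards [eventually_octant_iff (F := F) v d s] with t ht
      exact hF.mem_convexEdgePoints_iff.2 ⟨τ, fun σ => (ht σ).trans (hτ σ)⟩
    · refine ⟨reflexEdgePoints P d, subset_union_right,
        fun p hp => Or.inr (mem_iUnion.2 ⟨d, p, hp, rfl⟩), ?_⟩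
      filter_upwards [eventually_octant_iff (F := F) v d s] with t ht
      exact hF.mem_reflexEdgePoints_iff.2 ⟨τ, fun σ => (ht σ).trans (hτ σ)⟩
  obtain ⟨ε, hε, hεX⟩ := mem_nhdsGT_iff_exists_Ioo_subset.1 hXv
  replace hε : 0 < ε := hε
  have hp : v + Pi.single d (ε / 2 * boolSign s) ∈ X :=
    hεX (show ε / 2 ∈ Ioo 0 ε from ⟨by linarith, by linarith⟩)
  refine ⟨_, hXe _ hp, s, isPreconnected_connectedComponentIn, fun hmem => ?_, fun q hq j hj => ?_,
    ε, hε, fun t ht0 htε => ?_⟩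
  · have hvX := hX (connectedComponentIn_subset X _ hmem)
    exact Nat.not_odd_iff_even.2 (even_card_of_update_iff fun σ b => hF.octant_update_iff hvX σ b) hv
  · have hK : {x | ∃ B ∈ F, x = B.1 j ∨ x = B.2 j}.Finite := by
      refine ((F.finite_toSet.image fun B => B.1 j).union
        (F.finite_toSet.image fun B => B.2 j)).subset ?_
      rintro x ⟨B, hB, rfl | rfl⟩
      exacts [Or.inl ⟨B, hB, rfl⟩, Or.inr ⟨B, hB, rfl⟩]
    have hpre : IsPreconnected ((fun q : Space => q j) ''
        connectedComponentIn X (v + Pi.single d (ε / 2 * boolSign s))) :=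
      isPreconnected_connectedComponentIn.image _ (by fun_prop)
    have := hpre.subsingleton_of_subset_finite hK ?_ (mem_image_of_mem _ hq)
      (mem_image_of_mem _ (mem_connectedComponentIn hp))
    · simpa [hj] using this
    · rintro _ ⟨q, hq, rfl⟩
      exact hF.exists_eq_of_mem_edgePoints (hX (connectedComponentIn_subset X _ hq)) hj
  · have hpre : IsPreconnected ((fun t : ℝ => v + Pi.single d (t * boolSign s)) '' Ioo 0 ε) := by
      refine isPreconnected_Ioo.image _ (Continuous.continuousOn ?_)
      exact continuous_const.add
        ((continuous_single (A := fun _ : Fin 3 => ℝ) d).comp (by fun_prop))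
    refine hpre.subset_connectedComponentIn ?_ ?_ (mem_image_of_mem _ ⟨ht0, htε⟩)
    · exact ⟨ε / 2, ⟨by linarith, by linarith⟩, rfl⟩
    · rintro _ ⟨t, ht, rfl⟩
      exact hεX ht

omit hF in
/-- If a set is a union of fibres of a map to a finite type all of whose fibres are connected, then
it has finitely many components. -/
theorem finite_components {T : Type*} [Finite T] (κ : Space → T)
    (hκ : ∀ c, IsPreconnected (κ ⁻¹' {c})) {E : Set Space}
    (hE : ∀ p q, κ p = κ q → p ∈ E → q ∈ E) :
    {e | ∃ p ∈ E, e = connectedComponentIn E p}.Finite := by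
  classical
  let f : T → Set Space := fun c =>
    if h : ∃ p, κ p = c then connectedComponentIn E h.choose else ∅
  refine (finite_range f).subset ?_
  rintro _ ⟨p, hp, rfl⟩
  have h : ∃ q, κ q = κ p := ⟨p, rfl⟩
  refine ⟨κ p, ?_⟩
  simp only [f, dif_pos h]
  refine connectedComponentIn_eq ?_
  refine (hκ (κ p)).subset_connectedComponentIn h.choose_spec ?_ rfl
  intro q hq
  exact hE p q hq.symm hp

theorem finite_polyhedronEdges : (polyhedronEdges P).Finite := by
  -- the relative position of a point with respect to the planes of the faces of the bricks
  let κ : Space → Fin 3 → F → SignType × SignType := fun p j B =>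
    (SignType.sign (p j - B.1.1 j), SignType.sign (p j - B.1.2 j))
  have hκ : ∀ c, IsPreconnected (κ ⁻¹' {c}) := by
    intro c
    have hconv : ∀ (j : Fin 3) (x : ℝ) (s : SignType),
        Convex ℝ {p : Space | SignType.sign (p j - x) = s} := by
      intro j x s
      have h1 : Monotone fun r : ℝ => SignType.sign (r - x) :=
        SignType.sign.monotone.comp fun a b h => sub_le_sub_right h x
      have h2 : ((fun r : ℝ => SignType.sign (r - x)) ⁻¹' {s}).OrdConnected :=
        ordConnected_singleton.preimage_mono h1
      exact h2.convex.linear_preimage (LinearMap.proj (R := ℝ) (φ := fun _ : Fin 3 => ℝ) j)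
    have heq : κ ⁻¹' {c} = ⋂ j : Fin 3, ⋂ B : F, {p : Space | SignType.sign (p j - B.1.1 j) = (c j B).1} ∩
        {p : Space | SignType.sign (p j - B.1.2 j) = (c j B).2} := by
      ext p
      simp only [mem_preimage, mem_singleton_iff, mem_iInter, mem_inter_iff, mem_ofPred_eq, κ]
      constructor
      · rintro rfl j B
        exact ⟨rfl, rfl⟩
      · intro h
        funext j B
        exact Prod.ext (h j B).1 (h j B).2
    rw [heq]
    exact (convex_iInter fun j => convex_iInter fun B =>
      (hconv j _ _).inter (hconv j _ _)).isPreconnected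
  have hoct : ∀ p q, κ p = κ q → ∀ σ, Octant F p σ ↔ Octant F q σ := by
    intro p q h σ
    refine exists_congr fun B => and_congr_right fun hB => forall_congr' fun j => ?_
    have hs : ∀ x y c : ℝ, SignType.sign (x - c) = SignType.sign (y - c) →
        (x < c ↔ y < c) ∧ (c < x ↔ c < y) := by
      intro x y c h
      constructor
      · rw [← sub_neg, ← sub_neg (a := y), ← sign_eq_neg_one_iff, h, sign_eq_neg_one_iff]
      · rw [← sub_pos, ← sub_pos (a := y), ← sign_eq_one_iff, h, sign_eq_one_iff]
    have h1 := congrFun (congrFun h j) ⟨B, hB⟩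
    obtain ⟨h2, h3⟩ := Prod.ext_iff.1 h1
    obtain ⟨e1, e2⟩ := hs _ _ _ h2
    obtain ⟨e3, e4⟩ := hs _ _ _ h3
    simp only [HasSide, ← not_lt, e1, e2, e3, e4]
  refine Finite.union (finite_iUnion fun d => ?_) (finite_iUnion fun d => ?_)
  · refine finite_components κ hκ fun p q h hp => ?_
    rw [hF.mem_convexEdgePoints_iff] at hp ⊢
    simpa only [hoct p q h] using hp
  · refine finite_components κ hκ fun p q h hp => ?_
    rw [hF.mem_reflexEdgePoints_iff] at hp ⊢
    simpa only [hoct p q h] using hp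

open Classical in
/-- Each point that is a corner of exactly one brick is the endpoint of three edges. -/
theorem three_mul_card_le (V : Finset Space)
    (hV : ∀ v ∈ V, (F.filter fun B => v ∈ boxCorners B).card = 1) :
    3 * V.card ≤ 2 * (polyhedronEdges P).ncard := by
  have hodd : ∀ v ∈ V, ∀ d, ∃ e ∈ polyhedronEdges P, ∃ s, IsEdgeEnd e v d s := fun v hv d =>
    hF.exists_isEdgeEnd (by rw [hF.odd_card_octant_iff, hV v hv]; exact odd_one) d
  choose! e he s hs using hodd
  have hfin := hF.finite_polyhedronEdges
  have := Finset.card_le_card_of_injOn (s := V ×ˢ (Finset.univ : Finset (Fin 3)))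
    (t := hfin.toFinset ×ˢ (Finset.univ : Finset Bool))
    (fun x => (e x.1 x.2, s x.1 x.2)) ?_ ?_
  · rw [Finset.card_product, Finset.card_product, ← ncard_eq_toFinset_card _ hfin] at this
    simp only [Finset.card_univ, Fintype.card_fin, Fintype.card_bool] at this
    omega
  · rintro ⟨v, d⟩ hx
    simp only [Finset.coe_product, mem_prod, Finset.mem_coe] at hx
    simpa using he v hx.1 d
  · rintro ⟨v, d⟩ hx ⟨v', d'⟩ hx' h
    simp only [Finset.coe_product, mem_prod, Finset.mem_coe] at hx hx'
    obtain ⟨h1, h2⟩ := Prod.ext_iff.1 h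
    have a := hs v hx.1 d
    have b := hs v' hx'.1 d'
    simp only at h1 h2
    rw [h1, h2] at a
    obtain ⟨rfl, rfl⟩ := a.unique b
    rfl

end IsBrickwork

/-! ### Reflex edges at contacts -/

theorem hasSide_of_lt {lo hi x : ℝ} (h1 : lo < x) (h2 : x < hi) (b : Bool) : HasSide lo hi x b := by
  cases b <;> simp only [HasSide, if_true, Bool.false_eq_true, if_false]
  exacts [⟨h1, h2.le⟩, ⟨h1.le, h2⟩]

theorem hasSide_left_iff {lo hi : ℝ} (h : lo < hi) (b : Bool) : HasSide lo hi lo b ↔ b = true := by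
  cases b <;> simp [HasSide, h]

theorem hasSide_right_iff {lo hi : ℝ} (h : lo < hi) (b : Bool) :
    HasSide lo hi hi b ↔ b = false := by
  cases b <;> simp [HasSide, h]

/-- Two different overlapping intervals: one of them has an endpoint inside the other. -/
theorem exists_hasSide_of_ne {a₁ a₂ b₁ b₂ : ℝ} (ha : a₁ < a₂) (hb : b₁ < b₂) (h1 : a₁ < b₂)
    (h2 : b₁ < a₂) (hne : a₁ ≠ b₁ ∨ a₂ ≠ b₂) :
    ∃ x c, ((∀ b, HasSide a₁ a₂ x b) ∧ ∀ b, HasSide b₁ b₂ x b ↔ b = c) ∨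
      ((∀ b, HasSide b₁ b₂ x b) ∧ ∀ b, HasSide a₁ a₂ x b ↔ b = c) := by
  rcases hne with h | h <;> rcases lt_or_gt_of_ne h with h | h
  · exact ⟨b₁, true, Or.inl ⟨hasSide_of_lt h h2, hasSide_left_iff hb⟩⟩
  · exact ⟨a₁, true, Or.inr ⟨hasSide_of_lt h h1, hasSide_left_iff ha⟩⟩
  · exact ⟨a₂, false, Or.inr ⟨hasSide_of_lt h2 h, hasSide_right_iff ha⟩⟩
  · exact ⟨b₂, false, Or.inl ⟨hasSide_of_lt h1 h, hasSide_right_iff hb⟩⟩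

namespace IsBrickwork

variable {i : Fin 3} {P : Set Space} {F : Finset (Space × Space)} (hF : IsBrickwork i P F)

include hF

theorem octant_iff_of_mem {A B : Space × Space} (hA : A ∈ F) (hB : B ∈ F) (hAB : A ≠ B) {p : Space}
    (hpA : p ∈ Icc A.1 A.2) (hpB : p ∈ Icc B.1 B.2) (σ : Fin 3 → Bool) :
    Octant F p σ ↔ BoxOctant A p σ ∨ BoxOctant B p σ := by
  constructor
  · rintro ⟨C, hC, h⟩
    rcases hF.eq_or_eq_of_mem hA hB hC hAB hpA hpB h.mem with rfl | rfl
    exacts [Or.inl h, Or.inr h]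
  · rintro (h | h)
    exacts [⟨A, hA, h⟩, ⟨B, hB, h⟩]

/-- If two bricks that touch each other have different horizontal rectangles, there is a reflex edge
between them. -/
theorem exists_reflexEdge {A B : Space × Space} (hA : A ∈ F) (hB : B ∈ F) (hi : A.2 i = B.1 i)
    {p : Space} (hpA : p ∈ Icc A.1 A.2) (hpB : p ∈ Icc B.1 B.2) {j : Fin 3} (hj : j ≠ i)
    (hne : A.1 j ≠ B.1 j ∨ A.2 j ≠ B.2 j) :
    ∃ e ∈ reflexEdges P, ∃ q ∈ e, q ∈ Icc A.1 A.2 ∧ q ∈ Icc B.1 B.2 := by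
  have hA' := hF.lt A hA
  have hB' := hF.lt B hB
  have hAB : A ≠ B := by
    rintro rfl
    exact (hA' i).ne hi.symm
  obtain ⟨d, hdi, hdj, hcov⟩ : ∃ d, d ≠ i ∧ d ≠ j ∧ ∀ k, k = i ∨ k = j ∨ k = d := by
    clear hi hne hF hpA hpB
    revert i j; decide
  have hov := (hF.contact A hA B hB hAB p hpA hpB).2
  obtain ⟨x, c, hx⟩ := exists_hasSide_of_ne (hA' j) (hB' j) (hov j hj).1 (hov j hj).2 hne
  obtain ⟨y, hy1, hy2⟩ := exists_between (max_lt (lt_min (hA' d) (hov d hdi).1)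
    (lt_min (hov d hdi).2 (hB' d)))
  simp only [max_lt_iff, lt_min_iff] at hy1 hy2
  set q : Space := fun k => if k = i then A.2 i else if k = j then x else y with hq
  have hqi : q i = A.2 i := by simp [hq]
  have hqj : q j = x := by simp [hq, hj]
  have hqd : q d = y := by simp [hq, hdi, hdj]
  have hall : ∀ R : Fin 3 → Prop, (∀ k, R k) ↔ R i ∧ R j ∧ R d := fun R =>
    ⟨fun h => ⟨h i, h j, h d⟩, fun h k => by
      rcases hcov k with rfl | rfl | rfl
      exacts [h.1, h.2.1, h.2.2]⟩
  have hoA : ∀ σ, BoxOctant A q σ ↔ σ i = false ∧ HasSide (A.1 j) (A.2 j) x (σ j) := by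
    intro σ
    rw [BoxOctant, hall, hqi, hqj, hqd, hasSide_right_iff (hA' i)]
    simp [hasSide_of_lt hy1.1 hy2.1]
  have hoB : ∀ σ, BoxOctant B q σ ↔ σ i = true ∧ HasSide (B.1 j) (B.2 j) x (σ j) := by
    intro σ
    rw [BoxOctant, hall, hqi, hqj, hqd, hi, hasSide_left_iff (hB' i)]
    simp [hasSide_of_lt hy1.2 hy2.2]
  have hside : (∃ b, HasSide (A.1 j) (A.2 j) x b) ∧ ∃ b, HasSide (B.1 j) (B.2 j) x b := by
    rcases hx with ⟨h1, h2⟩ | ⟨h1, h2⟩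
    exacts [⟨⟨c, h1 c⟩, ⟨c, (h2 c).2 rfl⟩⟩, ⟨⟨c, (h2 c).2 rfl⟩, ⟨c, h1 c⟩⟩]
  obtain ⟨⟨b, hb⟩, ⟨b', hb'⟩⟩ := hside
  have hqA : q ∈ Icc A.1 A.2 := ((hoA (fun k => if k = i then false else b)).2 (by simp [hj, hb])).mem
  have hqB : q ∈ Icc B.1 B.2 :=
    ((hoB (fun k => if k = i then true else b')).2 (by simp [hj, hb'])).mem
  have hex : ∀ R : Fin 3 → Prop, (∃ k, k ≠ d ∧ R k) ↔ R i ∨ R j := fun R =>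
    ⟨fun ⟨k, hk, h⟩ => by
      rcases hcov k with rfl | rfl | rfl
      exacts [Or.inl h, Or.inr h, absurd rfl hk], fun h => by
      rcases h with h | h
      exacts [⟨i, hdi.symm, h⟩, ⟨j, hdj.symm, h⟩]⟩
  have hmem : q ∈ reflexEdgePoints P d := by
    rw [hF.mem_reflexEdgePoints_iff]
    rcases hx with ⟨h1, h2⟩ | ⟨h1, h2⟩
    · refine ⟨fun k => if k = i then false else c, fun σ => ?_⟩
      rw [hF.octant_iff_of_mem hA hB hAB hqA hqB, hoA, hoB, hex, h2]
      simp only [h1, and_true, if_true, if_neg hj]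
      cases σ i <;> simp
    · refine ⟨fun k => if k = i then true else c, fun σ => ?_⟩
      rw [hF.octant_iff_of_mem hA hB hAB hqA hqB, hoA, hoB, hex, h2]
      simp only [h1, and_true, if_true, if_neg hj]
      cases σ i <;> simp
  exact ⟨_, mem_iUnion.2 ⟨d, q, hmem, rfl⟩, q, mem_connectedComponentIn hmem, hqA, hqB⟩

/-! ### The boundary surface -/

theorem isClosed : IsClosed P := by
  have : P = ⋃ B ∈ F, Icc B.1 B.2 := by
    ext p
    rw [hF.mem_iff]
    simp only [mem_iUnion, exists_prop]
  rw [this]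
  exact F.finite_toSet.isClosed_biUnion fun B _ => isClosed_Icc

theorem mem_frontier_iff {p : Space} : p ∈ frontier P ↔ p ∈ P ∧ ∃ σ, ¬ Octant F p σ := by
  rw [hF.isClosed.frontier_eq, Set.mem_sdiff]
  refine and_congr_right fun hp => ?_
  rw [← not_forall, not_iff_not, mem_interior_iff_mem_nhds]
  constructor
  · intro h σ
    have hc : Tendsto (fun t : ℝ => p + t • (fun j => boolSign (σ j))) (𝓝[>] 0) (𝓝 p) := by
      have : Continuous (fun t : ℝ => p + t • (fun j => boolSign (σ j))) := by fun_prop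
      simpa using (this.tendsto 0).mono_left nhdsWithin_le_nhds
    obtain ⟨t, h1, h2⟩ := ((hF.eventually_ray_mem_iff p σ).and (hc.eventually h)).exists
    exact h1.1 h2
  · intro h
    filter_upwards [hF.eventually_mem_iff p] with q hq
    rw [hq]
    choose b hb using fun j => exists_boolSign_mul_nonneg (q j - p j)
    exact ⟨b, h b, hb⟩

omit hF in
theorem forall_hasSide_iff {lo hi x : ℝ} (h : lo ≤ x ∧ x ≤ hi) :
    (∀ b, HasSide lo hi x b) ↔ ¬ (x = lo ∨ x = hi) := by
  simp only [HasSide, Bool.forall_bool, Bool.false_eq_true, if_false, if_true]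
  constructor
  · rintro ⟨h1, h2⟩ (h | h) <;> linarith [h1.1, h2.2]
  · intro hne
    push Not at hne
    have e1 := lt_of_le_of_ne h.1 (Ne.symm hne.1)
    have e2 := lt_of_le_of_ne h.2 hne.2
    exact ⟨⟨e1, e2.le⟩, ⟨e1.le, e2⟩⟩

/-- A point in a single brick is on the surface if and only if it is on that of the brick. -/
theorem mem_frontier_iff_of_unique {A : Space × Space} (hA : A ∈ F) {p : Space}
    (hp : p ∈ Icc A.1 A.2) (h : ∀ B ∈ F, p ∈ Icc B.1 B.2 → B = A) :
    p ∈ frontier P ↔ ∃ j, p j = A.1 j ∨ p j = A.2 j := by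
  have hO : ∀ σ, Octant F p σ ↔ BoxOctant A p σ := fun σ =>
    ⟨fun ⟨B, hB, h'⟩ => h B hB h'.mem ▸ h', fun h' => ⟨A, hA, h'⟩⟩
  rw [hF.mem_frontier_iff, and_iff_right ((hF.mem_iff p).2 ⟨A, hA, hp⟩), ← not_iff_not]
  push Not
  simp only [hO, ← not_or, ← forall_hasSide_iff ⟨hp.1 _, hp.2 _⟩]
  exact ⟨fun h j b => by simpa using h (fun _ => b) j, fun h σ j => h j (σ j)⟩

/-- A point in two bricks is on the surface if and only if it is on the perimeter of their contact
rectangle. -/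
theorem mem_frontier_iff_of_contact {A B : Space × Space} (hA : A ∈ F) (hB : B ∈ F)
    (hi : A.2 i = B.1 i) {p : Space} (hpA : p ∈ Icc A.1 A.2) (hpB : p ∈ Icc B.1 B.2) :
    p ∈ frontier P ↔ ∃ j, j ≠ i ∧ ((p j = A.1 j ∨ p j = A.2 j) ∨ p j = B.1 j ∨ p j = B.2 j) := by
  have hA' := hF.lt A hA
  have hB' := hF.lt B hB
  have hAB : A ≠ B := by
    rintro rfl
    exact (hA' i).ne hi.symm
  have hpi : p i = A.2 i := le_antisymm (hpA.2 i) (hi ▸ hpB.1 i)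
  rw [hF.mem_frontier_iff, and_iff_right ((hF.mem_iff p).2 ⟨A, hA, hpA⟩), ← not_iff_not]
  push Not
  have h1 : ∀ b, HasSide (A.1 i) (A.2 i) (p i) b ↔ b = false := by
    rw [hpi]; exact hasSide_right_iff (hA' i)
  have h2 : ∀ b, HasSide (B.1 i) (B.2 i) (p i) b ↔ b = true := by
    rw [hpi, hi]; exact hasSide_left_iff (hB' i)
  have hR : (∀ j, j ≠ i → (p j ≠ A.1 j ∧ p j ≠ A.2 j) ∧ p j ≠ B.1 j ∧ p j ≠ B.2 j) ↔
      ∀ j, j ≠ i → ∀ b, HasSide (A.1 j) (A.2 j) (p j) b ∧ HasSide (B.1 j) (B.2 j) (p j) b := by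
    refine forall₂_congr fun j _ => ?_
    rw [forall_and, forall_hasSide_iff ⟨hpA.1 j, hpA.2 j⟩, forall_hasSide_iff ⟨hpB.1 j, hpB.2 j⟩]
    push Not
    exact Iff.rfl
  rw [hR]
  simp only [hF.octant_iff_of_mem hA hB hAB hpA hpB]
  constructor
  · intro h j hj b
    constructor
    · rcases h (fun k => if k = i then false else b) with h | h
      · simpa [hj] using h j
      · exact absurd ((h2 _).1 (h i)) (by simp)
    · rcases h (fun k => if k = i then true else b) with h | h
      · exact absurd ((h1 _).1 (h i)) (by simp)
      · simpa [hj] using h j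
  · intro h σ
    cases hs : σ i
    · left
      intro j
      by_cases hj : j = i
      · subst hj; exact (h1 _).2 hs
      · exact (h j hj _).1
    · right
      intro j
      by_cases hj : j = i
      · subst hj; exact (h2 _).2 hs
      · exact (h j hj _).2

end IsBrickwork

/-! ### Perimeters of rectangles -/

/-- The point at height `z` over the point `w` of the complex plane, the real axis of which has the
direction `a`. -/
def planarPoint (i a : Fin 3) (w : ℂ) (z : ℝ) : Space :=
  fun j => if j = i then z else if j = a then w.re else w.im

theorem continuous_planarPoint (i a : Fin 3) :
    Continuous fun x : ℂ × ℝ => planarPoint i a x.1 x.2 := by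
  refine continuous_pi fun j => ?_
  simp only [planarPoint]
  split_ifs
  · exact continuous_snd
  · exact Complex.continuous_re.comp continuous_fst
  · exact Complex.continuous_im.comp continuous_fst

/-- The perimeter of a rectangle in the complex plane is homeomorphic to the unit circle. -/
theorem exists_homeomorph_perimeter {a₁ a₂ b₁ b₂ : ℝ} (ha : a₁ < a₂) (hb : b₁ < b₂) :
    ∃ h : ℂ ≃ₜ ℂ, h '' Metric.sphere 0 1 =
      {w | (a₁ ≤ w.re ∧ w.re ≤ a₂ ∧ b₁ ≤ w.im ∧ w.im ≤ b₂) ∧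
        ((w.re = a₁ ∨ w.re = a₂) ∨ w.im = b₁ ∨ w.im = b₂)} := by
  have hconv : Convex ℝ (Icc a₁ a₂ ×ℂ Icc b₁ b₂) :=
    ((convex_Icc a₁ a₂).linear_preimage Complex.reLm).inter
      ((convex_Icc b₁ b₂).linear_preimage Complex.imLm)
  have hint : (interior (Icc a₁ a₂ ×ℂ Icc b₁ b₂)).Nonempty := by
    rw [Complex.interior_reProdIm, interior_Icc, interior_Icc]
    obtain ⟨x, hx⟩ := nonempty_Ioo.2 ha
    obtain ⟨y, hy⟩ := nonempty_Ioo.2 hb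
    exact ⟨⟨x, y⟩, hx, hy⟩
  have hbdd : Bornology.IsBounded (Icc a₁ a₂ ×ℂ Icc b₁ b₂) :=
    (Metric.isBounded_Icc _ _).reProdIm (Metric.isBounded_Icc _ _)
  obtain ⟨h, -, -, hf⟩ :=
    exists_homeomorph_image_interior_closure_frontier_eq_unitBall hconv hint hbdd
  refine ⟨h.symm, ?_⟩
  rw [← hf, ← image_comp]
  simp only [Homeomorph.symm_comp_self, image_id]
  rw [Complex.frontier_reProdIm, frontier_Icc ha.le, frontier_Icc hb.le, isClosed_Icc.closure_eq,
    isClosed_Icc.closure_eq]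
  ext w
  simp only [mem_union, Complex.mem_reProdIm, mem_Icc, mem_insert_iff, mem_singleton_iff,
    mem_ofPred_eq]
  constructor
  · rintro (⟨⟨h1, h2⟩, h3⟩ | ⟨h1, h2, h3⟩)
    · refine ⟨⟨h1, h2, ?_⟩, Or.inr h3⟩
      rcases h3 with h3 | h3 <;> constructor <;> linarith
    · refine ⟨⟨?_, ?_, h2, h3⟩, Or.inl h1⟩ <;> rcases h1 with h1 | h1 <;> linarith
  · rintro ⟨⟨h1, h2, h3, h4⟩, h5 | h5⟩
    exacts [Or.inr ⟨h5, h3, h4⟩, Or.inl ⟨⟨h1, h2⟩, h5⟩]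

theorem perimeter_mem_iff {i a b : Fin 3} (hai : a ≠ i) (hbi : b ≠ i)
    (hcov : ∀ j, j = i ∨ j = a ∨ j = b) {l u p : Space} (hpi : l i ≤ p i ∧ p i ≤ u i) :
    (p ∈ Icc l u ∧ ∃ j, j ≠ i ∧ (p j = l j ∨ p j = u j)) ↔
      ((l a ≤ p a ∧ p a ≤ u a ∧ l b ≤ p b ∧ p b ≤ u b) ∧
        ((p a = l a ∨ p a = u a) ∨ p b = l b ∨ p b = u b)) := by
  constructor
  · rintro ⟨⟨h1, h2⟩, j, hj, h⟩
    refine ⟨⟨h1 a, h2 a, h1 b, h2 b⟩, ?_⟩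
    rcases hcov j with rfl | rfl | rfl
    exacts [absurd rfl hj, Or.inl h, Or.inr h]
  · rintro ⟨⟨h1, h2, h3, h4⟩, h⟩
    refine ⟨⟨fun j => ?_, fun j => ?_⟩, ?_⟩
    · rcases hcov j with rfl | rfl | rfl
      exacts [hpi.1, h1, h3]
    · rcases hcov j with rfl | rfl | rfl
      exacts [hpi.2, h2, h4]
    · rcases h with h | h
      exacts [⟨a, hai, h⟩, ⟨b, hbi, h⟩]

/-- The perimeter of a horizontal rectangle is a simple closed curve. -/
theorem exists_circle_perimeter {i : Fin 3} {l u : Space} (hi : l i = u i)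
    (hlu : ∀ j, j ≠ i → l j < u j) :
    ∃ γ : Circle → Space, Continuous γ ∧ Function.Injective γ ∧
      range γ = {p | p ∈ Icc l u ∧ ∃ j, j ≠ i ∧ (p j = l j ∨ p j = u j)} := by
  obtain ⟨a, b, hai, hbi, hab, hcov⟩ := exists_other_directions i
  obtain ⟨h, hh⟩ := exists_homeomorph_perimeter (hlu a hai) (hlu b hbi)
  have e1 : ∀ w z, planarPoint i a w z i = z := fun w z => by simp [planarPoint]
  have e2 : ∀ w z, planarPoint i a w z a = w.re := fun w z => by simp [planarPoint, hai]
  have e3 : ∀ w z, planarPoint i a w z b = w.im := fun w z => by simp [planarPoint, hbi, hab]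
  refine ⟨fun c => planarPoint i a (h c) (l i), ?_, ?_, ?_⟩
  · exact (continuous_planarPoint i a).comp
      ((h.continuous.comp continuous_subtype_val).prodMk continuous_const)
  · intro c c' hc
    refine Circle.ext (h.injective (Complex.ext ?_ ?_))
    · simpa [e2] using congrFun hc a
    · simpa [e3] using congrFun hc b
  · ext p
    constructor
    · rintro ⟨c, rfl⟩
      refine (perimeter_mem_iff hai hbi hcov (by simp [e1, hi])).2 ?_
      have : h c ∈ h '' Metric.sphere 0 1 := mem_image_of_mem _ (by simp [Circle.norm_coe])
      rw [hh] at this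
      simp only [e2, e3]
      exact this
    · intro hp
      have hpi : p i = l i := le_antisymm (hi ▸ hp.1.2 i) (hp.1.1 i)
      have hw := (perimeter_mem_iff hai hbi hcov ⟨hp.1.1 i, hp.1.2 i⟩).1 hp
      have : (⟨p a, p b⟩ : ℂ) ∈ h '' Metric.sphere 0 1 := by rw [hh]; exact hw
      obtain ⟨c, hc, hce⟩ := this
      refine ⟨⟨c, hc⟩, ?_⟩
      funext j
      rcases hcov j with rfl | rfl | rfl
      · exact (e1 _ _).trans hpi.symm
      · exact (e2 _ _).trans (congrArg Complex.re hce)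
      · exact (e3 _ _).trans (congrArg Complex.im hce)

/-- The side wall of the box with corners `l` and `u`, without its horizontal rims. -/
def boxWall (i : Fin 3) (l u : Space) : Set Space :=
  {p | (l i < p i ∧ p i < u i) ∧ p ∈ Icc l u ∧ ∃ j, j ≠ i ∧ (p j = l j ∨ p j = u j)}

/-- The side wall of a box is path connected. -/
theorem joinedIn_wall {i : Fin 3} {l u : Space} (hlu : ∀ j, j ≠ i → l j < u j) {p q : Space}
    (hp : p ∈ boxWall i l u) (hq : q ∈ boxWall i l u) : JoinedIn (boxWall i l u) p q := by
  obtain ⟨a, b, hai, hbi, hab, hcov⟩ := exists_other_directions i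
  obtain ⟨h, hh⟩ := exists_homeomorph_perimeter (hlu a hai) (hlu b hbi)
  have e1 : ∀ w z, planarPoint i a w z i = z := fun w z => by simp [planarPoint]
  have e2 : ∀ w z, planarPoint i a w z a = w.re := fun w z => by simp [planarPoint, hai]
  have e3 : ∀ w z, planarPoint i a w z b = w.im := fun w z => by simp [planarPoint, hbi, hab]
  have hs : IsPathConnected (Metric.sphere (0 : ℂ) 1) :=
    isPathConnected_sphere (by rw [Complex.rank_real_complex]; exact Nat.one_lt_ofNat) 0 zero_le_one
  have hz : IsPathConnected (Ioo (l i) (u i)) :=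
    (convex_Ioo _ _).isPathConnected (nonempty_Ioo.2 (hp.1.1.trans hp.1.2))
  have hW : boxWall i l u =
      (fun x : ℂ × ℝ => planarPoint i a x.1 x.2) '' ((h '' Metric.sphere 0 1) ×ˢ Ioo (l i) (u i)) := by
    ext p
    constructor
    · rintro ⟨hpi, hp⟩
      refine ⟨(⟨p a, p b⟩, p i), ⟨?_, hpi⟩, ?_⟩
      · rw [hh]
        exact (perimeter_mem_iff hai hbi hcov ⟨hpi.1.le, hpi.2.le⟩).1 hp
      · funext j
        rcases hcov j with rfl | rfl | rfl
        exacts [e1 _ _, e2 _ _, e3 _ _]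
    · rintro ⟨⟨w, z⟩, ⟨hw, hz⟩, rfl⟩
      simp only at hw hz ⊢
      rw [hh] at hw
      refine ⟨by rw [e1]; exact hz, ?_⟩
      refine (perimeter_mem_iff hai hbi hcov (by rw [e1]; exact ⟨hz.1.le, hz.2.le⟩)).2 ?_
      rw [e2, e3]
      exact hw
  rw [hW] at hp hq ⊢
  exact (((hs.image h.continuous).prod hz).image (continuous_planarPoint i a)).joinedIn _ hp _ hq

/-! ### Walking around rectangles -/

theorem joinedIn_update {T : Set Space} {p : Space} {j : Fin 3} {x : ℝ}
    (h : ∀ t ∈ uIcc (p j) x, Function.update p j t ∈ T) : JoinedIn T p (Function.update p j x) := by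
  refine JoinedIn.of_segment_subset ?_
  rw [segment_eq_image_lineMap]
  rintro _ ⟨θ, hθ, rfl⟩
  have : AffineMap.lineMap p (Function.update p j x) θ =
      Function.update p j (AffineMap.lineMap (p j) x θ) := by
    funext k
    by_cases hk : k = j
    · subst hk; simp [AffineMap.lineMap_apply]
    · simp [AffineMap.lineMap_apply, hk]
  rw [this]
  refine h _ ?_
  rw [← segment_eq_uIcc, segment_eq_image_lineMap]
  exact mem_image_of_mem _ hθ

/-- A box has a neighbourhood of some size `ε` that is disjoint from finitely many other closed
sets that are disjoint from the box. -/
theorem exists_enlarged_Icc_disjoint {B : Space × Space} {O : Finset (Space × Space)}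
    (hO : ∀ C ∈ O, ∀ q, q ∈ Icc B.1 B.2 → q ∉ Icc C.1 C.2) (hne : (Icc B.1 B.2).Nonempty) :
    ∃ ε > 0, ∀ q : Space, (∀ j, B.1 j - ε ≤ q j ∧ q j ≤ B.2 j + ε) →
      ∀ C ∈ O, q ∉ Icc C.1 C.2 := by
  have hopen : IsOpen (⋃ C ∈ O, Icc C.1 C.2)ᶜ :=
    (O.finite_toSet.isClosed_biUnion fun C _ => isClosed_Icc).isOpen_compl
  have hsub : Icc B.1 B.2 ⊆ (⋃ C ∈ O, Icc C.1 C.2)ᶜ := by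
    intro q hq hq'
    obtain ⟨C, hC, hqC⟩ := mem_iUnion₂.1 hq'
    exact hO C hC q hq hqC
  obtain ⟨ε, hε, h⟩ := isCompact_Icc.exists_cthickening_subset_open hopen hsub
  refine ⟨ε, hε, fun q hq C hC hqC => ?_⟩
  have hle : B.1 ≤ B.2 := nonempty_Icc.1 hne
  have hmem : q ∈ Metric.cthickening ε (Icc B.1 B.2) := by
    refine Metric.mem_cthickening_of_dist_le q (fun j => max (B.1 j) (min (q j) (B.2 j))) ε _ ?_ ?_
    · exact ⟨fun j => le_max_left _ _, fun j => max_le (hle j) (min_le_right _ _)⟩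
    · rw [dist_pi_le_iff hε.le]
      intro j
      rw [Real.dist_eq, abs_le]
      obtain ⟨h1, h2⟩ := hq j
      have h3 := hle j
      rcases le_total (q j) (B.2 j) with h4 | h4
      · rw [min_eq_left h4]
        rcases le_total (B.1 j) (q j) with h5 | h5
        · rw [max_eq_right h5]; constructor <;> linarith
        · rw [max_eq_left h5]; constructor <;> linarith
      · rw [min_eq_right h4, max_eq_right h3]; constructor <;> linarith
  exact h hmem (mem_iUnion₂.2 ⟨C, hC, hqC⟩)

/-- In a horizontal rectangle from which finitely many pairwise disjoint closed rectangles (the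
traces of the boxes in `O`) are removed, each point can be joined to the perimeter: walk in the
direction `a`, and around each obstacle that is in the way. -/
theorem exists_joinedIn_perimeter {i : Fin 3} {l u : Space} {z : ℝ} {O : Finset (Space × Space)}
    (hO : ∀ B ∈ O, ∀ j, B.1 j < B.2 j) (hz : ∀ B ∈ O, B.1 i ≤ z ∧ z ≤ B.2 i)
    (hdisj : ∀ B ∈ O, ∀ C ∈ O, B ≠ C → ∀ q, q ∈ Icc B.1 B.2 → q ∉ Icc C.1 C.2)
    {p : Space} (hp : p ∈ Icc l u) (hpz : p i = z) (hpO : ∀ B ∈ O, p ∉ Icc B.1 B.2) :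
    ∃ q, (∃ j, j ≠ i ∧ (q j = l j ∨ q j = u j)) ∧
      JoinedIn {x | x ∈ Icc l u ∧ x i = z ∧ ∀ B ∈ O, x ∉ Icc B.1 B.2} p q := by
  classical
  obtain ⟨a, b, hai, hbi, hab, hcov⟩ := exists_other_directions i
  set T : Set Space := {x | x ∈ Icc l u ∧ x i = z ∧ ∀ B ∈ O, x ∉ Icc B.1 B.2} with hT
  have hlu : ∀ p ∈ T, ∀ j t, j ≠ i → l j ≤ t → t ≤ u j →
      Function.update p j t ∈ Icc l u ∧ Function.update p j t i = z := by
    intro p hp j t hj h1 h2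
    refine ⟨⟨fun k => ?_, fun k => ?_⟩, by rw [Function.update_of_ne hj.symm]; exact hp.2.1⟩ <;>
    · by_cases hk : k = j
      · subst hk; simpa
      · rw [Function.update_of_ne hk]
        first | exact hp.1.1 k | exact hp.1.2 k
  induction hn : (O.filter fun B => p a < B.1 a).card using Nat.strong_induction_on generalizing p with
  | _ n ih =>
  have hpT : p ∈ T := ⟨hp, hpz, hpO⟩
  -- the obstacles to the walk from `p` in the direction `a`
  by_cases hH : (O.filter fun B => p a < B.1 a ∧ B.1 a ≤ u a ∧ B.1 b ≤ p b ∧ p b ≤ B.2 b).Nonempty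
  swap
  · refine ⟨Function.update p a (u a), ⟨a, hai, Or.inr (by simp)⟩, joinedIn_update fun t ht => ?_⟩
    rw [uIcc_of_le (hp.2 a)] at ht
    obtain ⟨h1, h2⟩ := hlu p hpT a t hai ((hp.1 a).trans ht.1) ht.2
    refine ⟨h1, h2, fun B hB hBt => hH ⟨B, Finset.mem_filter.2 ⟨hB, ?_⟩⟩⟩
    have hBa := hBt.1 a
    have hBa' := hBt.2 a
    have hBb := hBt.1 b
    have hBb' := hBt.2 b
    rw [Function.update_self] at hBa hBa'
    rw [Function.update_of_ne hab] at hBb hBb'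
    refine ⟨?_, hBa.trans ht.2, hBb, hBb'⟩
    by_contra hcon
    push Not at hcon
    refine hpO B hB ⟨fun j => ?_, fun j => ?_⟩ <;> rcases hcov j with rfl | rfl | rfl
    exacts [hpz ▸ (hz B hB).1, hcon, hBb, hpz ▸ (hz B hB).2, ht.1.trans hBa', hBb']
  obtain ⟨B, hBH, hBmin⟩ := Finset.exists_min_image _ (fun B : Space × Space => B.1 a) hH
  obtain ⟨hB, hB1, hB2, hB3, hB4⟩ := Finset.mem_filter.1 hBH
  obtain ⟨ε, hε, hfree⟩ := exists_enlarged_Icc_disjoint (B := B) (O := O.erase B)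
    (fun C hC q hq => hdisj B hB C (Finset.mem_of_mem_erase hC) (Finset.ne_of_mem_erase hC).symm q hq)
    (nonempty_Icc.2 fun j => (hO B hB j).le)
  have hBa := hO B hB a
  have hBb := hO B hB b
  have hBz := hz B hB
  -- first walk to the obstacle `B`
  set x₁ := max (p a) (B.1 a - ε) with hx₁
  have hx1 : x₁ < B.1 a := max_lt hB1 (by linarith)
  have hpx : p a ≤ x₁ := le_max_left _ _
  have hex : B.1 a - ε ≤ x₁ := le_max_right _ _
  set p₁ := Function.update p a x₁ with hp₁
  have hJ1 : JoinedIn T p p₁ := by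
    refine joinedIn_update fun t ht => ?_
    rw [uIcc_of_le hpx] at ht
    obtain ⟨h1, h2⟩ := hlu p hpT a t hai ((hp.1 a).trans ht.1) (by linarith [ht.2])
    refine ⟨h1, h2, fun C hC hCt => ?_⟩
    have hCa := hCt.1 a
    have hCa' := hCt.2 a
    have hCb := hCt.1 b
    have hCb' := hCt.2 b
    rw [Function.update_self] at hCa hCa'
    rw [Function.update_of_ne hab] at hCb hCb'
    by_cases hcon : p a < C.1 a
    · have := hBmin C (Finset.mem_filter.2 ⟨hC, hcon, by linarith [ht.2], hCb, hCb'⟩)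
      linarith [ht.2]
    · push Not at hcon
      refine hpO C hC ⟨fun j => ?_, fun j => ?_⟩ <;> rcases hcov j with rfl | rfl | rfl
      exacts [hpz ▸ (hz C hC).1, hcon, hCb, hpz ▸ (hz C hC).2, ht.1.trans hCa', hCb']
  have hp1T : p₁ ∈ T := hJ1.target_mem
  have hp1a : p₁ a = x₁ := by simp [hp₁]
  have hp1b : p₁ b = p b := by simp [hp₁, hab]
  -- points close to `B` but outside of it are free
  have hnear : ∀ q : Space, q ∈ Icc l u → q i = z → (B.1 a - ε ≤ q a ∧ q a ≤ B.2 a + ε) →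
      (B.1 b - ε ≤ q b ∧ q b ≤ B.2 b + ε) → (q a < B.1 a ∨ q b < B.1 b) → q ∈ T := by
    intro q hq hqz hqa hqb hout
    refine ⟨hq, hqz, fun C hC hqC => ?_⟩
    by_cases hCB : C = B
    · subst hCB
      rcases hout with h | h
      exacts [absurd (hqC.1 a) (not_le.2 h), absurd (hqC.1 b) (not_le.2 h)]
    · refine hfree q (fun j => ?_) C (Finset.mem_erase.2 ⟨hCB, hC⟩) hqC
      rcases hcov j with rfl | rfl | rfl
      · rw [hqz]; constructor <;> linarith
      · exact hqa
      · exact hqb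
  -- then walk along its side
  set y₁ := max (l b) (B.1 b - ε) with hy₁
  have hy1 : y₁ ≤ p b := max_le (hp.1 b) (by linarith)
  have hey : B.1 b - ε ≤ y₁ := le_max_right _ _
  have hly : l b ≤ y₁ := le_max_left _ _
  set p₂ := Function.update p₁ b y₁ with hp₂
  have hJ2 : JoinedIn T p₁ p₂ := by
    refine joinedIn_update fun t ht => ?_
    rw [hp1b, uIcc_of_ge hy1] at ht
    obtain ⟨h1, h2⟩ := hlu p₁ hp1T b t hbi (hly.trans ht.1) (ht.2.trans (hp.2 b))
    refine hnear _ h1 h2 ?_ ?_ ?_ <;> simp only [Function.update_self,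
      Function.update_of_ne hab.symm, hp1a]
    · constructor <;> linarith
    · constructor <;> linarith [ht.1, ht.2]
    · exact Or.inl hx1
  have hp2T : p₂ ∈ T := hJ2.target_mem
  have hp2a : p₂ a = x₁ := by simp [hp₂, hab.symm, hp1a]
  have hp2b : p₂ b = y₁ := by simp [hp₂]
  rcases le_or_gt (B.1 b - ε) (l b) with hcase | hcase
  · exact ⟨p₂, ⟨b, hbi, Or.inl (by rw [hp2b, hy₁, max_eq_left hcase])⟩, hJ1.trans hJ2⟩
  have hy1' : y₁ = B.1 b - ε := max_eq_right hcase.le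
  -- and pass it
  set p₃ := Function.update p₂ a (B.1 a) with hp₃
  have hJ3 : JoinedIn T p₂ p₃ := by
    refine joinedIn_update fun t ht => ?_
    rw [hp2a, uIcc_of_le hx1.le] at ht
    obtain ⟨h1, h2⟩ := hlu p₂ hp2T a t hai (by linarith [hp.1 a, ht.1]) (ht.2.trans hB2)
    refine hnear _ h1 h2 ?_ ?_ ?_ <;> simp only [Function.update_self,
      Function.update_of_ne hab, hp2b]
    · constructor <;> linarith [ht.1, ht.2]
    · constructor <;> linarith
    · right; linarith
  obtain ⟨h31, h32, h33⟩ := hJ3.target_mem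
  have hp3a : p₃ a = B.1 a := by simp [hp₃]
  obtain ⟨q, hq, hJ⟩ := ih _ (by
    rw [← hn]
    refine Finset.card_lt_card ⟨fun C hC => ?_, fun hsub => ?_⟩
    · obtain ⟨h1, h2⟩ := Finset.mem_filter.1 hC
      exact Finset.mem_filter.2 ⟨h1, by linarith⟩
    · have := (Finset.mem_filter.1 (hsub (Finset.mem_filter.2 ⟨hB, hB1⟩))).2
      exact absurd this (by rw [hp3a]; exact lt_irrefl _)) h31 h32 h33 rfl
  exact ⟨q, hq, ((hJ1.trans hJ2).trans hJ3).trans hJ⟩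

/-! ### The genus -/

namespace IsBrickwork

variable {i : Fin 3} {P : Set Space} {F : Finset (Space × Space)} (hF : IsBrickwork i P F)

include hF

theorem ne_of_stacked {A B : Space × Space} (hA : A ∈ F) (hi : A.2 i = B.1 i) : A ≠ B := by
  rintro rfl
  exact (hF.lt A hA i).ne hi.symm

/-- The perimeter of a contact rectangle is a simple closed curve on the surface. -/
theorem exists_circle_contact {A B : Space × Space} (hA : A ∈ F) (hB : B ∈ F)
    (hi : A.2 i = B.1 i) (ht : ∃ p, p ∈ Icc A.1 A.2 ∧ p ∈ Icc B.1 B.2) :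
    ∃ γ : Circle → Space, Continuous γ ∧ Function.Injective γ ∧
      range γ = (Icc A.1 A.2 ∩ Icc B.1 B.2) ∩ frontier P := by
  obtain ⟨p, hpA, hpB⟩ := ht
  have hA' := hF.lt A hA
  have hB' := hF.lt B hB
  have hov := (hF.contact A hA B hB (hF.ne_of_stacked hA hi) p hpA hpB).2
  obtain ⟨γ, h1, h2, h3⟩ := exists_circle_perimeter (i := i) (l := A.1 ⊔ B.1) (u := A.2 ⊓ B.2)
    (by
      have a := hA' i
      have b := hB' i
      simp only [Pi.sup_apply, Pi.inf_apply]
      rw [max_eq_right (by linarith), min_eq_left (by linarith), hi])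
    (fun j hj => max_lt (lt_min (hA' j) (hov j hj).1) (lt_min (hov j hj).2 (hB' j)))
  refine ⟨γ, h1, h2, ?_⟩
  rw [h3, Icc_inter_Icc]
  ext q
  simp only [mem_ofPred_eq, mem_inter_iff]
  refine and_congr_right fun hq => ?_
  rw [← Icc_inter_Icc] at hq
  rw [hF.mem_frontier_iff_of_contact hA hB hi hq.1 hq.2]
  refine exists_congr fun j => and_congr_right fun _ => ?_
  have a1 := hq.1.1 j
  have a2 := hq.1.2 j
  have b1 := hq.2.1 j
  have b2 := hq.2.2 j
  simp only [Pi.sup_apply, Pi.inf_apply]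
  constructor
  · rintro (h | h)
    · rcases max_choice (A.1 j) (B.1 j) with e | e
      exacts [Or.inl (Or.inl (h.trans e)), Or.inr (Or.inl (h.trans e))]
    · rcases min_choice (A.2 j) (B.2 j) with e | e
      exacts [Or.inl (Or.inr (h.trans e)), Or.inr (Or.inr (h.trans e))]
  · rintro ((h | h) | h | h)
    · exact Or.inl (by rw [max_eq_left (h ▸ b1), h])
    · exact Or.inr (by rw [min_eq_left (h ▸ b2), h])
    · exact Or.inl (by rw [max_eq_right (h ▸ a1), h])
    · exact Or.inr (by rw [min_eq_right (h ▸ a2), h])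

section Surface

/- In this section, `T` is a part of the surface that contains all its points in a single brick, like
the complement of some perimeters of contact rectangles. -/
variable {T : Set Space} (hT1 : ∀ A ∈ F, ∀ p ∈ Icc A.1 A.2, (∀ B ∈ F, p ∈ Icc B.1 B.2 → B = A) →
    (∃ j, p j = A.1 j ∨ p j = A.2 j) → p ∈ T) (hT2 : T ⊆ frontier P)

include hT1

/-- The side wall of a brick is disjoint from the other bricks. -/
theorem wall_subset {A : Space × Space} (hA : A ∈ F) : boxWall i A.1 A.2 ⊆ T := by
  rintro p ⟨hpi, hp, j, -, hj⟩
  refine hT1 A hA p hp (fun B hB hpB => ?_) ⟨j, hj⟩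
  by_contra hBA
  have b1 := hpB.1 i
  have b2 := hpB.2 i
  rcases (hF.contact A hA B hB (Ne.symm hBA) p hp hpB).1 with e | e <;> linarith [hpi.1, hpi.2]

/-- A point of a vertical face of a brick can be moved vertically to the middle of its wall. -/
theorem exists_joinedIn_wall_of_side {A : Space × Space} (hA : A ∈ F) {p : Space} (hpT : p ∈ T)
    (hp : p ∈ Icc A.1 A.2) (hside : ∃ j, j ≠ i ∧ (p j = A.1 j ∨ p j = A.2 j)) :
    ∃ w ∈ boxWall i A.1 A.2, JoinedIn T p w := by
  obtain ⟨j, hj, hpj⟩ := hside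
  have hlt := hF.lt A hA i
  have hmem : ∀ t, A.1 i < t → t < A.2 i →
      Function.update p i t ∈ boxWall i A.1 A.2 := by
    intro t h1 h2
    refine ⟨by simp [h1, h2], ⟨fun k => ?_, fun k => ?_⟩, j, hj, ?_⟩
    · by_cases hk : k = i
      · subst hk; simp [h1.le]
      · rw [Function.update_of_ne hk]; exact hp.1 k
    · by_cases hk : k = i
      · subst hk; simp [h2.le]
      · rw [Function.update_of_ne hk]; exact hp.2 k
    · rw [Function.update_of_ne hj]; exact hpj
  refine ⟨Function.update p i ((A.1 i + A.2 i) / 2), hmem _ (by linarith) (by linarith),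
    joinedIn_update fun t ht => ?_⟩
  by_cases htp : t = p i
  · rw [htp, Function.update_eq_self]; exact hpT
  · refine hF.wall_subset hT1 hA (hmem t ?_ ?_)
    · rcases le_total (p i) ((A.1 i + A.2 i) / 2) with h | h
      · rw [uIcc_of_le h] at ht
        exact (hp.1 i).trans_lt (lt_of_le_of_ne ht.1 (Ne.symm htp))
      · rw [uIcc_of_ge h] at ht
        linarith [ht.1]
    · rcases le_total (p i) ((A.1 i + A.2 i) / 2) with h | h
      · rw [uIcc_of_le h] at ht
        linarith [ht.2]
      · rw [uIcc_of_ge h] at ht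
        exact (lt_of_le_of_ne ht.2 htp).trans_le (hp.2 i)

/-- A point of a horizontal face of a brick that is in no other brick can be joined to the wall,
around the contact rectangles. -/
theorem exists_joinedIn_wall_of_unique {A : Space × Space} (hA : A ∈ F) {p : Space}
    (hp : p ∈ Icc A.1 A.2) (huniq : ∀ B ∈ F, p ∈ Icc B.1 B.2 → B = A)
    (hpi : p i = A.1 i ∨ p i = A.2 i) :
    ∃ w ∈ boxWall i A.1 A.2, JoinedIn T p w := by
  classical
  have hAlt := hF.lt A hA i
  set O := F.filter fun B => B ≠ A ∧ ∃ q, q ∈ Icc A.1 A.2 ∧ q ∈ Icc B.1 B.2 ∧ q i = p i with hO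
  have hsub : {x | x ∈ Icc A.1 A.2 ∧ x i = p i ∧ ∀ B ∈ O, x ∉ Icc B.1 B.2} ⊆ T := by
    rintro x ⟨hx, hxi, hxO⟩
    refine hT1 A hA x hx (fun B hB hxB => ?_) ⟨i, by rw [hxi]; exact hpi⟩
    by_contra hBA
    exact hxO B (Finset.mem_filter.2 ⟨hB, hBA, x, hx, hxB, hxi⟩) hxB
  obtain ⟨q, hq, hJ⟩ := exists_joinedIn_perimeter (i := i) (l := A.1) (u := A.2) (z := p i) (O := O)
    (fun B hB => hF.lt B (Finset.mem_filter.1 hB).1)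
    (fun B hB => by
      obtain ⟨-, -, q, -, hq, e⟩ := Finset.mem_filter.1 hB
      exact e ▸ ⟨hq.1 i, hq.2 i⟩)
    (fun B hB C hC hBC q hqB hqC => by
      -- the obstacles are on the same side of the face
      obtain ⟨hB, hBA, x, hxA, hxB, hx⟩ := Finset.mem_filter.1 hB
      obtain ⟨hC, hCA, y, hyA, hyC, hy⟩ := Finset.mem_filter.1 hC
      have b := hF.lt B hB i
      have c := hF.lt C hC i
      have x1 := hxB.1 i
      have x2 := hxB.2 i
      have y1 := hyC.1 i
      have y2 := hyC.2 i
      rcases (hF.contact A hA B hB hBA.symm x hxA hxB).1 with e1 | e1 <;>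
      rcases (hF.contact A hA C hC hCA.symm y hyA hyC).1 with e2 | e2 <;>
      rcases (hF.contact B hB C hC hBC q hqB hqC).1 with e3 | e3 <;>
      rcases hpi with e4 | e4 <;> linarith)
    hp rfl
    (fun B hB hpB => (Finset.mem_filter.1 hB).2.1 (huniq B (Finset.mem_filter.1 hB).1 hpB))
  obtain ⟨w, hw, hJ'⟩ := hF.exists_joinedIn_wall_of_side hT1 hA (hJ.mono hsub).target_mem
    hJ.target_mem.1 hq
  exact ⟨w, hw, (hJ.mono hsub).trans hJ'⟩

include hT2 in
theorem exists_joinedIn_wall {A : Space × Space} (hA : A ∈ F) {p : Space} (hpT : p ∈ T)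
    (hp : p ∈ Icc A.1 A.2) :
    ∃ w ∈ boxWall i A.1 A.2, JoinedIn T p w := by
  by_cases hside : ∃ j, j ≠ i ∧ (p j = A.1 j ∨ p j = A.2 j)
  · exact hF.exists_joinedIn_wall_of_side hT1 hA hpT hp hside
  by_cases huniq : ∀ B ∈ F, p ∈ Icc B.1 B.2 → B = A
  · refine hF.exists_joinedIn_wall_of_unique hT1 hA hp huniq ?_
    obtain ⟨j, hj⟩ := (hF.mem_frontier_iff_of_unique hA hp huniq).1 (hT2 hpT)
    by_cases hji : j = i
    · exact hji ▸ hj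
    · exact absurd ⟨j, hji, hj⟩ hside
  -- on the perimeter of a contact rectangle, step out of it first
  push Not at huniq hside
  obtain ⟨B, hB, hpB, hBA⟩ := huniq
  have hcon := (hF.contact A hA B hB hBA.symm p hp hpB).1
  have hpi : p i = A.1 i ∨ p i = A.2 i := by
    have a1 := hp.1 i
    have a2 := hp.2 i
    have b1 := hpB.1 i
    have b2 := hpB.2 i
    rcases hcon with e | e
    · right; linarith
    · left; linarith
  obtain ⟨j, hj, hjB⟩ : ∃ j, j ≠ i ∧ (p j = B.1 j ∨ p j = B.2 j) := by
    rcases hcon with e | e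
    · obtain ⟨j, hj, h | h⟩ := (hF.mem_frontier_iff_of_contact hA hB e hp hpB).1 (hT2 hpT)
      · exact absurd h (not_or.2 (hside j hj))
      · exact ⟨j, hj, h⟩
    · obtain ⟨j, hj, h | h⟩ := (hF.mem_frontier_iff_of_contact hB hA e hpB hp).1 (hT2 hpT)
      · exact ⟨j, hj, h⟩
      · exact absurd h (not_or.2 (hside j hj))
  obtain ⟨s, hs⟩ : ∃ s : ℝ, ∀ t, 0 < t → ¬ (B.1 j ≤ p j + t * s ∧ p j + t * s ≤ B.2 j) := by
    rcases hjB with e | e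
    · exact ⟨-1, fun t ht h => by linarith [h.1]⟩
    · exact ⟨1, fun t ht h => by linarith [h.2]⟩
  have hc : Tendsto (fun t : ℝ => Function.update p j (p j + t * s)) (𝓝[>] 0) (𝓝 p) := by
    have : Continuous (fun t : ℝ => Function.update p j (p j + t * s)) :=
      continuous_const.update j (by fun_prop)
    have h2 := (this.tendsto 0).mono_left (nhdsWithin_le_nhds (s := Ioi 0))
    simpa using h2
  have hev : ∀ᶠ q in 𝓝 p, (A.1 j < q j ∧ q j < A.2 j) ∧
      ∀ C ∈ F, C ≠ A → C ≠ B → q ∉ Icc C.1 C.2 := by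
    refine ((((continuous_apply (A := fun _ : Fin 3 => ℝ) j).tendsto p).eventually_const_lt
      (lt_of_le_of_ne (hp.1 j) (hside j hj).1.symm)).and
      (((continuous_apply (A := fun _ : Fin 3 => ℝ) j).tendsto p).eventually_lt_const
      (lt_of_le_of_ne (hp.2 j) (hside j hj).2))).and ?_
    refine (Filter.eventually_all_finset F).2 fun C hC => ?_
    by_cases hpC : p ∈ Icc C.1 C.2
    · rcases hF.eq_or_eq_of_mem hA hB hC hBA.symm hp hpB hpC with rfl | rfl
      exacts [Eventually.of_forall fun q h => absurd rfl h,
        Eventually.of_forall fun q _ h => absurd rfl h]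
    · filter_upwards [eventually_notMem_Icc hpC] with q hq _ _ using hq
  obtain ⟨ε, hε, hεs⟩ := mem_nhdsGT_iff_exists_Ioo_subset.1 (hc.eventually hev)
  replace hε : 0 < ε := hε
  have hgood : ∀ t, 0 < t → t < ε → Function.update p j (p j + t * s) ∈ Icc A.1 A.2 ∧
      (∀ C ∈ F, Function.update p j (p j + t * s) ∈ Icc C.1 C.2 → C = A) ∧
      (Function.update p j (p j + t * s) i = A.1 i ∨
        Function.update p j (p j + t * s) i = A.2 i) := by
    intro t ht0 htε
    obtain ⟨⟨h1, h2⟩, h3⟩ := hεs ⟨ht0, htε⟩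
    refine ⟨⟨fun k => ?_, fun k => ?_⟩, fun C hC hqC => ?_, ?_⟩
    · by_cases hk : k = j
      · subst hk; exact h1.le
      · rw [Function.update_of_ne hk]; exact hp.1 k
    · by_cases hk : k = j
      · subst hk; exact h2.le
      · rw [Function.update_of_ne hk]; exact hp.2 k
    · by_contra hCA
      by_cases hCB : C = B
      · subst hCB
        have c1 := hqC.1 j
        have c2 := hqC.2 j
        rw [Function.update_self] at c1 c2
        exact hs t ht0 ⟨c1, c2⟩
      · exact h3 C hC hCA hCB hqC
    · rw [Function.update_of_ne hj.symm]; exact hpi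
  obtain ⟨g1, g2, g3⟩ := hgood (ε / 2) (by linarith) (by linarith)
  obtain ⟨w, hw, hJ⟩ := hF.exists_joinedIn_wall_of_unique hT1 hA g1 g2 g3
  refine ⟨w, hw, JoinedIn.trans (joinedIn_update fun x hx => ?_) hJ⟩
  rw [← segment_eq_uIcc, segment_eq_image'] at hx
  obtain ⟨θ, hθ, rfl⟩ := hx
  rcases hθ.1.eq_or_lt with e | e
  · rw [← e]; simpa using hpT
  · have hval : p j + θ • (p j + ε / 2 * s - p j) = p j + (θ * (ε / 2)) * s := by
      simp only [smul_eq_mul]; ring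
    simp only [hval]
    obtain ⟨g1, g2, g3⟩ := hgood (θ * (ε / 2)) (by positivity) (by nlinarith [hθ.2])
    exact hT1 A hA _ g1 g2 ⟨i, g3⟩

end Surface

/-- If the contacts in `E` can be cut without disconnecting the bricks from each other, then the
perimeters of their contact rectangles together do not separate the surface. -/
theorem hasNonseparatingCurves {E : Finset ((Space × Space) × (Space × Space))}
    (hE : ∀ x ∈ E, x.1 ∈ F ∧ x.2 ∈ F ∧ x.1.2 i = x.2.1 i ∧
      ∃ p, p ∈ Icc x.1.1 x.1.2 ∧ p ∈ Icc x.2.1 x.2.2)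
    (htree : ∀ Q : Space × Space → Prop, (∃ r ∈ F, Q r) →
      (∀ A ∈ F, ∀ B ∈ F, A ≠ B → (∃ p, p ∈ Icc A.1 A.2 ∧ p ∈ Icc B.1 B.2) →
        (A, B) ∉ E → (B, A) ∉ E → Q B → Q A) → ∀ A ∈ F, Q A) :
    HasNonseparatingCurves (frontier P) E.card := by
  classical
  have hγ : ∀ x : E, ∃ γ : Circle → Space, Continuous γ ∧ Function.Injective γ ∧
      range γ = (Icc x.1.1.1 x.1.1.2 ∩ Icc x.1.2.1 x.1.2.2) ∩ frontier P := fun x => by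
    obtain ⟨h1, h2, h3, h4⟩ := hE x.1 x.2
    exact hF.exists_circle_contact h1 h2 h3 h4
  choose γ hγ1 hγ2 hγ3 using hγ
  have hEne : ∀ x ∈ E, x.1 ≠ x.2 := fun x hx =>
    hF.ne_of_stacked (hE x hx).1 (hE x hx).2.2.1
  set T := frontier P \ ⋃ k, range (γ (E.equivFin.symm k)) with hT
  have hTmem : ∀ p, p ∈ T ↔ p ∈ frontier P ∧
      ∀ x ∈ E, ¬ (p ∈ Icc x.1.1 x.1.2 ∧ p ∈ Icc x.2.1 x.2.2) := by
    intro p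
    rw [hT, Set.mem_sdiff]
    refine and_congr_right fun hp => ?_
    simp only [mem_iUnion, not_exists, hγ3, mem_inter_iff, hp, and_true]
    constructor
    · intro h x hx
      simpa using h (E.equivFin ⟨x, hx⟩)
    · intro h k
      exact h _ (E.equivFin.symm k).2
  have hT2 : T ⊆ frontier P := sdiff_subset
  have hT1 : ∀ A ∈ F, ∀ p ∈ Icc A.1 A.2, (∀ B ∈ F, p ∈ Icc B.1 B.2 → B = A) →
      (∃ j, p j = A.1 j ∨ p j = A.2 j) → p ∈ T := by
    intro A hA p hp huniq hj
    refine (hTmem p).2 ⟨(hF.mem_frontier_iff_of_unique hA hp huniq).2 hj, fun x hx h => ?_⟩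
    obtain ⟨h1, h2, -⟩ := hE x hx
    exact hEne x hx ((huniq _ h1 h.1).trans (huniq _ h2 h.2).symm)
  have hwallne : ∀ A ∈ F, ∃ w, w ∈ boxWall i A.1 A.2 := by
    intro A hA
    obtain ⟨a, -, hai, -⟩ := exists_other_directions i
    have hlt := hF.lt A hA
    refine ⟨Function.update A.1 i ((A.1 i + A.2 i) / 2), ?_, ⟨fun k => ?_, fun k => ?_⟩, a, hai, ?_⟩
    · have := hlt i
      simp only [Function.update_self]; constructor <;> linarith
    · by_cases hk : k = i
      · subst hk; have := hlt k; simp only [Function.update_self]; linarith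
      · rw [Function.update_of_ne hk]
    · by_cases hk : k = i
      · subst hk; have := hlt k; simp only [Function.update_self]; linarith
      · rw [Function.update_of_ne hk]; exact (hlt k).le
    · left; rw [Function.update_of_ne hai]
  have hwallJ : ∀ A ∈ F, ∀ p q, p ∈ boxWall i A.1 A.2 → q ∈ boxWall i A.1 A.2 → JoinedIn T p q :=
    fun A hA p q hp hq =>
      (joinedIn_wall (fun j _ => hF.lt A hA j) hp hq).mono (hF.wall_subset hT1 hA)
  have hjoin : ∀ x ∈ T, ∀ y ∈ T, JoinedIn T x y := by
    intro x hx y hy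
    have hmemP : ∀ q ∈ T, q ∈ P := fun q hq => (hF.mem_frontier_iff.1 (hT2 hq)).1
    obtain ⟨A, hA, hxA⟩ := (hF.mem_iff x).1 (hmemP x hx)
    obtain ⟨w, hw, hJx⟩ := hF.exists_joinedIn_wall hT1 hT2 hA hx hxA
    have hall := htree (fun B => ∀ q ∈ boxWall i B.1 B.2, JoinedIn T x q)
      ⟨A, hA, fun q hq => hJx.trans (hwallJ A hA w q hw hq)⟩ ?_
    · obtain ⟨B, hB, hyB⟩ := (hF.mem_iff y).1 (hmemP y hy)
      obtain ⟨w', hw', hJy⟩ := hF.exists_joinedIn_wall hT1 hT2 hB hy hyB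
      exact (hall B hB w' hw').trans hJy.symm
    · -- pass from one wall to the other through the perimeter of a contact rectangle
      intro B hB C hC hBC ht hn1 hn2 hQ q hq
      obtain ⟨r, hrT, hrB, hrC⟩ : ∃ r ∈ T, r ∈ Icc B.1 B.2 ∧ r ∈ Icc C.1 C.2 := by
        have key : ∃ r ∈ frontier P, r ∈ Icc B.1 B.2 ∧ r ∈ Icc C.1 C.2 := by
          obtain ⟨p, hpB, hpC⟩ := ht
          rcases (hF.contact B hB C hC hBC p hpB hpC).1 with e | e
          · obtain ⟨γ', -, -, h3⟩ := hF.exists_circle_contact hB hC e ⟨p, hpB, hpC⟩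
            have : γ' 1 ∈ range γ' := mem_range_self 1
            rw [h3] at this
            exact ⟨_, this.2, this.1⟩
          · obtain ⟨γ', -, -, h3⟩ := hF.exists_circle_contact hC hB e ⟨p, hpC, hpB⟩
            have : γ' 1 ∈ range γ' := mem_range_self 1
            rw [h3] at this
            exact ⟨_, this.2, this.1.symm⟩
        obtain ⟨r, hr, hrB, hrC⟩ := key
        refine ⟨r, (hTmem r).2 ⟨hr, fun z hz h => ?_⟩, hrB, hrC⟩
        obtain ⟨h1, h2, -⟩ := hE z hz
        have hzne := hEne z hz
        rcases hF.eq_or_eq_of_mem hB hC h1 hBC hrB hrC h.1 with e1 | e1 <;>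
        rcases hF.eq_or_eq_of_mem hB hC h2 hBC hrB hrC h.2 with e2 | e2
        · exact hzne (e1.trans e2.symm)
        · exact hn1 (by rw [← e1, ← e2]; exact hz)
        · exact hn2 (by rw [← e1, ← e2]; exact hz)
        · exact hzne (e1.trans e2.symm)
      obtain ⟨w1, hw1, hJ1⟩ := hF.exists_joinedIn_wall hT1 hT2 hB hrT hrB
      obtain ⟨w2, hw2, hJ2⟩ := hF.exists_joinedIn_wall hT1 hT2 hC hrT hrC
      exact (((hQ w2 hw2).trans hJ2.symm).trans hJ1).trans (hwallJ B hB w1 q hw1 hq)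
  refine ⟨fun k => γ (E.equivFin.symm k), fun k => hγ1 _, fun k => hγ2 _, fun k => ?_, ?_, ?_⟩
  · rw [hγ3]; exact inter_subset_right
  · intro k l hkl
    refine disjoint_left.2 fun p hp hp' => hkl ?_
    rw [hγ3] at hp hp'
    obtain ⟨x, hx⟩ : ∃ x, x = E.equivFin.symm k := ⟨_, rfl⟩
    obtain ⟨y, hy⟩ : ∃ y, y = E.equivFin.symm l := ⟨_, rfl⟩
    rw [← hx] at hp
    rw [← hy] at hp'
    obtain ⟨x1, x2, x3, -⟩ := hE x.1 x.2
    obtain ⟨y1, y2, y3, -⟩ := hE y.1 y.2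
    have hxy : x = y := by
      have hl1 := hF.lt _ x1 i
      have hl2 := hF.lt _ x2 i
      have hyne := hEne y.1 y.2
      rcases hF.eq_or_eq_of_mem x1 x2 y1 (hEne x.1 x.2) hp.1.1 hp.1.2 hp'.1.1 with e1 | e1 <;>
      rcases hF.eq_or_eq_of_mem x1 x2 y2 (hEne x.1 x.2) hp.1.1 hp.1.2 hp'.1.2 with e2 | e2
      · exact absurd (e1.trans e2.symm) hyne
      · exact Subtype.ext (Prod.ext e1.symm e2.symm)
      · rw [e1, e2] at y3
        linarith
      · exact absurd (e1.trans e2.symm) hyne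
    rw [hx, hy] at hxy
    exact E.equivFin.symm.injective hxy
  · intro x hx y hy _
    have hJ := hjoin x hx y hy
    exact (isPathConnected_pathComponentIn hx).isConnected.isPreconnected.subset_connectedComponentIn
      (JoinedIn.refl hx) pathComponentIn_subset hJ

end IsBrickwork

/-! ### Independent sets and edge covers in a spanning tree -/

/-- A connected graph has a spanning tree, given here by a parent function with root `r`, and a set
`I` of vertices that is independent in the tree and such that the edges from the members of `I` to
their parents cover all vertices. (The root is assigned an arbitrary neighbour as its parent, which
does not count as an edge of the tree.) -/
theorem SimpleGraph.Connected.exists_parent {V : Type*} [Fintype V] [Nontrivial V]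
    {G : SimpleGraph V} (hG : G.Connected) :
    ∃ (r : V) (par : V → V) (I : Finset V), (∀ v, G.Adj v (par v)) ∧
      (∀ p : V → Prop, p r → (∀ v, v ≠ r → p (par v) → p v) → ∀ v, p v) ∧
      (∀ v, v ≠ r → v ∈ I → par v ∉ I) ∧ (∀ u, u ∉ I → ∃ c ∈ I, par c = u) := by
  classical
  obtain ⟨r⟩ := hG.nonempty
  have hpar : ∀ v, ∃ w, G.Adj v w ∧ (v ≠ r → G.dist r v = G.dist r w + 1) := by
    intro v
    by_cases hv : v = r
    · obtain ⟨w, hw⟩ := hG.preconnected.exists_adj_of_nontrivial v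
      exact ⟨w, hw, fun h => absurd hv h⟩
    · obtain ⟨p, hp⟩ := (hG.preconnected v r).exists_walk_length_eq_dist
      cases p with
      | nil => exact absurd rfl hv
      | @cons _ w _ h q =>
        refine ⟨w, h, fun _ => ?_⟩
        have h1 : G.dist w r ≤ q.length := SimpleGraph.dist_le q
        have h2 : G.dist v r ≤ G.dist v w + G.dist w r := hG.dist_triangle
        have h3 : G.dist v w = 1 := SimpleGraph.dist_eq_one_iff_adj.2 h
        rw [SimpleGraph.Walk.length_cons] at hp
        rw [SimpleGraph.dist_comm (u := r), SimpleGraph.dist_comm (u := r) (v := w)]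
        omega
  choose par hadj hdist using hpar
  have hwf : WellFounded fun c v : V => c ≠ r ∧ par c = v := by
    refine Subrelation.wf (r := fun c v : V => G.dist r v < G.dist r c) ?_ ?_
    · rintro c v ⟨hc, rfl⟩
      have := hdist c hc
      omega
    · have : IsTrans V fun c v : V => G.dist r v < G.dist r c := ⟨fun _ _ _ h h' => h'.trans h⟩
      have : Std.Irrefl fun c v : V => G.dist r v < G.dist r c := ⟨fun _ h => lt_irrefl _ h⟩
      exact Finite.wellFounded_of_trans_of_irrefl _
  -- a vertex is in `J` if and only if none of its children is
  let J : V → Prop := hwf.fix (C := fun _ => Prop) fun v ih => ∀ c (h : c ≠ r ∧ par c = v), ¬ ih c h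
  have hJ : ∀ v, J v ↔ ∀ c, c ≠ r ∧ par c = v → ¬ J c := fun v => by
    show hwf.fix (C := fun _ => Prop) _ v ↔ _
    rw [hwf.fix_eq]
  refine ⟨r, par, Finset.univ.filter J, hadj, ?_, ?_, ?_⟩
  · intro p hr hp v
    induction hn : G.dist r v using Nat.strong_induction_on generalizing v with
    | _ n ih =>
      by_cases hv : v = r
      · exact hv ▸ hr
      · exact hp v hv (ih _ (by have := hdist v hv; omega) _ rfl)
  · intro v hv hvI hp
    simp only [Finset.mem_filter, Finset.mem_univ, true_and] at hvI hp
    exact (hJ _).1 hp v ⟨hv, rfl⟩ hvI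
  · intro u hu
    simp only [Finset.mem_filter, Finset.mem_univ, true_and] at hu ⊢
    rw [hJ] at hu
    push Not at hu
    obtain ⟨c, ⟨-, hc⟩, hcJ⟩ := hu
    exact ⟨c, hcJ, hc⟩

/-! ### The contact graph and the bound -/

namespace IsBrickwork

variable {i : Fin 3} {P : Set Space} {F : Finset (Space × Space)} (hF : IsBrickwork i P F)

omit hF in
/-- The graph of the bricks, in which bricks that touch each other are adjacent. -/
def contactGraph (F : Finset (Space × Space)) : SimpleGraph F where
  Adj A B := A ≠ B ∧ ∃ p, p ∈ Icc A.1.1 A.1.2 ∧ p ∈ Icc B.1.1 B.1.2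
  symm := ⟨fun _ _ ⟨h, p, hp⟩ => ⟨h.symm, p, hp.symm⟩⟩
  loopless := ⟨fun _ h => h.1 rfl⟩

include hF

theorem connected_contactGraph (hP : IsConnected P) : (contactGraph F).Connected := by
  obtain ⟨p₀, hp₀⟩ := hP.nonempty
  obtain ⟨A₀, hA₀, hpA₀⟩ := (hF.mem_iff p₀).1 hp₀
  have : Nonempty F := ⟨⟨A₀, hA₀⟩⟩
  have hreach : ∀ A : F, (contactGraph F).Reachable ⟨A₀, hA₀⟩ A := by
    intro A
    by_contra hA
    let U : Set Space := ⋃ B ∈ {B : F | (contactGraph F).Reachable ⟨A₀, hA₀⟩ B}, Icc B.1.1 B.1.2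
    let V : Set Space := ⋃ B ∈ {B : F | ¬ (contactGraph F).Reachable ⟨A₀, hA₀⟩ B}, Icc B.1.1 B.1.2
    have hU : IsClosed U := (toFinite _).isClosed_biUnion fun B _ => isClosed_Icc
    have hV : IsClosed V := (toFinite _).isClosed_biUnion fun B _ => isClosed_Icc
    obtain ⟨q, -, hqU, hqV⟩ := isPreconnected_closed_iff.1 hP.isPreconnected U V hU hV
      (fun q hq => by
        obtain ⟨B, hB, hqB⟩ := (hF.mem_iff q).1 hq
        by_cases h : (contactGraph F).Reachable ⟨A₀, hA₀⟩ ⟨B, hB⟩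
        · exact Or.inl (mem_iUnion₂.2 ⟨⟨B, hB⟩, h, hqB⟩)
        · exact Or.inr (mem_iUnion₂.2 ⟨⟨B, hB⟩, h, hqB⟩))
      ⟨p₀, hp₀, mem_iUnion₂.2 ⟨⟨A₀, hA₀⟩, SimpleGraph.Reachable.refl _, hpA₀⟩⟩
      ⟨A.1.1, (hF.mem_iff _).2 ⟨A.1, A.2, le_rfl, fun j => (hF.lt _ A.2 j).le⟩,
        mem_iUnion₂.2 ⟨A, hA, le_rfl, fun j => (hF.lt _ A.2 j).le⟩⟩
    obtain ⟨B, hB, hqB⟩ := mem_iUnion₂.1 hqU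
    obtain ⟨C, hC, hqC⟩ := mem_iUnion₂.1 hqV
    refine hC (SimpleGraph.Reachable.trans hB ?_)
    have hBC : B ≠ C := fun h => hC (h ▸ hB)
    exact SimpleGraph.Adj.reachable ⟨hBC, q, hqB, hqC⟩
  exact SimpleGraph.connected_iff_exists_forall_reachable _ |>.2 ⟨_, hreach⟩

open Classical in
/-- Bricks that touch each other and have different horizontal rectangles share at most two
corners. -/
theorem card_inter_boxCorners_le {A B : Space × Space} (hA : A ∈ F) (hB : B ∈ F)
    (hi : A.2 i = B.1 i) {j : Fin 3} (hj : j ≠ i) (hne : A.1 j ≠ B.1 j ∨ A.2 j ≠ B.2 j) :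
    (boxCorners A ∩ boxCorners B).card ≤ 2 := by
  obtain ⟨d, hdi, hdj, hcov⟩ : ∃ d, d ≠ i ∧ d ≠ j ∧ ∀ k, k = i ∨ k = j ∨ k = d := by
    clear hi hne hF
    revert i j; decide
  have hA' := hF.lt A hA
  have hB' := hF.lt B hB
  have hval : ∀ p ∈ boxCorners A ∩ boxCorners B, ∀ k,
      (p k = A.1 k ∨ p k = A.2 k) ∧ (p k = B.1 k ∨ p k = B.2 k) := fun p hp k =>
    ⟨mem_boxCorners.1 (Finset.mem_inter.1 hp).1 k, mem_boxCorners.1 (Finset.mem_inter.1 hp).2 k⟩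
  refine (Finset.card_le_card_of_injOn (t := {A.1 d, A.2 d}) (fun p => p d) ?_ ?_).trans
    Finset.card_le_two
  · intro p hp
    simpa using (hval p hp d).1
  · intro p hp q hq hpq
    funext k
    have a := hA' k
    have b := hB' k
    rcases hcov k with rfl | rfl | rfl
    · have h1 := hval p hp k
      have h2 := hval q hq k
      rcases h1 with ⟨e1 | e1, e2 | e2⟩ <;> rcases h2 with ⟨e3 | e3, e4 | e4⟩ <;> linarith
    · have h1 := hval p hp k
      have h2 := hval q hq k
      by_contra hpqk
      -- the two corners differ in the direction `k`, so they are both ends of both intervals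
      rcases h1 with ⟨e1 | e1, e2 | e2⟩ <;> rcases h2 with ⟨e3 | e3, e4 | e4⟩ <;>
        first
        | exact hpqk (by linarith)
        | (rcases hne with h | h <;> exact h (by linarith))
    · exact hpq

open Classical in
/-- Counting the corners of all bricks: a point is a corner of at most two bricks, and if it is a
corner of two, then it is a shared corner of a contact. -/
theorem eight_mul_card_le {S : Finset Space}
    (hS : ∀ A ∈ F, ∀ B ∈ F, A ≠ B → ∀ p ∈ boxCorners A, p ∈ boxCorners B → p ∈ S) :
    8 * F.card ≤ ((F.biUnion boxCorners).filter fun v =>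
      (F.filter fun B => v ∈ boxCorners B).card = 1).card + 2 * S.card := by
  set W := F.biUnion boxCorners with hW
  have hcorner : ∀ v, ∀ B ∈ F.filter fun B => v ∈ boxCorners B, B ∈ F ∧ v ∈ boxCorners B ∧
      v ∈ Icc B.1 B.2 := fun v B hB => by
    obtain ⟨h1, h2⟩ := Finset.mem_filter.1 hB
    exact ⟨h1, h2, mem_Icc_of_mem_boxCorners (hF.lt B h1) h2⟩
  have hmult : ∀ v ∈ W, (F.filter fun B => v ∈ boxCorners B).card ≤
      (if (F.filter fun B => v ∈ boxCorners B).card = 1 then 1 else 0) + 2 * if v ∈ S then 1 else 0 := by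
    intro v _
    rcases Nat.lt_trichotomy (F.filter fun B => v ∈ boxCorners B).card 1 with h | h | h
    · omega
    · simp [h]
    · have h2 : v ∈ S := by
        obtain ⟨A, hA, B, hB, hAB⟩ := Finset.one_lt_card.1 h
        obtain ⟨a1, a2, -⟩ := hcorner v A hA
        obtain ⟨b1, b2, -⟩ := hcorner v B hB
        exact hS A a1 B b1 hAB v a2 b2
      have h3 : (F.filter fun B => v ∈ boxCorners B).card ≤ 2 := by
        by_contra hlt
        obtain ⟨A, B, C, hA, hB, hC, hAB, hAC, hBC⟩ := Finset.two_lt_card_iff.1 (not_le.1 hlt)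
        obtain ⟨a1, -, a2⟩ := hcorner v A hA
        obtain ⟨b1, -, b2⟩ := hcorner v B hB
        obtain ⟨c1, -, c2⟩ := hcorner v C hC
        rcases hF.eq_or_eq_of_mem a1 b1 c1 hAB a2 b2 c2 with e | e
        exacts [hAC e.symm, hBC e.symm]
      rw [if_pos h2]
      omega
  have hsum : ∑ B ∈ F, (boxCorners B).card = ∑ v ∈ W, (F.filter fun B => v ∈ boxCorners B).card := by
    have h1 : ∀ B ∈ F, (boxCorners B).card = ∑ v ∈ W, if v ∈ boxCorners B then 1 else 0 := by
      intro B hB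
      rw [← Finset.card_filter]
      congr 1
      ext v
      simp only [Finset.mem_filter]
      exact ⟨fun h => ⟨Finset.mem_biUnion.2 ⟨B, hB, h⟩, h⟩, fun h => h.2⟩
    rw [Finset.sum_congr rfl h1, Finset.sum_comm]
    exact Finset.sum_congr rfl fun v _ => (Finset.card_filter _ _).symm
  have h8 : ∑ B ∈ F, (boxCorners B).card = 8 * F.card := by
    rw [Finset.sum_congr rfl fun B hB => card_boxCorners (hF.lt B hB)]
    simp [mul_comm]
  rw [← h8, hsum]
  refine (Finset.sum_le_sum hmult).trans ?_
  rw [Finset.sum_add_distrib, ← Finset.mul_sum, ← Finset.card_filter, ← Finset.card_filter]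
  gcongr
  intro v hv
  exact (Finset.mem_filter.1 hv).2

/-- The upper bound on the number of guards, in terms of a spanning tree of the contact graph and of
a set `I` of bricks that is independent in the tree. -/
theorem eight_mul_card_add_four_le
    (hred : ∀ A ∈ F, ∀ B ∈ F, A.2 i = B.1 i → ∃ j, j ≠ i ∧ (A.1 j ≠ B.1 j ∨ A.2 j ≠ B.2 j))
    {r : F} {par : F → F} {I : Finset F} (hadj : ∀ v, (contactGraph F).Adj v (par v))
    (hind : ∀ p : F → Prop, p r → (∀ v, v ≠ r → p (par v) → p v) → ∀ v, p v)
    (hI : ∀ v, v ≠ r → v ∈ I → par v ∉ I) {g : ℕ} (hg : polyhedronGenus P = (g : ℕ∞)) :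
    8 * I.card + 4 ≤ (polyhedronEdges P).ncard + 8 * g := by
  classical
  -- the contacts, as pairs of a lower and an upper brick
  set E := (F ×ˢ F).filter fun x => x.1.2 i = x.2.1 i ∧
    ∃ p, p ∈ Icc x.1.1 x.1.2 ∧ p ∈ Icc x.2.1 x.2.2 with hE
  have hEmem : ∀ x, x ∈ E ↔ (x.1 ∈ F ∧ x.2 ∈ F) ∧ x.1.2 i = x.2.1 i ∧
      ∃ p, p ∈ Icc x.1.1 x.1.2 ∧ p ∈ Icc x.2.1 x.2.2 := fun x => by
    rw [hE, Finset.mem_filter, Finset.mem_product]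
  -- the contacts in the tree
  set Tr := E.filter fun x => ∃ v : F, v ≠ r ∧ (x = (v.1, (par v).1) ∨ x = ((par v).1, v.1)) with hTr
  have hcardF : Fintype.card F = F.card := Fintype.card_coe F
  have hTrcard : Tr.card + 1 ≤ F.card := by
    have hsub : Tr ⊆ (Finset.univ.erase r).image fun v : F =>
        if v.1.2 i = (par v).1.1 i then (v.1, (par v).1) else ((par v).1, v.1) := by
      intro x hx
      obtain ⟨hxE, v, hv, hxv⟩ := Finset.mem_filter.1 hx
      obtain ⟨-, h1, -⟩ := (hEmem x).1 hxE
      refine Finset.mem_image.2 ⟨v, Finset.mem_erase.2 ⟨hv, Finset.mem_univ _⟩, ?_⟩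
      rcases hxv with rfl | rfl
      · rw [if_pos h1]
      · rw [if_neg]
        intro h2
        have := hF.lt _ v.2 i
        have := hF.lt _ (par v).2 i
        simp only at h1
        linarith
    have h1 := (Finset.card_le_card hsub).trans Finset.card_image_le
    rw [Finset.card_erase_of_mem (Finset.mem_univ r), Finset.card_univ, hcardF] at h1
    have : 0 < F.card := Finset.card_pos.2 ⟨_, r.2⟩
    omega
  -- the corners shared by the two bricks of a contact
  set Sh : (Space × Space) × (Space × Space) → Finset Space :=
    fun x => boxCorners x.1 ∩ boxCorners x.2 with hSh
  have hShcard : ∀ x ∈ E, (Sh x).card ≤ 2 := by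
    intro x hx
    obtain ⟨⟨h1, h2⟩, h3, -⟩ := (hEmem x).1 hx
    obtain ⟨j, hj, hne⟩ := hred _ h1 _ h2 h3
    exact hF.card_inter_boxCorners_le h1 h2 h3 hj hne
  have hS1 : (Tr.biUnion Sh).card ≤ Tr.card * 2 :=
    Finset.card_biUnion_le_card_mul _ _ _ fun x hx => hShcard x (Finset.mem_filter.1 hx).1
  have hS2 : (E.biUnion Sh).card ≤ (Tr.biUnion Sh).card + (E \ Tr).card * 2 := by
    have h1 : E.biUnion Sh ⊆ Tr.biUnion Sh ∪ (E \ Tr).biUnion Sh := by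
      rw [← Finset.union_biUnion, Finset.union_sdiff_of_subset (Finset.filter_subset _ _)]
    refine (Finset.card_le_card h1).trans ((Finset.card_union_le _ _).trans ?_)
    gcongr
    exact Finset.card_biUnion_le_card_mul _ _ _ fun x hx => hShcard x (Finset.mem_sdiff.1 hx).1
  -- the complement of `I` covers the edges of the tree, and a brick has eight corners only
  have hS3 : (Tr.biUnion Sh).card ≤ (Iᶜ).card * 8 := by
    have hsub : Tr.biUnion Sh ⊆ (Iᶜ).biUnion fun v => boxCorners v.1 := by
      intro p hp
      obtain ⟨x, hx, hpx⟩ := Finset.mem_biUnion.1 hp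
      obtain ⟨-, v, hv, hxv⟩ := Finset.mem_filter.1 hx
      obtain ⟨p1, p2⟩ := Finset.mem_inter.1 hpx
      have hpv : p ∈ boxCorners v.1 ∧ p ∈ boxCorners (par v).1 := by
        rcases hxv with rfl | rfl
        exacts [⟨p1, p2⟩, ⟨p2, p1⟩]
      by_cases hvI : v ∈ I
      · exact Finset.mem_biUnion.2 ⟨par v, Finset.mem_compl.2 (hI v hv hvI), hpv.2⟩
      · exact Finset.mem_biUnion.2 ⟨v, Finset.mem_compl.2 hvI, hpv.1⟩
    refine (Finset.card_le_card hsub).trans (Finset.card_biUnion_le_card_mul _ _ _ fun v _ => ?_)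
    exact (card_boxCorners (hF.lt _ v.2)).le
  have hcompl : I.card + (Iᶜ).card = F.card := by
    rw [Finset.card_add_card_compl, hcardF]
  -- the contacts outside the tree are bounded by the genus
  have hgenus : (E \ Tr).card ≤ g := by
    have hcurves := hF.hasNonseparatingCurves (E := E \ Tr)
      (fun x hx => by
        obtain ⟨⟨h1, h2⟩, h3, h4⟩ := (hEmem x).1 (Finset.mem_sdiff.1 hx).1
        exact ⟨h1, h2, h3, h4⟩)
      (fun Q ⟨r₀, hr₀, hQ⟩ hstep => by
        have hpar : ∀ v : F, v ≠ r → (v.1, (par v).1) ∉ E \ Tr ∧ ((par v).1, v.1) ∉ E \ Tr := by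
          intro v hv
          simp only [Finset.mem_sdiff, not_and, not_not]
          exact ⟨fun h => Finset.mem_filter.2 ⟨h, v, hv, Or.inl rfl⟩,
            fun h => Finset.mem_filter.2 ⟨h, v, hv, Or.inr rfl⟩⟩
        have hne : ∀ v : F, v.1 ≠ (par v).1 := fun v h => (hadj v).1 (Subtype.ext h)
        have hQr : Q r.1 := by
          refine hind (fun v => Q v.1 → Q r.1) id (fun v hv ih hQv => ih ?_) ⟨r₀, hr₀⟩ hQ
          obtain ⟨p, hp⟩ := (hadj v).2
          exact hstep _ (par v).2 _ v.2 (hne v).symm ⟨p, hp.symm⟩ (hpar v hv).2 (hpar v hv).1 hQv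
        intro A hA
        refine hind (fun v => Q v.1) hQr (fun v hv ih => ?_) ⟨A, hA⟩
        exact hstep _ v.2 _ (par v).2 (hne v) (hadj v).2 (hpar v hv).1 (hpar v hv).2 ih)
    have : ((E \ Tr).card : ℕ∞) ≤ polyhedronGenus P :=
      le_iSup₂ (f := fun (n : ℕ) (_ : n ∈ {n : ℕ | HasNonseparatingCurves (frontier P) n}) =>
        (n : ℕ∞)) _ hcurves
    rw [hg] at this
    exact_mod_cast this
  have hcorners := hF.eight_mul_card_le (S := E.biUnion Sh) (by
    intro A hA B hB hAB p hpA hpB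
    have h1 := mem_Icc_of_mem_boxCorners (hF.lt A hA) hpA
    have h2 := mem_Icc_of_mem_boxCorners (hF.lt B hB) hpB
    rcases (hF.contact A hA B hB hAB p h1 h2).1 with e | e
    · exact Finset.mem_biUnion.2 ⟨(A, B), (hEmem _).2 ⟨⟨hA, hB⟩, e, p, h1, h2⟩,
        Finset.mem_inter.2 ⟨hpA, hpB⟩⟩
    · exact Finset.mem_biUnion.2 ⟨(B, A), (hEmem _).2 ⟨⟨hB, hA⟩, e, p, h2, h1⟩,
        Finset.mem_inter.2 ⟨hpB, hpA⟩⟩)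
  have hedges := hF.three_mul_card_le ((F.biUnion boxCorners).filter fun v =>
    (F.filter fun B => v ∈ boxCorners B).card = 1) fun v hv => (Finset.mem_filter.1 hv).2
  omega

/-- If `A` and `B` are bricks that touch each other, some point of a reflex edge sees both of them
entirely. -/
theorem exists_guard
    (hred : ∀ A ∈ F, ∀ B ∈ F, A.2 i = B.1 i → ∃ j, j ≠ i ∧ (A.1 j ≠ B.1 j ∨ A.2 j ≠ B.2 j))
    {A B : F} (h : (contactGraph F).Adj A B) :
    ∃ e ∈ reflexEdges P, ∃ q ∈ e, ∀ p, p ∈ Icc A.1.1 A.1.2 ∨ p ∈ Icc B.1.1 B.1.2 → Sees P q p := by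
  obtain ⟨hAB, p, hpA, hpB⟩ := h
  have hne : A.1 ≠ B.1 := fun h => hAB (Subtype.ext h)
  have hsub : ∀ C : F, Icc C.1.1 C.1.2 ⊆ P := fun C p hp => (hF.mem_iff p).2 ⟨C.1, C.2, hp⟩
  have hsees : ∀ q ∈ Icc A.1.1 A.1.2, q ∈ Icc B.1.1 B.1.2 → ∀ p,
      p ∈ Icc A.1.1 A.1.2 ∨ p ∈ Icc B.1.1 B.1.2 → Sees P q p := by
    rintro q hqA hqB p (hp | hp)
    · exact ((convex_Icc A.1.1 A.1.2).segment_subset hqA hp).trans (hsub A)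
    · exact ((convex_Icc B.1.1 B.1.2).segment_subset hqB hp).trans (hsub B)
  rcases (hF.contact _ A.2 _ B.2 hne p hpA hpB).1 with e | e
  · obtain ⟨j, hj, hjne⟩ := hred _ A.2 _ B.2 e
    obtain ⟨e, he, q, hq, hqA, hqB⟩ := hF.exists_reflexEdge A.2 B.2 e hpA hpB hj hjne
    exact ⟨e, he, q, hq, hsees q hqA hqB⟩
  · obtain ⟨j, hj, hjne⟩ := hred _ B.2 _ A.2 e
    obtain ⟨e, he, q, hq, hqB, hqA⟩ := hF.exists_reflexEdge B.2 A.2 e hpB hpA hj hjne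
    exact ⟨e, he, q, hq, hsees q hqA hqB⟩

theorem nontrivial_of_not_convex (hP : ¬ Convex ℝ P) : Nontrivial F := by
  rw [← not_subsingleton_iff_nontrivial]
  intro hsub
  refine hP fun x hx y hy a b ha hb hab => ?_
  obtain ⟨A, hA, hxA⟩ := (hF.mem_iff x).1 hx
  obtain ⟨B, hB, hyB⟩ := (hF.mem_iff y).1 hy
  obtain rfl : A = B := congrArg Subtype.val (Subsingleton.elim (⟨A, hA⟩ : F) ⟨B, hB⟩)
  exact (hF.mem_iff _).2 ⟨A, hA, convex_Icc A.1 A.2 hxA hyB ha hb hab⟩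

end IsBrickwork

theorem theoremt4 (P : Set Space) (hP : IsOrthogonalPolyhedron P) (h2 : IsTwoReflex P)
    (hnc : ¬ Convex ℝ P) (m g : ℕ) (hm : (polyhedronEdges P).ncard = m)
    (hg : polyhedronGenus P = (g : ℕ∞)) :
    (∃ G : Finset (Set Space), (G : Set (Set Space)) ⊆ reflexEdges P ∧
      (G.card : ℤ) ≤ ⌊((m : ℚ) - 4) / 8⌋ + (g : ℤ) ∧ GuardedByOpen P (G : Set (Set Space))) ∧
    (∃ G : Finset (Set Space), (G : Set (Set Space)) ⊆ reflexEdges P ∧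
      (G.card : ℤ) ≤ ⌊((m : ℚ) - 4) / 8⌋ + (g : ℤ) ∧ GuardedByClosed P (G : Set (Set Space))) := by
  classical
  obtain ⟨i, hi⟩ := h2
  have hr : reflexEdgePoints P i = ∅ := by
    rw [eq_empty_iff_forall_notMem]
    intro p hp
    have : connectedComponentIn (reflexEdgePoints P i) p ∈ reflexEdgesAlong P i := ⟨p, hp, rfl⟩
    rw [hi] at this
    exact this
  obtain ⟨S, hS, hbox, hPS⟩ := hP.union_boxes
  obtain ⟨F, hF, hred⟩ :=
    exists_reduced_isBrickwork (exists_isBrickwork hP.manifold hr hS hbox hPS)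
  have : Nontrivial F := hF.nontrivial_of_not_convex hnc
  obtain ⟨r, par, I, hadj, hind, hI, hcover⟩ :=
    (hF.connected_contactGraph hP.connected).exists_parent
  have hbound := hF.eight_mul_card_add_four_le hred hadj hind hI hg
  rw [hm] at hbound
  choose e he q hq hsees using fun v => hF.exists_guard hred (hadj v)
  have hsub : ((I.image e : Finset (Set Space)) : Set (Set Space)) ⊆ reflexEdges P := by
    intro x hx
    obtain ⟨v, -, rfl⟩ := Finset.mem_image.1 hx
    exact he v
  have hcard : ((I.image e).card : ℤ) ≤ ⌊((m : ℚ) - 4) / 8⌋ + (g : ℤ) := by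
    have h1 : (I.image e).card ≤ I.card := Finset.card_image_le
    rw [← sub_le_iff_le_add, Int.le_floor, le_div_iff₀ (by norm_num)]
    push_cast
    have h2 : (8 * I.card + 4 : ℚ) ≤ m + 8 * g := by exact_mod_cast hbound
    have h3 : ((I.image e).card : ℚ) ≤ I.card := by exact_mod_cast h1
    linarith
  have hopen : GuardedByOpen P ((I.image e : Finset (Set Space)) : Set (Set Space)) := by
    intro p hp
    obtain ⟨A, hA, hpA⟩ := (hF.mem_iff p).1 hp
    by_cases hAI : (⟨A, hA⟩ : F) ∈ I
    · exact ⟨_, Finset.mem_image_of_mem e hAI, _, hq _, hsees _ p (Or.inl hpA)⟩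
    · obtain ⟨c, hc, hpar⟩ := hcover _ hAI
      refine ⟨_, Finset.mem_image_of_mem e hc, _, hq _, hsees _ p (Or.inr ?_)⟩
      rw [hpar]
      exact hpA
  refine ⟨⟨I.image e, hsub, hcard, hopen⟩, ⟨I.image e, hsub, hcard, fun p hp => ?_⟩⟩
  obtain ⟨x, hx, y, hy, hxy⟩ := hopen p hp
  exact ⟨x, hx, y, subset_closure hy, hxy⟩
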